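/- \textbf{Theorem (asymptotic power of the semi-supervised kernel test xssMMD with the linear kernel).} Let $\Phi$ be the distribution function of $N(0,1)$, $z_p=\Phi^{-1}(p)$, and let $\alpha\in(0,1)$. Consider a sequence of experiments along which the sample size $n\to\infty$ runs through even integers and the dimension $d=d_n$ satisfies $d/n\to\tau\in(0,\infty)$; all quantities below may depend on the experiment. The constants $c,C$ do not. \emph{Model.} Let $(X,V)\sim P_{XV}=N\big((\mu_X,\mu_V),\Sigma\big)$ and $(Y,W)\sim P_{YW}=N\big((\mu_Y,\mu_W),\Sigma\big)$, where $X,V,Y,W$ are $\mathbb R^d$-valued and $\Sigma=\begin{pmatrix}\Sigma_{11}&\Sigma_{12}\\ \Sigma_{21}&\Sigma_{22}\end{pmatrix}$ is a common (positive semidefinite) covariance matrix. There are constants $0<c\le C$ such that all eigenvalues of $\Sigma_{11}$ and $\Sigma_{22}$ lie in $[c,C]$, and $\|\mu_X\|^2=O(\sqrt d/n)$, $\|\mu_Y\|^2=O(\sqrt d/n)$. \emph{Data} (all independent). Labeled pairs $(X_i,V_i)_{i=1}^{n}$ i.i.d. from $P_{XV}$; unlabeled covariates $V_{n+1},\dots,V_{2n}$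 i.i.d. with the law of $V$; an additional sample $\widetilde X_1,\dots,\widetilde X_n$ i.i.d. with the law of $X$; and likewise $(Y_i,W_i)_{i=1}^n$, $W_{n+1},\dots,W_{2n}$, $\widetilde Y_1,\dots,\widetilde Y_n$ from $P_{YW}$ and its marginals (so $n_1=n_2=m_1=m_2=n$). \emph{Statistic.} With the linear kernel the witness function is $\widehat f(x)=\frac1n\sum_{i=1}^n\langle\widetilde X_i,x\rangle-\frac1n\sum_{i=1}^n\langle\widetilde Y_i,x\rangle$. A (measurable) regression procedure produces, from a function $f$ and a training sample of $n/2$ labeled pairs, an estimate $v\mapsto\widehat{\mathbb E}[f(X)\mid V=v]$; another one is used for $(Y,W)$. For $1\le i\le 2n$ let $\widehat e_i=\widehat{\mathbb E}[\widehat f(X_i)\mid V_i]$ be the estimate for $f=\widehat f$, evaluated at $V_i$ and trained on the labeled pairs with even index if $i$ is odd and on those with odd index if $i$ is even, and put $\widehat r_i=\widehat f(X_i)-\widehat e_i$ for $1\le i\le n$. Let $$\widehat\mu_X^\dagger=\frac1n\sum_{i=1}^n\widehat r_i+\frac1{2n}\sum_{i=1}^{2n}\widehat e_i,\qquad \widehat\sigma_X^{\dagger2}=\frac1n\Big\{\frac1n\sum_{i=1}^n\widehat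 r_i^2-\Big(\frac1n\sum_{i=1}^n\widehat r_i\Big)^2\Big\}+\frac1{2n}\Big\{\frac1{2n}\sum_{i=1}^{2n}\widehat e_i^2-\Big(\frac1{2n}\sum_{i=1}^{2n}\widehat e_i\Big)^2\Big\},$$ and define $\widehat\mu_Y^\dagger,\widehat\sigma_Y^{\dagger2}$ in the same way from $(Y,W)$. The xssMMD test rejects, $\Psi_{\mathrm{xss}}=1$, if $(\widehat\mu_X^\dagger-\widehat\mu_Y^\dagger)/\sqrt{\widehat\sigma_X^{\dagger2}+\widehat\sigma_Y^{\dagger2}}>z_{1-\alpha}$, and $\Psi_{\mathrm{xss}}=0$ otherwise. \emph{Consistency of the estimated conditional expectations.} With $(X,V)$ independent of $\widehat f$ and of the training sample, $$\frac{\mathbb E\big[\{\mathbb E[\widehat f(X)\mid V,\widehat f]-\widehat{\mathbb E}[\widehat f(X)\mid V]\}^2\,\big|\,\widehat f\,\big]}{\mathrm{Var}\{\widehat f(X)\mid\widehat f\}}=o_P(1),$$ where the expectation in the numerator is over the new pair $(X,V)$ and over a training sample of $n/2$ independent pairs from $P_{XV}$, and the analogous condition holds for $(Y,W)$. \emph{Conclusion.}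 As $n\to\infty$, $$\mathbb E[\Psi_{\mathrm{xss}}]=\Phi\left(z_\alpha+\frac{n\,\|\mu_X-\mu_Y\|^2}{\sqrt{4\,\mathrm{tr}(\Sigma_{11}^2)-2\,\mathrm{tr}(\Sigma_{12}\Sigma_{22}^{-1}\Sigma_{21}\Sigma_{11})}}\right)+o(1).$$ -/

import Mathlib

open MeasureTheory ProbabilityTheory Filter Topology
open scoped ENNReal RealInnerProductSpace

namespace XssMMD

noncomputable section

/-- The feature space `ℝ^d`. -/
abbrev Vec (d : ℕ) : Type := EuclideanSpace ℝ (Fin d)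

/-- The joint law `N((μ₁, μ₂), [[S₁₁, S₁₂], [S₂₁, S₂₂]])` of a pair of random vectors of `ℝ^d`. -/
def gaussianPair {d : ℕ} (μ₁ μ₂ : Vec d) (S₁₁ S₁₂ S₂₁ S₂₂ : Matrix (Fin d) (Fin d) ℝ) :
    Measure (Vec d × Vec d) :=
  (multivariateGaussian (WithLp.toLp 2 (Sum.elim (fun i => μ₁ i) (fun i => μ₂ i)))
      (Matrix.fromBlocks S₁₁ S₁₂ S₂₁ S₂₂)).map
    (fun z : EuclideanSpace ℝ (Fin d ⊕ Fin d) =>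
      ((WithLp.toLp 2 (fun i => z (Sum.inl i)) : Vec d),
        (WithLp.toLp 2 (fun i => z (Sum.inr i)) : Vec d)))

/-- The observations of one group: the independent copies `X̃₁, …, X̃ₙ` used for the witness
function, the labeled pairs `(X₁, V₁), …, (Xₙ, Vₙ)`, and the unlabeled covariates
`Vₙ₊₁, …, Vₙ₊ₘ`. Indices are `0`-based. -/
abbrev GroupData (d n m : ℕ) : Type :=
  (Fin n → Vec d) × (Fin n → Vec d × Vec d) × (Fin m → Vec d)

/-- The law of the observations of one group: everything is mutually independent, the pairs have
law `P`, the copies and the unlabeled covariates have its first and its second marginal. -/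
def groupLaw {d : ℕ} (P : Measure (Vec d × Vec d)) (n m : ℕ) : Measure (GroupData d n m) :=
  (Measure.pi fun _ : Fin n => P.fst).prod
    ((Measure.pi fun _ : Fin n => P).prod (Measure.pi fun _ : Fin m => P.snd))

/-- The law of all observations, the two groups being independent. -/
def dataLaw {d : ℕ} (P Q : Measure (Vec d × Vec d)) (n₁ n₂ m₁ m₂ : ℕ) :
    Measure (GroupData d n₁ m₁ × GroupData d n₂ m₂) :=
  (groupLaw P n₁ m₁).prod (groupLaw Q n₂ m₂)

/-- The linear kernel `k(x, y) = ⟨x, y⟩`. -/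
def linearKernel {d : ℕ} (x y : Vec d) : ℝ := ⟪x, y⟫

/-- The estimated witness function
`f̂ = n₁⁻¹ ∑ᵢ k(X̃ᵢ, ·) - n₂⁻¹ ∑ᵢ k(Ỹᵢ, ·)`. -/
def witness {d n₁ n₂ : ℕ} (k : Vec d → Vec d → ℝ) (X : Fin n₁ → Vec d) (Y : Fin n₂ → Vec d) :
    Vec d → ℝ :=
  fun x => (∑ i, k (X i) x) / n₁ - (∑ i, k (Y i) x) / n₂

/-- A regression procedure: from a function `f` and a training sample of `h` labeled pairs
`(Xᵢ, Vᵢ)`, it produces an estimate `v ↦ Ê[f(X) | V = v]`. -/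
abbrev Regression (d h : ℕ) : Type :=
  (Vec d → ℝ) → (Fin h → Vec d × Vec d) → Vec d → ℝ

/-- Applied to the witness function, the regression procedure is a measurable function of the
data and of the evaluation point. -/
def MeasurableRegression {d h : ℕ} (k : Vec d → Vec d → ℝ) (n₁ n₂ : ℕ) (est : Regression d h) :
    Prop :=
  Measurable fun p : ((Fin n₁ → Vec d) × (Fin n₂ → Vec d)) × (Fin h → Vec d × Vec d) × Vec d =>
    est (witness k p.1.1 p.1.2) p.2.1 p.2.2

/-- The half of a sample with odd `1`-based indices. -/
def foldA {α : Type} {n : ℕ} (L : Fin n → α) : Fin (n / 2) → α :=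
  fun j => L ⟨2 * j, by omega⟩

/-- The half of a sample with even `1`-based indices. -/
def foldB {α : Type} {n : ℕ} (L : Fin n → α) : Fin (n / 2) → α :=
  fun j => L ⟨2 * j + 1, by omega⟩

/-- All covariates of a group, labeled ones first. -/
def covariates {d n m : ℕ} (L : Fin n → Vec d × Vec d) (U : Fin m → Vec d) :
    Fin (n + m) → Vec d :=
  Fin.append (fun i => (L i).2) U

/-- The cross-fitted values `Ê[f(Xᵢ) | Vᵢ]`, `1 ≤ i ≤ n + m`: the estimator is trained on the
labeled pairs with even index if `i` is odd, and on those with odd index if `i` is even. -/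
def crossFit {d n m : ℕ} (est : Regression d (n / 2)) (f : Vec d → ℝ)
    (L : Fin n → Vec d × Vec d) (U : Fin m → Vec d) (i : Fin (n + m)) : ℝ :=
  if Odd ((i : ℕ) + 1) then est f (foldB L) (covariates L U i)
  else est f (foldA L) (covariates L U i)

/-- The residuals `f(Xᵢ) - Ê[f(Xᵢ) | Vᵢ]`, `1 ≤ i ≤ n`. -/
def residual {d n m : ℕ} (est : Regression d (n / 2)) (f : Vec d → ℝ)
    (L : Fin n → Vec d × Vec d) (U : Fin m → Vec d) (i : Fin n) : ℝ :=
  f (L i).1 - crossFit est f L U (Fin.castAdd m i)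

/-- Sample mean. -/
def empMean {n : ℕ} (a : Fin n → ℝ) : ℝ := (∑ i, a i) / n

/-- Sample variance `n⁻¹ ∑ aᵢ² - (n⁻¹ ∑ aᵢ)²`. -/
def empVar {n : ℕ} (a : Fin n → ℝ) : ℝ := empMean (fun i => a i ^ 2) - empMean a ^ 2

/-- The cross-fitted semi-supervised mean estimator of one group. -/
def crossMean {d n m : ℕ} (est : Regression d (n / 2)) (f : Vec d → ℝ)
    (L : Fin n → Vec d × Vec d) (U : Fin m → Vec d) : ℝ :=
  empMean (residual est f L U) + empMean (crossFit est f L U)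

/-- The cross-fitted estimator of the variance of the mean estimator of one group. -/
def crossVar {d n m : ℕ} (est : Regression d (n / 2)) (f : Vec d → ℝ)
    (L : Fin n → Vec d × Vec d) (U : Fin m → Vec d) : ℝ :=
  empVar (residual est f L U) / n + empVar (crossFit est f L U) / ((n + m : ℕ) : ℝ)

/-- The witness function of a data set. -/
def dataWitness {d n₁ n₂ m₁ m₂ : ℕ} (k : Vec d → Vec d → ℝ)
    (D : GroupData d n₁ m₁ × GroupData d n₂ m₂) : Vec d → ℝ :=
  witness k D.1.1 D.2.1

/-- The studentized cross-fitted statistic. -/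
def statistic {d n₁ n₂ m₁ m₂ : ℕ} (k : Vec d → Vec d → ℝ)
    (estX : Regression d (n₁ / 2)) (estY : Regression d (n₂ / 2))
    (D : GroupData d n₁ m₁ × GroupData d n₂ m₂) : ℝ :=
  (crossMean estX (dataWitness k D) D.1.2.1 D.1.2.2 -
      crossMean estY (dataWitness k D) D.2.2.1 D.2.2.2) /
    √(crossVar estX (dataWitness k D) D.1.2.1 D.1.2.2 +
      crossVar estY (dataWitness k D) D.2.2.1 D.2.2.2)

/-- The standard normal distribution function. -/
def Phi (x : ℝ) : ℝ := cdf (gaussianReal 0 1) x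

/-- The quantile of order `p ∈ (0, 1)` of the standard normal distribution. -/
def z (p : ℝ) : ℝ := sInf {x : ℝ | p ≤ Phi x}

/-- The power of the test of nominal level `α`, which rejects when the statistic exceeds
`z (1 - α)`: the probability of rejection. -/
def power {d : ℕ} (k : Vec d → Vec d → ℝ) (P Q : Measure (Vec d × Vec d)) (n₁ n₂ m₁ m₂ : ℕ)
    (estX : Regression d (n₁ / 2)) (estY : Regression d (n₂ / 2)) (α : ℝ) : ℝ :=
  (dataLaw P Q n₁ n₂ m₁ m₂).real {D | z (1 - α) < statistic k estX estY D}

/-- For a given function `f`, the ratio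
`E[(E[f(X) | V] - Ê[f(X) | V])²] / Var(f(X))`, where `(X, V) ∼ P` is independent of the training
sample of `h` independent pairs with law `P`, over which the expectation is taken as well.
As the witness function is independent of `(X, V)` and of the training sample, conditioning on it
amounts to taking it for `f`. -/
def relMSE {d h : ℕ} (P : Measure (Vec d × Vec d)) (est : Regression d h) (f : Vec d → ℝ) :
    ℝ≥0∞ :=
  (∫⁻ t, ∫⁻ p, ENNReal.ofReal
      (((P[fun q : Vec d × Vec d => f q.1 |
          MeasurableSpace.comap (Prod.snd : Vec d × Vec d → Vec d) inferInstance]) p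
        - est f t p.2) ^ 2) ∂P ∂(Measure.pi fun _ : Fin h => P)) /
    eVar[fun q : Vec d × Vec d => f q.1; P]

end

end XssMMD

/-!
Given the samples `X̃` and `Ỹ`, the witness function is `f = ⟪a, ·⟫` for a fixed vector `a`, and
`f(X)` is an affine function of `V` plus independent Gaussian noise. As the trained regressions are
independent of the data on which they are evaluated, replacing them by the true regression function
changes the mean and the variance estimators only by remainders of the size of the regression error.
What is left of the difference of the two mean estimators is exactly Gaussian with mean
`⟪μX - μY, a⟫` and variance `2 ⟪a, A a⟫ / n`, where `A = Σ₁₁ - Σ₁₂ Σ₂₂⁻¹ Σ₂₁ / 2`, and the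
studentizer estimates this variance consistently. The conditional power is therefore close to
`Φ(z_α + ⟪μX - μY, a⟫ / √(2 ⟪a, A a⟫ / n))`.

Unconditionally `a` has law `N(μX - μY, (2 / n) Σ₁₁)`. Because `‖μX - μY‖² = O(√d / n)` and
`d ∼ τ n`, second moments show that `⟪a, A a⟫` concentrates around `(2 / n) tr(A Σ₁₁)`, which stays
bounded away from zero, and `√n ⟪μX - μY, a⟫` around `√n ‖μX - μY‖²`. Integrating the conditional
power over `a` gives the limit.
-/

namespace XssMMD

open scoped Matrix NNReal

/-! ### The standard normal distribution function -/

lemma gaussianPDFReal_le (μ : ℝ) (v : ℝ≥0) (x : ℝ) :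
    gaussianPDFReal μ v x ≤ (√(2 * Real.pi * v))⁻¹ := by
  refine mul_le_of_le_one_right (by positivity) (Real.exp_le_one_iff.2 ?_)
  exact div_nonpos_of_nonpos_of_nonneg (neg_nonpos.2 (sq_nonneg _)) (by positivity)

lemma gaussianPDFReal_zero_one_le_one (x : ℝ) : gaussianPDFReal 0 1 x ≤ 1 := by
  refine (gaussianPDFReal_le 0 1 x).trans (inv_le_one_of_one_le₀ (Real.one_le_sqrt.2 ?_))
  rw [NNReal.coe_one]
  linarith [Real.pi_gt_three]

lemma Phi_sub {x y : ℝ} (h : x ≤ y) : Phi y - Phi x = (gaussianReal 0 1).real (Set.Ioc x y) := by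
  rw [Phi, Phi, cdf_eq_real, cdf_eq_real, ← Set.Iic_sdiff_Iic,
    measureReal_sdiff (Set.Iic_subset_Iic.2 h) measurableSet_Iic]

lemma Phi_mono : Monotone Phi := monotone_cdf _

lemma Phi_sub_le {x y : ℝ} (h : x ≤ y) : Phi y - Phi x ≤ y - x := by
  rw [Phi_sub h, Measure.real, gaussianReal_apply _ one_ne_zero]
  refine ENNReal.toReal_le_of_le_ofReal (by linarith) ?_
  calc ∫⁻ t in Set.Ioc x y, gaussianPDF 0 1 t ≤ ∫⁻ _ in Set.Ioc x y, (1 : ℝ≥0∞) :=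
        lintegral_mono fun t => ENNReal.ofReal_le_one.2 (gaussianPDFReal_zero_one_le_one t)
    _ = ENNReal.ofReal (y - x) := by simp

lemma abs_Phi_sub_le (x y : ℝ) : |Phi x - Phi y| ≤ |x - y| := by
  wlog h : y ≤ x generalizing x y
  · rw [abs_sub_comm, abs_sub_comm x]
    exact this y x (le_of_not_ge h)
  rw [abs_of_nonneg (sub_nonneg.2 (Phi_mono h)), abs_of_nonneg (sub_nonneg.2 h)]
  exact Phi_sub_le h

lemma abs_sub_Phi_le_of_Phi_le {p x η ε : ℝ} (hη : 0 ≤ η) (hlow : Phi (x - η) ≤ p + ε)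
    (hup : p ≤ Phi (x + η) + ε) : |p - Phi x| ≤ η + ε := by
  have Phi_low := Phi_sub_le (show x - η ≤ x by linarith)
  have Phi_up := Phi_sub_le (show x ≤ x + η by linarith)
  exact abs_le.2 ⟨by linarith, by linarith⟩

lemma continuous_Phi : Continuous Phi :=
  (LipschitzWith.of_dist_le' (K := 1) fun x y => by
    simpa [Real.dist_eq] using abs_Phi_sub_le x y).continuous

lemma Phi_strictMono : StrictMono Phi := by
  intro x y h
  rw [← sub_pos, Phi_sub h.le, measureReal_def, ENNReal.toReal_pos_iff]
  refine ⟨pos_iff_ne_zero.2 fun h0 => ?_, measure_lt_top _ _⟩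
  have volume_eq_zero := gaussianReal_absolutelyContinuous' 0 (v := 1) one_ne_zero h0
  simp only [Real.volume_Ioc, ENNReal.ofReal_eq_zero, sub_nonpos] at volume_eq_zero
  exact absurd volume_eq_zero (not_le.2 h)

lemma measureReal_gaussianReal_Ioi (x : ℝ) : (gaussianReal 0 1).real (Set.Ioi x) = Phi (-x) := by
  have map_neg : (gaussianReal 0 1).map (fun y => -y) = gaussianReal 0 1 := by
    simpa using gaussianReal_map_neg (μ := 0) (v := 1)
  have := nullSingletonClass_gaussianReal (μ := 0) (v := 1) one_ne_zero
  rw [Phi, cdf_eq_real, measureReal_def, measureReal_def]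
  conv_rhs => rw [← map_neg, Measure.map_apply measurable_neg measurableSet_Iic]
  congr 1
  rw [show (fun y : ℝ => -y) ⁻¹' Set.Iic (-x) = Set.Ici x by ext; simp]
  exact measure_congr Ioi_ae_eq_Ici

lemma Phi_neg (x : ℝ) : Phi (-x) = 1 - Phi x := by
  rw [← measureReal_gaussianReal_Ioi, ← Set.compl_Iic, measureReal_compl measurableSet_Iic, Phi,
    cdf_eq_real]
  simp

lemma Phi_z {p : ℝ} (hp : p ∈ Set.Ioo (0 : ℝ) 1) : Phi (z p) = p := by
  obtain ⟨a, ha⟩ := ((tendsto_cdf_atBot (gaussianReal 0 1)).eventually_lt_const hp.1).exists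
  obtain ⟨b, hb⟩ := ((tendsto_cdf_atTop (gaussianReal 0 1)).eventually_const_lt hp.2).exists
  obtain ⟨x, hx⟩ : p ∈ Set.range Phi :=
    mem_range_of_exists_le_of_exists_ge continuous_Phi ⟨a, ha.le⟩ ⟨b, hb.le⟩
  have superlevel : {y | p ≤ Phi y} = Set.Ici x := by
    ext y
    rw [← hx]
    exact Phi_strictMono.le_iff_le
  rw [z, superlevel, csInf_Ici, hx]

lemma z_one_sub {p : ℝ} (hp : p ∈ Set.Ioo (0 : ℝ) 1) : z (1 - p) = -z p := by
  apply Phi_strictMono.injective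
  rw [Phi_neg, Phi_z hp, Phi_z ⟨by linarith [hp.2], by linarith [hp.1]⟩]

/-! ### Perturbation of a studentized Gaussian statistic -/

lemma abs_sqrt_sub_one_le {x : ℝ} (hx : 0 ≤ x) : |√x - 1| ≤ |x - 1| := by
  have factor : x - 1 = (√x - 1) * (√x + 1) := by linear_combination -Real.sq_sqrt hx
  rw [factor, abs_mul]
  refine le_mul_of_one_le_right (abs_nonneg _) ?_
  rw [abs_of_nonneg (by positivity)]
  linarith [Real.sqrt_nonneg x]

lemma lt_div_sqrt_iff {t N S v : ℝ} (hS : 0 < S) (hv : 0 < v) :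
    t < N / √S ↔ t * √(S / v) < N / √v := by
  rw [lt_div_iff₀ (by positivity), lt_div_iff₀ (by positivity), mul_assoc,
    ← Real.sqrt_mul (by positivity), div_mul_cancel₀ _ hv.ne']

lemma abs_studentization_error_le {t N S O v κ : ℝ} (hS : 0 ≤ S) (hv : 0 < v)
    (hN : |N - O| ≤ κ * √v) (hSv : |S / v - 1| ≤ κ) :
    |(N / √v - t * √(S / v)) - (O / √v - t)| ≤ κ * (|t| + 1) := by
  have mean_error : |(N - O) / √v| ≤ κ := by
    rw [abs_div, abs_of_nonneg (Real.sqrt_nonneg v)]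
    exact div_le_of_le_mul₀ (Real.sqrt_nonneg v) ((abs_nonneg _).trans hSv) hN
  have scale_error : |t * (√(S / v) - 1)| ≤ κ * |t| := by
    rw [abs_mul, mul_comm]
    gcongr
    exact (abs_sqrt_sub_one_le (by positivity)).trans hSv
  calc |(N / √v - t * √(S / v)) - (O / √v - t)| = |(N - O) / √v - t * (√(S / v) - 1)| := by ring_nf
    _ ≤ |(N - O) / √v| + |t * (√(S / v) - 1)| := abs_sub _ _
    _ ≤ κ * (|t| + 1) := by linarith

section Studentization

variable {Ω : Type*} {mΩ : MeasurableSpace Ω} {ν : Measure Ω}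

lemma measureReal_lt_div_sqrt_of_hasLaw_gaussianReal {O : Ω → ℝ} {m : ℝ} {v : ℝ≥0} (hv : v ≠ 0)
    (hO : HasLaw O (gaussianReal m v) ν) (u : ℝ) :
    ν.real {ω | u < O ω / √v} = Phi (-u + m / √v) := by
  have standardized : HasLaw (fun ω => O ω / √v - m / √v) (gaussianReal 0 1) ν := by
    have h := gaussianReal_sub_const (gaussianReal_div_const hO √v) (m / √v)
    have unit_variance : v / .mk (√(v : ℝ) ^ 2) (sq_nonneg _) = 1 := by
      ext
      simp [hv]
    rwa [sub_self, unit_variance] at h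
  rw [show -u + m / √v = -(u - m / √v) by ring, ← measureReal_gaussianReal_Ioi]
  convert standardized.measureReal_eq (p := fun x => u - m / √v < x) measurableSet_Ioi using 3
  · simp
  · rfl

lemma abs_measureReal_studentized_sub_le {N S O : Ω → ℝ} {m : ℝ} {v : ℝ≥0} (hv : v ≠ 0)
    (hO : HasLaw O (gaussianReal m v) ν) (t : ℝ) {κ : ℝ} (hκ0 : 0 < κ) (hκ : κ ≤ 1) :
    |ν.real {ω | t < N ω / √(S ω)} - Phi (-t + m / √v)| ≤
      κ * (|t| + 1) + ν.real {ω | κ * √v ≤ |N ω - O ω|} + ν.real {ω | κ ≤ |S ω / v - 1|} := by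
  have := hO.isProbabilityMeasure
  set badMean := {ω | κ * √v ≤ |N ω - O ω|}
  set badScale := {ω | κ ≤ |S ω / v - 1|}
  set η := κ * (|t| + 1)
  have hv' : (0 : ℝ) < v := NNReal.coe_pos.2 (pos_iff_ne_zero.2 hv)
  have good : ∀ ω, ω ∉ badMean → ω ∉ badScale →
      (t < N ω / √(S ω) ↔ t * √(S ω / v) < N ω / √v) ∧
        |(N ω / √v - t * √(S ω / v)) - (O ω / √v - t)| ≤ η := by
    intro ω hmean hscale
    simp only [badMean, badScale, Set.mem_ofPred_eq, not_le] at hmean hscale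
    have hS : 0 < S ω := by
      have : 0 < S ω / v := by linarith [(abs_lt.1 hscale).1]
      exact (div_pos_iff_of_pos_right hv').1 this
    exact ⟨lt_div_sqrt_iff hS hv', abs_studentization_error_le hS.le hv' hmean.le hscale.le⟩
  have upper : {ω | t < N ω / √(S ω)} ⊆ {ω | t - η < O ω / √v} ∪ badMean ∪ badScale := by
    intro ω hω
    by_contra hcon
    simp only [Set.mem_union, not_or, Set.mem_ofPred_eq, not_lt] at hcon
    obtain ⟨hiff, hclose⟩ := good ω hcon.1.2 hcon.2
    linarith [hiff.1 hω, (abs_le.1 hclose).2]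
  have lower : {ω | t + η < O ω / √v} ⊆ {ω | t < N ω / √(S ω)} ∪ badMean ∪ badScale := by
    intro ω hω
    by_contra hcon
    simp only [Set.mem_union, not_or, Set.mem_ofPred_eq] at hcon hω
    obtain ⟨hiff, hclose⟩ := good ω hcon.1.2 hcon.2
    linarith [not_lt.1 (mt hiff.2 hcon.1.1), (abs_le.1 hclose).1]
  have union_bound : ∀ A : Set Ω, ν.real (A ∪ badMean ∪ badScale) ≤
      ν.real A + ν.real badMean + ν.real badScale := fun A =>
    (measureReal_union_le _ _).trans (by gcongr; exact measureReal_union_le _ _)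
  have hup := (measureReal_mono upper (μ := ν)).trans (union_bound _)
  have hlow := (measureReal_mono lower (μ := ν)).trans (union_bound _)
  rw [measureReal_lt_div_sqrt_of_hasLaw_gaussianReal hv hO] at hup hlow
  rw [add_assoc]
  refine abs_sub_Phi_le_of_Phi_le (by positivity) ?_ ?_
  · rwa [← add_assoc, show -t + m / √v - η = -(t + η) + m / √v by ring]
  · rwa [← add_assoc, show -t + m / √v + η = -(t - η) + m / √v by ring]

end Studentization

/-! ### Sums of independent variables under a product measure -/

lemma memLp_two_of_lintegral_ne_top {α : Type*} {mα : MeasurableSpace α} {μ : Measure α} {g : α → ℝ}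
    (hg : AEStronglyMeasurable g μ) (h : ∫⁻ x, ENNReal.ofReal (g x ^ 2) ∂μ ≠ ∞) : MemLp g 2 μ := by
  rw [memLp_two_iff_integrable_sq hg]
  refine ⟨hg.pow 2, ?_⟩
  rw [hasFiniteIntegral_iff_ofReal (ae_of_all _ fun x => sq_nonneg _)]
  exact lt_top_iff_ne_top.2 h

section Pi

variable {ι : Type*} [Fintype ι] {α : ι → Type*} {mα : ∀ i, MeasurableSpace (α i)}
  {μ : ∀ i, Measure (α i)} [∀ i, IsProbabilityMeasure (μ i)] {g : ∀ i, α i → ℝ}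

lemma lintegral_sq_sum_sub_integral_of_memLp (hg : ∀ i, MemLp (g i) 2 (μ i)) :
    ∫⁻ t, ENNReal.ofReal ((∑ i, (g i (t i) - ∫ x, g i x ∂μ i)) ^ 2) ∂Measure.pi μ =
      ENNReal.ofReal (∑ i, Var[g i; μ i]) := by
  have hg_pi : ∀ i, MemLp (fun t : ∀ i, α i => g i (t i)) 2 (Measure.pi μ) := fun i =>
    (hg i).comp_measurePreserving (measurePreserving_eval μ i)
  have mean_sum : ∫ t, (∑ i, fun t : ∀ i, α i => g i (t i)) t ∂Measure.pi μ =
      ∑ i, ∫ x, g i x ∂μ i := by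
    simp only [Finset.sum_apply]
    rw [integral_finsetSum _ fun i _ => (hg_pi i).integrable (by norm_num)]
    exact Finset.sum_congr rfl fun i _ => integral_comp_eval (hg i).aestronglyMeasurable
  have evariance_sum := evariance_eq_lintegral_ofReal (∑ i, fun t : ∀ i, α i => g i (t i))
    (Measure.pi μ)
  rw [mean_sum] at evariance_sum
  simp only [Finset.sum_apply, ← Finset.sum_sub_distrib] at evariance_sum
  rw [← evariance_sum, ← (memLp_finsetSum' _ fun i _ => hg_pi i).ofReal_variance_eq,
    variance_sum_pi hg]

lemma lintegral_sq_sum_sub_integral_le (hg : ∀ i, AEStronglyMeasurable (g i) (μ i)) :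
    ∫⁻ t, ENNReal.ofReal ((∑ i, (g i (t i) - ∫ x, g i x ∂μ i)) ^ 2) ∂Measure.pi μ ≤
      ∑ i, ∫⁻ x, ENNReal.ofReal (g i x ^ 2) ∂μ i := by
  by_cases h : ∀ i, ∫⁻ x, ENNReal.ofReal (g i x ^ 2) ∂μ i ≠ ∞
  · have hL : ∀ i, MemLp (g i) 2 (μ i) := fun i => memLp_two_of_lintegral_ne_top (hg i) (h i)
    rw [lintegral_sq_sum_sub_integral_of_memLp hL,
      ENNReal.ofReal_sum_of_nonneg fun i _ => variance_nonneg _ _]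
    refine Finset.sum_le_sum fun i _ => ?_
    rw [← ofReal_integral_eq_lintegral_ofReal (hL i).integrable_sq
      (ae_of_all _ fun _ => sq_nonneg _)]
    exact ENNReal.ofReal_le_ofReal (variance_le_expectation_sq (hg i))
  · push Not at h
    obtain ⟨i, hi⟩ := h
    rw [ENNReal.sum_eq_top.2 ⟨i, Finset.mem_univ _, hi⟩]
    exact le_top

end Pi

/-! ### Sums of independent Gaussian variables -/

section GaussianSums

variable {Ω : Type*} {mΩ : MeasurableSpace Ω} {ν : Measure Ω} {X Y : Ω → ℝ} {m m' : ℝ} {v v' : ℝ≥0}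

lemma integral_of_hasLaw_gaussianReal (hX : HasLaw X (gaussianReal m v) ν) :
    ∫ ω, X ω ∂ν = m := by
  rw [hX.integral_eq, integral_id_gaussianReal]

lemma variance_of_hasLaw_gaussianReal (hX : HasLaw X (gaussianReal m v) ν) : Var[X; ν] = v := by
  rw [hX.variance_eq, variance_id_gaussianReal]

lemma hasLaw_gaussianReal_of_hasGaussianLaw (hX : HasGaussianLaw X ν) (hm : ∫ ω, X ω ∂ν = m)
    (hv : Var[X; ν] = v) : HasLaw X (gaussianReal m v) ν :=
  ⟨hX.aemeasurable, by rw [hX.map_eq_gaussianReal, hm, hv, Real.toNNReal_coe]⟩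

lemma hasLaw_add_gaussianReal_of_indepFun (hXY : IndepFun X Y ν)
    (hX : HasLaw X (gaussianReal m v) ν) (hY : HasLaw Y (gaussianReal m' v') ν) :
    HasLaw (fun ω => X ω + Y ω) (gaussianReal (m + m') (v + v')) ν :=
  gaussianReal_conv_gaussianReal (m₁ := m) (m₂ := m') ▸ hXY.hasLaw_fun_add hX hY

lemma hasLaw_sum_pi_gaussianReal {ι : Type*} [Fintype ι] {α : ι → Type*}
    {mα : ∀ i, MeasurableSpace (α i)} {μ : ∀ i, Measure (α i)} [∀ i, IsProbabilityMeasure (μ i)]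
    {g : ∀ i, α i → ℝ} {m : ι → ℝ} {v : ι → ℝ≥0}
    (hg : ∀ i, HasLaw (g i) (gaussianReal (m i) (v i)) (μ i)) :
    HasLaw (fun t => ∑ i, g i (t i)) (gaussianReal (∑ i, m i) (∑ i, v i)) (Measure.pi μ) := by
  have hg_pi : ∀ i, HasLaw (fun t : ∀ i, α i => g i (t i)) (gaussianReal (m i) (v i))
      (Measure.pi μ) := fun i => (hg i).fun_comp (measurePreserving_eval μ i).hasLaw
  refine hasLaw_gaussianReal_of_hasGaussianLaw
    (iIndepFun.hasGaussianLaw_fun_sum (fun i => (hg_pi i).hasGaussianLaw)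
      (iIndepFun_pi fun i => (hg i).aemeasurable)) ?_ ?_
  · rw [integral_finsetSum _ fun i _ => (hg_pi i).hasGaussianLaw.integrable]
    exact Finset.sum_congr rfl fun i _ => integral_of_hasLaw_gaussianReal (hg_pi i)
  · rw [← Finset.sum_fn, variance_sum_pi fun i => (hg i).hasGaussianLaw.memLp_two, NNReal.coe_sum]
    exact Finset.sum_congr rfl fun i _ => variance_of_hasLaw_gaussianReal (hg i)

lemma hasLaw_prod_add_gaussianReal {α β : Type*} [MeasurableSpace α] [MeasurableSpace β]
    {μ : Measure α} {η : Measure β} [IsProbabilityMeasure μ] [IsProbabilityMeasure η] {g : α → ℝ}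
    {k : β → ℝ} (hg : HasLaw g (gaussianReal m v) μ) (hk : HasLaw k (gaussianReal m' v') η) :
    HasLaw (fun p => g p.1 + k p.2) (gaussianReal (m + m') (v + v')) (μ.prod η) :=
  hasLaw_add_gaussianReal_of_indepFun (indepFun_prod₀ hg.aemeasurable hk.aemeasurable)
    (hg.fun_comp measurePreserving_fst.hasLaw) (hk.fun_comp measurePreserving_snd.hasLaw)

end GaussianSums

/-! ### The empirical variance -/

lemma empVar_sub_const {n : ℕ} (hn : 0 < n) (a : Fin n → ℝ) (c : ℝ) :
    empVar (fun i => a i - c) = empVar a := by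
  have hn' : (n : ℝ) ≠ 0 := by positivity
  simp only [empVar, empMean, sub_sq, Finset.sum_add_distrib, Finset.sum_sub_distrib,
    ← Finset.sum_mul, ← Finset.mul_sum, Finset.sum_const, Finset.card_univ, Fintype.card_fin,
    nsmul_eq_mul]
  field_simp
  ring

lemma empMean_add {n : ℕ} (a b : Fin n → ℝ) :
    empMean (fun i => a i + b i) = empMean a + empMean b := by
  simp only [empMean, Finset.sum_add_distrib, add_div]

lemma empVar_eq_empMean_sq_sub {n : ℕ} (hn : 0 < n) (a : Fin n → ℝ) :
    empVar a = empMean fun i => (a i - empMean a) ^ 2 := by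
  have centered : empMean (fun i => a i - empMean a) = 0 := by
    have hn' : (n : ℝ) ≠ 0 := by positivity
    simp only [empMean, Finset.sum_sub_distrib, Finset.sum_const, Finset.card_univ,
      Fintype.card_fin, nsmul_eq_mul]
    field_simp
    ring
  rw [← empVar_sub_const hn a (empMean a), empVar, centered, zero_pow two_ne_zero, sub_zero]

lemma empVar_le_empMean_sq {n : ℕ} (a : Fin n → ℝ) : empVar a ≤ empMean fun i => a i ^ 2 :=
  sub_le_self _ (sq_nonneg _)

lemma two_mul_abs_mul_le {x y θ : ℝ} (hθ : 0 < θ) : 2 * |x * y| ≤ θ * x ^ 2 + θ⁻¹ * y ^ 2 := by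
  have square : θ⁻¹ * (θ * |x| - |y|) ^ 2 = θ * |x| ^ 2 + θ⁻¹ * |y| ^ 2 - 2 * (|x| * |y|) := by
    field_simp
    ring
  have : 0 ≤ θ⁻¹ * (θ * |x| - |y|) ^ 2 := by positivity
  rw [abs_mul, ← sq_abs x, ← sq_abs y]
  linarith

lemma abs_add_sq_sub_sq_le (x y : ℝ) {θ : ℝ} (hθ : 0 < θ) :
    |(x + y) ^ 2 - x ^ 2| ≤ θ * x ^ 2 + (1 + θ⁻¹) * y ^ 2 := by
  calc |(x + y) ^ 2 - x ^ 2| = |2 * (x * y) + y ^ 2| := by ring_nf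
    _ ≤ 2 * |x * y| + y ^ 2 := (abs_add_le _ _).trans (by rw [abs_mul, abs_two, abs_sq])
    _ ≤ θ * x ^ 2 + (1 + θ⁻¹) * y ^ 2 := by linarith [two_mul_abs_mul_le (x := x) (y := y) hθ]

lemma abs_empVar_add_sub_le {n : ℕ} (hn : 0 < n) (a b : Fin n → ℝ) {θ : ℝ} (hθ : 0 < θ) :
    |empVar (fun i => a i + b i) - empVar a| ≤ θ * empVar a + (1 + θ⁻¹) * empVar b := by
  simp only [empVar_eq_empMean_sq_sub hn, empMean_add, add_sub_add_comm]
  simp only [empMean, ← sub_div, ← mul_div_assoc, ← add_div, Finset.mul_sum,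
    ← Finset.sum_sub_distrib, ← Finset.sum_add_distrib]
  rw [abs_div, Nat.abs_cast]
  gcongr
  exact (Finset.abs_sum_le_sum_abs _ _).trans
    (Finset.sum_le_sum fun i _ => abs_add_sq_sub_sq_le _ _ hθ)

/-! ### Moments of the empirical variance of a Gaussian sample -/

/-- The fourth moment of the standard normal distribution. -/
noncomputable def fourthMoment : ℝ := ∫ x, x ^ 4 ∂(gaussianReal 0 1)

lemma fourthMoment_nonneg : 0 ≤ fourthMoment := integral_nonneg fun x => by positivity

lemma integrable_pow_four_gaussianReal (m : ℝ) (v : ℝ≥0) :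
    Integrable (fun x : ℝ => x ^ 4) (gaussianReal m v) := by
  refine ((memLp_id_gaussianReal (μ := m) (v := v) 4).integrable_norm_pow (p := 4)
    (by norm_num)).congr (ae_of_all _ fun x => ?_)
  simp only [id, Real.norm_eq_abs]
  exact Even.pow_abs (by decide) x

lemma lintegral_sub_sq_gaussianReal (m : ℝ) (v : ℝ≥0) :
    ∫⁻ x, ENNReal.ofReal ((x - m) ^ 2) ∂(gaussianReal m v) = v := by
  have h := evariance_eq_lintegral_ofReal id (gaussianReal m v)
  simp only [id, integral_id_gaussianReal] at h
  rw [← h]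
  change eVar[id; gaussianReal m v] = v
  rw [← (memLp_id_gaussianReal 2).ofReal_variance_eq, variance_id_gaussianReal,
    ENNReal.ofReal_coe_nnreal]

lemma lintegral_sub_pow_four_gaussianReal (m : ℝ) (v : ℝ≥0) :
    ∫⁻ x, ENNReal.ofReal ((x - m) ^ 4) ∂(gaussianReal m v) =
      ENNReal.ofReal (fourthMoment * v ^ 2) := by
  have affine : HasLaw (fun x => √v * x + m) (gaussianReal m v) (gaussianReal 0 1) := by
    have h := gaussianReal_add_const
      (gaussianReal_const_mul (HasLaw.id (μ := gaussianReal 0 1)) √v) m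
    have variance_eq : .mk (√(v : ℝ) ^ 2) (sq_nonneg _) * 1 = v := by
      ext
      simp
    rwa [mul_zero, zero_add, variance_eq] at h
  rw [← affine.lintegral_comp (by fun_prop), fourthMoment, mul_comm,
    ENNReal.ofReal_mul (by positivity),
    ofReal_integral_eq_lintegral_ofReal (integrable_pow_four_gaussianReal 0 1)
      (ae_of_all _ fun x => by positivity), ← lintegral_const_mul _ (by fun_prop)]
  refine lintegral_congr fun x => ?_
  rw [← ENNReal.ofReal_mul (by positivity)]
  congr 1
  linear_combination x ^ 4 * (√(v : ℝ) ^ 2 + v) * Real.sq_sqrt v.coe_nonneg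

section GaussianSample

variable {ι : Type*} [Fintype ι] (m : ℝ) (v : ℝ≥0)

lemma lintegral_sq_sum_sub_gaussianReal :
    ∫⁻ x, ENNReal.ofReal ((∑ i, (x i - m)) ^ 2) ∂(Measure.pi fun _ : ι => gaussianReal m v) =
      ENNReal.ofReal (Fintype.card ι * v) := by
  have h := lintegral_sq_sum_sub_integral_of_memLp (ι := ι) (μ := fun _ => gaussianReal m v)
    (g := fun _ => id) fun _ => memLp_id_gaussianReal 2
  simpa using h

lemma lintegral_sq_sum_sq_sub_gaussianReal_le :
    ∫⁻ x, ENNReal.ofReal ((∑ i, ((x i - m) ^ 2 - v)) ^ 2)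
        ∂(Measure.pi fun _ : ι => gaussianReal m v) ≤
      ENNReal.ofReal (Fintype.card ι * (fourthMoment * v ^ 2)) := by
  have h := lintegral_sq_sum_sub_integral_le (ι := ι) (μ := fun _ => gaussianReal m v)
    (g := fun _ x => (x - m) ^ 2) fun _ => by fun_prop
  have mean_sq : ∫ x, (x - m) ^ 2 ∂(gaussianReal m v) = v := by
    rw [integral_eq_lintegral_of_nonneg_ae (ae_of_all _ fun _ => sq_nonneg _)
      (by fun_prop), lintegral_sub_sq_gaussianReal, ENNReal.coe_toReal]
  simpa only [mean_sq, ← pow_mul, Nat.reduceMul, lintegral_sub_pow_four_gaussianReal,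
    Finset.sum_const, nsmul_eq_mul, Finset.card_univ, ENNReal.ofReal_mul (Nat.cast_nonneg _),
    ENNReal.ofReal_natCast] using h

end GaussianSample

lemma abs_empVar_sub_le {n : ℕ} (hn : 0 < n) (a : Fin n → ℝ) (m v : ℝ) {s : ℝ} (hs : 0 < s) :
    |empVar a - v| ≤ s + s⁻¹ * (n : ℝ)⁻¹ ^ 2 * (∑ i, ((a i - m) ^ 2 - v)) ^ 2 +
      (n : ℝ)⁻¹ ^ 2 * (∑ i, (a i - m)) ^ 2 := by
  have hn' : (n : ℝ) ≠ 0 := by positivity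
  set y := (n : ℝ)⁻¹ * ∑ i, ((a i - m) ^ 2 - v) with hy
  have decomposition : empVar a - v = y - (n : ℝ)⁻¹ ^ 2 * (∑ i, (a i - m)) ^ 2 := by
    rw [← empVar_sub_const hn _ m, empVar, empMean, empMean, hy,
      Finset.sum_sub_distrib (f := fun i => (a i - m) ^ 2), Finset.sum_const, Finset.card_univ,
      Fintype.card_fin, nsmul_eq_mul]
    field_simp
    ring
  have young : |y| ≤ s + s⁻¹ * y ^ 2 := by
    have h := two_mul_abs_mul_le (x := 1) (y := y) hs
    rw [one_mul] at h
    linarith [abs_nonneg y]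
  have mean_term : |(n : ℝ)⁻¹ ^ 2 * (∑ i, (a i - m)) ^ 2| = (n : ℝ)⁻¹ ^ 2 * (∑ i, (a i - m)) ^ 2 :=
    abs_of_nonneg (by positivity)
  have hy_sq : s⁻¹ * y ^ 2 = s⁻¹ * (n : ℝ)⁻¹ ^ 2 * (∑ i, ((a i - m) ^ 2 - v)) ^ 2 := by
    rw [hy]
    ring
  rw [decomposition, ← hy_sq]
  linarith [abs_sub y ((n : ℝ)⁻¹ ^ 2 * (∑ i, (a i - m)) ^ 2)]

lemma lintegral_abs_empVar_sub_gaussianReal_le_add {n : ℕ} (hn : 0 < n) (m : ℝ) (v : ℝ≥0) {s : ℝ}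
    (hs : 0 < s) :
    ∫⁻ x, ENNReal.ofReal |empVar x - v| ∂(Measure.pi fun _ : Fin n => gaussianReal m v) ≤
      ENNReal.ofReal (s + s⁻¹ * fourthMoment * v ^ 2 / n + v / n) := by
  have hn' : (n : ℝ) ≠ 0 := by positivity
  have hK := fourthMoment_nonneg
  calc _ ≤ ∫⁻ x, (ENNReal.ofReal s +
          ENNReal.ofReal (s⁻¹ * (n : ℝ)⁻¹ ^ 2) *
            ENNReal.ofReal ((∑ i, ((x i - m) ^ 2 - v)) ^ 2) +
          ENNReal.ofReal ((n : ℝ)⁻¹ ^ 2) * ENNReal.ofReal ((∑ i, (x i - m)) ^ 2))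
          ∂(Measure.pi fun _ : Fin n => gaussianReal m v) := by
        refine lintegral_mono fun x => ?_
        rw [← ENNReal.ofReal_mul (by positivity), ← ENNReal.ofReal_mul (by positivity),
          ← ENNReal.ofReal_add (by positivity) (by positivity),
          ← ENNReal.ofReal_add (by positivity) (by positivity)]
        exact ENNReal.ofReal_le_ofReal (abs_empVar_sub_le hn x m v hs)
    _ ≤ ENNReal.ofReal s +
          ENNReal.ofReal (s⁻¹ * (n : ℝ)⁻¹ ^ 2) * ENNReal.ofReal (n * (fourthMoment * v ^ 2)) +
          ENNReal.ofReal ((n : ℝ)⁻¹ ^ 2) * ENNReal.ofReal (n * v) := by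
        rw [lintegral_add_left (by fun_prop), lintegral_add_left (by fun_prop),
          lintegral_const_mul _ (by fun_prop), lintegral_const_mul _ (by fun_prop), lintegral_const,
          measure_univ, mul_one, lintegral_sq_sum_sub_gaussianReal, Fintype.card_fin]
        gcongr
        simpa using lintegral_sq_sum_sq_sub_gaussianReal_le (ι := Fin n) m v
    _ = _ := by
        rw [← ENNReal.ofReal_mul (by positivity), ← ENNReal.ofReal_mul (by positivity),
          ← ENNReal.ofReal_add (by positivity) (by positivity),
          ← ENNReal.ofReal_add (by positivity) (by positivity)]
        congr 1
        field_simp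

lemma lintegral_abs_empVar_sub_gaussianReal_le {n : ℕ} (hn : 0 < n) (m : ℝ) {v V : ℝ≥0}
    (hvV : v ≤ V) (hV : 0 < V) :
    ∫⁻ x, ENNReal.ofReal |empVar x - v| ∂(Measure.pi fun _ : Fin n => gaussianReal m v) ≤
      ENNReal.ofReal (V * (fourthMoment + 2) / √n) := by
  have hn' : (0 : ℝ) < n := by positivity
  have : (0 : ℝ) < V := hV
  have hK := fourthMoment_nonneg
  refine (lintegral_abs_empVar_sub_gaussianReal_le_add hn m v
    (s := V / √n) (by positivity)).trans (ENNReal.ofReal_le_ofReal ?_)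
  have quadratic_term : (V / √n)⁻¹ * fourthMoment * v ^ 2 / n ≤ V * fourthMoment / √n := by
    calc (V / √n : ℝ)⁻¹ * fourthMoment * v ^ 2 / n ≤ (V / √n)⁻¹ * fourthMoment * V ^ 2 / n := by
          gcongr
      _ = V * fourthMoment / √n := by
          have := Real.sq_sqrt hn'.le
          field_simp
          rw [this, mul_comm]
  have mean_term : (v : ℝ) / n ≤ V / √n := by
    have : √(n : ℝ) ≤ n := by
      rw [Real.sqrt_le_left hn'.le]
      exact le_self_pow₀ (by exact_mod_cast hn) two_ne_zero
    gcongr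
  calc _ ≤ V / √n + V * fourthMoment / √n + V / √n := by linarith
    _ = _ := by ring

/-! ### Cross-fitting -/

/-- The enumeration of all indices by those of the two folds. -/
def foldEquiv {n : ℕ} (hn : Even n) : Fin (n / 2) ⊕ Fin (n / 2) ≃ Fin n where
  toFun := Sum.elim (fun k => ⟨2 * k, by omega⟩) (fun k => ⟨2 * k + 1, by omega⟩)
  invFun i := if (i : ℕ) % 2 = 0 then Sum.inl ⟨i / 2, by obtain ⟨m, rfl⟩ := hn; omega⟩
    else Sum.inr ⟨i / 2, by obtain ⟨m, rfl⟩ := hn; omega⟩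
  left_inv := by
    rintro (k | k)
    · simp
    · have : (2 * (k : ℕ) + 1) / 2 = k := by omega
      simp [this, Nat.add_mod]
  right_inv i := by
    dsimp only
    split_ifs <;> ext <;> simp only [Sum.elim_inl, Sum.elim_inr] <;> omega

/-- The fold on which the function evaluated at the `i`-th covariate (`0`-based) is trained. -/
def trainingFold {α : Type} {n : ℕ} (L : Fin n → α) (i : ℕ) : Fin (n / 2) → α :=
  if Even i then foldB L else foldA L

lemma trainingFold_add {α : Type} {n : ℕ} (hn : Even n) (L : Fin n → α) (i : ℕ) :
    trainingFold L (n + i) = trainingFold L i := by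
  simp only [trainingFold, Nat.even_add, hn, true_iff]

lemma crossFit_eq {d n m : ℕ} (est : Regression d (n / 2)) (f : Vec d → ℝ)
    (L : Fin n → Vec d × Vec d) (U : Fin m → Vec d) (i : Fin (n + m)) :
    crossFit est f L U i = est f (trainingFold L i) (covariates L U i) := by
  simp only [crossFit, trainingFold, Nat.odd_add_one, Nat.not_odd_iff_even]
  split_ifs <;> rfl

lemma sum_trainingFold {α β M : Type} [AddCommMonoid M] {n : ℕ} (hn : Even n) (L : Fin n → α)
    (G : (Fin (n / 2) → α) → β → M) (w : Fin n → β) :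
    ∑ i : Fin n, G (trainingFold L i) (w i) =
      ∑ k, G (foldB L) (foldA w k) + ∑ k, G (foldA L) (foldB w k) := by
  rw [← (foldEquiv hn).sum_comp, Fintype.sum_sum_type]
  simp [foldEquiv, trainingFold, foldA, foldB]

section Folds

variable {α : Type} {mα : MeasurableSpace α} {n : ℕ}

@[fun_prop]
lemma measurable_foldA : Measurable (foldA : (Fin n → α) → Fin (n / 2) → α) :=
  measurable_pi_lambda _ fun _ => measurable_pi_apply _

@[fun_prop]
lemma measurable_foldB : Measurable (foldB : (Fin n → α) → Fin (n / 2) → α) :=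
  measurable_pi_lambda _ fun _ => measurable_pi_apply _

lemma measurable_trainingFold (i : ℕ) :
    Measurable fun L : Fin n → α => trainingFold L i := by
  unfold trainingFold
  split_ifs <;> fun_prop

variable (μ : Measure α) [IsProbabilityMeasure μ]

lemma measurePreserving_foldA_foldB (hn : Even n) :
    MeasurePreserving (fun L : Fin n → α => (foldA L, foldB L)) (Measure.pi fun _ => μ)
      ((Measure.pi fun _ => μ).prod (Measure.pi fun _ => μ)) :=
  (measurePreserving_sumPiEquivProdPi fun _ : Fin (n / 2) ⊕ Fin (n / 2) => μ).comp
    (measurePreserving_piCongrLeft (fun _ : Fin n => μ) (foldEquiv hn)).symm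

lemma measurePreserving_foldB_foldA (hn : Even n) :
    MeasurePreserving (fun L : Fin n → α => (foldB L, foldA L)) (Measure.pi fun _ => μ)
      ((Measure.pi fun _ => μ).prod (Measure.pi fun _ => μ)) :=
  Measure.measurePreserving_swap.comp (measurePreserving_foldA_foldB μ hn)

lemma measurePreserving_foldA (hn : Even n) :
    MeasurePreserving (foldA : (Fin n → α) → Fin (n / 2) → α) (Measure.pi fun _ => μ)
      (Measure.pi fun _ => μ) :=
  measurePreserving_fst.comp (measurePreserving_foldA_foldB μ hn)

lemma measurePreserving_foldB (hn : Even n) :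
    MeasurePreserving (foldB : (Fin n → α) → Fin (n / 2) → α) (Measure.pi fun _ => μ)
      (Measure.pi fun _ => μ) :=
  measurePreserving_snd.comp (measurePreserving_foldA_foldB μ hn)

lemma measurePreserving_trainingFold (hn : Even n) (i : ℕ) :
    MeasurePreserving (fun L : Fin n → α => trainingFold L i) (Measure.pi fun _ => μ)
      (Measure.pi fun _ => μ) := by
  unfold trainingFold
  split_ifs
  · exact measurePreserving_foldB μ hn
  · exact measurePreserving_foldA μ hn

lemma measurePreserving_trainingFold_apply (hn : Even n) (i : Fin n) :
    MeasurePreserving (fun L : Fin n → α => (trainingFold L i, L i)) (Measure.pi fun _ => μ)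
      ((Measure.pi fun _ => μ).prod μ) := by
  obtain ⟨k | k, rfl⟩ := (foldEquiv hn).surjective i
  · have h := ((MeasurePreserving.id _).prod (measurePreserving_eval (fun _ => μ) k)).comp
      (measurePreserving_foldB_foldA μ hn)
    convert! h using 2
    simp [foldEquiv, trainingFold, foldA]
  · have h := ((MeasurePreserving.id _).prod (measurePreserving_eval (fun _ => μ) k)).comp
      (measurePreserving_foldA_foldB μ hn)
    convert! h using 2
    simp [foldEquiv, trainingFold, foldB]

end Folds

lemma ofReal_add_sub_add_sq_le (a b c d : ℝ) :
    ENNReal.ofReal ((a + b - (c + d)) ^ 2) ≤ 4 * (ENNReal.ofReal (a ^ 2) + ENNReal.ofReal (b ^ 2) +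
      ENNReal.ofReal (c ^ 2) + ENNReal.ofReal (d ^ 2)) := by
  rw [← ENNReal.ofReal_add (by positivity) (by positivity),
    ← ENNReal.ofReal_add (by positivity) (by positivity),
    ← ENNReal.ofReal_add (by positivity) (by positivity),
    ← ENNReal.ofReal_ofNat 4, ← ENNReal.ofReal_mul (by positivity)]
  refine ENNReal.ofReal_le_ofReal ?_
  linarith [sq_nonneg (a - b), sq_nonneg (c - d), sq_nonneg (a + c), sq_nonneg (a + d),
    sq_nonneg (b + c), sq_nonneg (b + d)]

lemma lintegral_add_sub_add_sq_le {Ω : Type*} {mΩ : MeasurableSpace Ω} {ν : Measure Ω}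
    {a b c d : Ω → ℝ} {M : ℝ≥0∞} (hb : Measurable b) (hc : Measurable c) (hd : Measurable d)
    (haM : ∫⁻ ω, ENNReal.ofReal (a ω ^ 2) ∂ν ≤ M) (hbM : ∫⁻ ω, ENNReal.ofReal (b ω ^ 2) ∂ν ≤ M)
    (hcM : ∫⁻ ω, ENNReal.ofReal (c ω ^ 2) ∂ν ≤ M) (hdM : ∫⁻ ω, ENNReal.ofReal (d ω ^ 2) ∂ν ≤ M) :
    ∫⁻ ω, ENNReal.ofReal ((a ω + b ω - (c ω + d ω)) ^ 2) ∂ν ≤ 4 * (M + M + M + M) := by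
  refine (lintegral_mono fun ω => ofReal_add_sub_add_sq_le _ _ _ _).trans ?_
  rw [lintegral_const_mul' _ _ (by simp), lintegral_add_right _ (by fun_prop),
    lintegral_add_right _ (by fun_prop), lintegral_add_right _ (by fun_prop)]
  gcongr

section Trained

variable {α β : Type} {mα : MeasurableSpace α} {mβ : MeasurableSpace β} {P : Measure (α × β)}
  {n m h : ℕ}

/-- The law of `n` labeled pairs and of `m` independent unlabeled covariates. -/
noncomputable def sampleLaw (P : Measure (α × β)) (n m : ℕ) :
    Measure ((Fin n → α × β) × (Fin m → β)) :=
  (Measure.pi fun _ : Fin n => P).prod (Measure.pi fun _ : Fin m => P.snd)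

instance (P : Measure (α × β)) [IsProbabilityMeasure P] (n m : ℕ) :
    IsProbabilityMeasure (sampleLaw P n m) := by
  unfold sampleLaw
  infer_instance

/-- The mean square of a function trained on `h` labeled pairs, at an independent covariate. -/
noncomputable def trainedSq (P : Measure (α × β)) (D : (Fin h → α × β) → β → ℝ) : ℝ≥0∞ :=
  ∫⁻ q, ENNReal.ofReal (Function.uncurry D q ^ 2) ∂((Measure.pi fun _ : Fin h => P).prod P.snd)

/-- The sum of the values of `g` at the points `w`, centered at its mean under `η`. -/
noncomputable def centeredSum (η : Measure β) (g : β → ℝ) (w : Fin h → β) : ℝ :=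
  ∑ k, (g (w k) - ∫ v, g v ∂η)

variable [IsProbabilityMeasure P]

lemma measurable_centeredSum {D : (Fin h → α × β) → β → ℝ}
    (hD : Measurable (Function.uncurry D)) :
    Measurable fun q : (Fin h → α × β) × (Fin h → β) => centeredSum P.snd (D q.1) q.2 := by
  have mean : Measurable fun t => ∫ v, D t v ∂P.snd :=
    (hD.stronglyMeasurable.integral_prod_right' (ν := P.snd)).measurable
  unfold centeredSum
  refine Finset.measurable_sum _ fun k _ => Measurable.sub ?_ (mean.comp measurable_fst)
  exact hD.comp (f := fun q : (Fin h → α × β) × (Fin h → β) => (q.1, q.2 k)) (by fun_prop)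

lemma lintegral_sq_centeredSum_le {D : (Fin h → α × β) → β → ℝ}
    (hD : Measurable (Function.uncurry D)) :
    ∫⁻ q, ENNReal.ofReal (centeredSum P.snd (D q.1) q.2 ^ 2)
        ∂((Measure.pi fun _ : Fin h => P).prod (Measure.pi fun _ : Fin h => P.snd)) ≤
      h * trainedSq P D := by
  rw [lintegral_prod _ ((measurable_centeredSum hD).pow_const 2).ennreal_ofReal.aemeasurable,
    trainedSq, lintegral_prod _ (hD.pow_const 2).ennreal_ofReal.aemeasurable,
    ← lintegral_const_mul' _ _ (ENNReal.natCast_ne_top h)]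
  refine lintegral_mono fun t => ?_
  refine (lintegral_sq_sum_sub_integral_le (ι := Fin h) (μ := fun _ => P.snd) (g := fun _ => D t)
    fun _ => (hD.comp measurable_prodMk_left).aestronglyMeasurable).trans_eq ?_
  simp [Function.uncurry]

variable {D : (Fin (n / 2) → α × β) → β → ℝ}

lemma sum_trainingFold_sub_sum_trainingFold (hn : Even n) (η : Measure β) (L : Fin n → α × β)
    (U W : Fin n → β) :
    ∑ i : Fin n, D (trainingFold L i) (U i) - ∑ i : Fin n, D (trainingFold L i) (W i) =
      (centeredSum η (D (foldB L)) (foldA U) + centeredSum η (D (foldA L)) (foldB U)) -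
        (centeredSum η (D (foldB L)) (foldA W) + centeredSum η (D (foldA L)) (foldB W)) := by
  simp only [sum_trainingFold hn, centeredSum, Finset.sum_sub_distrib]
  ring

/-- Given the training fold, each of the four centered sums is a sum of independent centered
variables, whence the linear growth in `n`. -/
lemma lintegral_sq_sum_trainingFold_sub_le (hn : Even n) (hD : Measurable (Function.uncurry D)) :
    ∫⁻ q, ENNReal.ofReal ((∑ i : Fin n, D (trainingFold q.1 i) (q.2 i) -
        ∑ i : Fin n, D (trainingFold q.1 i) (q.1 i).2) ^ 2) ∂(sampleLaw P n n) ≤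
      8 * n * trainedSq P D := by
  have labeled_covariates : MeasurePreserving (fun t : Fin (n / 2) → α × β => fun k => (t k).2)
      (Measure.pi fun _ => P) (Measure.pi fun _ => P.snd) :=
    measurePreserving_pi _ _ fun _ => measurable_snd.measurePreserving P
  have labeled_pairs : MeasurePreserving Prod.fst (sampleLaw P n n) (Measure.pi fun _ => P) :=
    measurePreserving_fst
  have unlabeled_A := (measurePreserving_foldB P hn).prod (measurePreserving_foldA P.snd hn)
  have unlabeled_B := (measurePreserving_foldA P hn).prod (measurePreserving_foldB P.snd hn)
  have labeled_A := (((MeasurePreserving.id _).prod labeled_covariates).comp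
    (measurePreserving_foldB_foldA P hn)).comp labeled_pairs
  have labeled_B := (((MeasurePreserving.id _).prod labeled_covariates).comp
    (measurePreserving_foldA_foldB P hn)).comp labeled_pairs
  have measurable_sum := measurable_centeredSum (P := P) hD
  have bound : ∀ {φ : (Fin n → α × β) × (Fin n → β) → (Fin (n / 2) → α × β) × (Fin (n / 2) → β)},
      MeasurePreserving φ (sampleLaw P n n)
        ((Measure.pi fun _ => P).prod (Measure.pi fun _ => P.snd)) →
      ∫⁻ q, ENNReal.ofReal (centeredSum P.snd (D (φ q).1) (φ q).2 ^ 2) ∂(sampleLaw P n n) ≤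
        (n / 2 : ℕ) * trainedSq P D := fun hφ =>
    (hφ.lintegral_comp (measurable_sum.pow_const 2).ennreal_ofReal).trans_le
      (lintegral_sq_centeredSum_le hD)
  simp only [sum_trainingFold_sub_sum_trainingFold hn P.snd]
  refine (lintegral_add_sub_add_sq_le (measurable_sum.comp unlabeled_B.measurable)
    (measurable_sum.comp labeled_A.measurable) (measurable_sum.comp labeled_B.measurable)
    (bound unlabeled_A) (bound unlabeled_B) (bound labeled_A) (bound labeled_B)).trans_eq ?_
  have half : ((n / 2 : ℕ) : ℝ≥0∞) + (n / 2 : ℕ) = n := by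
    obtain ⟨k, rfl⟩ := hn
    norm_cast
    omega
  rw [← half]
  ring

end Trained

/-! ### The estimators of one group when the regression is Gaussian -/

lemma abs_empVar_add_sub_le_add {n : ℕ} (hn : 0 < n) (a b : Fin n → ℝ) {v θ : ℝ} (hθ : 0 < θ)
    (hθ1 : θ ≤ 1) :
    |empVar (fun i => a i + b i) - v| ≤
      θ * v + 2 * |empVar a - v| + 2 * θ⁻¹ * ((n : ℝ)⁻¹ * ∑ i, b i ^ 2) := by
  have one_le : 1 ≤ θ⁻¹ := (one_le_inv₀ hθ).2 hθ1
  have perturbation : (1 + θ⁻¹) * empVar b ≤ 2 * θ⁻¹ * ((n : ℝ)⁻¹ * ∑ i, b i ^ 2) := by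
    rw [← div_eq_inv_mul]
    exact mul_le_mul (by linarith) (empVar_le_empMean_sq b)
      (by rw [empVar_eq_empMean_sq_sub hn, empMean]; positivity) (by positivity)
  have base : θ * (empVar a - v) ≤ |empVar a - v| :=
    (mul_le_mul_of_nonneg_left (le_abs_self _) hθ.le).trans
      (mul_le_of_le_one_left (abs_nonneg _) hθ1)
  calc |empVar (fun i => a i + b i) - v|
      ≤ |empVar (fun i => a i + b i) - empVar a| + |empVar a - v| := abs_sub_le _ _ _
    _ ≤ _ := by linarith [abs_empVar_add_sub_le hn a b hθ]

lemma lintegral_abs_empVar_add_sub_le {Ω : Type*} {mΩ : MeasurableSpace Ω} {ν : Measure Ω}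
    [IsProbabilityMeasure ν] {n : ℕ} (hn : 0 < n) {x g : Fin n → Ω → ℝ}
    (hg : ∀ i, Measurable (g i)) {v b θ : ℝ} {M : ℝ≥0∞} (hv : 0 ≤ v) (hb : 0 ≤ b) (hθ : 0 < θ)
    (hθ1 : θ ≤ 1)
    (hxv : ∫⁻ ω, ENNReal.ofReal |empVar (fun i => x i ω) - v| ∂ν ≤ ENNReal.ofReal b)
    (hgM : ∀ i, ∫⁻ ω, ENNReal.ofReal (g i ω ^ 2) ∂ν ≤ M) :
    ∫⁻ ω, ENNReal.ofReal |empVar (fun i => x i ω + g i ω) - v| ∂ν ≤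
      ENNReal.ofReal (θ * v + 2 * b) + ENNReal.ofReal (2 * θ⁻¹) * M := by
  have hn' : (0 : ℝ) < n := by positivity
  have measurable_sq : ∀ i, Measurable fun ω => ENNReal.ofReal (g i ω ^ 2) := fun i =>
    ((hg i).pow_const 2).ennreal_ofReal
  calc _ ≤ ∫⁻ ω, (ENNReal.ofReal (θ * v) +
          ENNReal.ofReal 2 * ENNReal.ofReal |empVar (fun i => x i ω) - v| +
          ENNReal.ofReal (2 * θ⁻¹) *
            (ENNReal.ofReal (n : ℝ)⁻¹ * ∑ i, ENNReal.ofReal (g i ω ^ 2))) ∂ν := by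
        refine lintegral_mono fun ω => ?_
        rw [← ENNReal.ofReal_sum_of_nonneg fun i _ => sq_nonneg _,
          ← ENNReal.ofReal_mul (by positivity), ← ENNReal.ofReal_mul (by positivity),
          ← ENNReal.ofReal_mul (by positivity), ← ENNReal.ofReal_add (by positivity)
            (by positivity), ← ENNReal.ofReal_add (by positivity) (by positivity)]
        exact ENNReal.ofReal_le_ofReal (abs_empVar_add_sub_le_add hn _ _ hθ hθ1)
    _ ≤ ENNReal.ofReal (θ * v) + ENNReal.ofReal 2 * ENNReal.ofReal b + ENNReal.ofReal (2 * θ⁻¹) *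
          (ENNReal.ofReal (n : ℝ)⁻¹ * ∑ _i : Fin n, M) := by
        rw [lintegral_add_right _ (by fun_prop), lintegral_add_left (by fun_prop),
          lintegral_const_mul' _ _ ENNReal.ofReal_ne_top,
          lintegral_const_mul' _ _ ENNReal.ofReal_ne_top,
          lintegral_const_mul' _ _ ENNReal.ofReal_ne_top, lintegral_const, measure_univ, mul_one,
          lintegral_finsetSum _ fun i _ => measurable_sq i]
        gcongr
        exact hgM _
    _ = _ := by
        rw [Finset.sum_const, Finset.card_univ, Fintype.card_fin, nsmul_eq_mul, ← mul_assoc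
          (ENNReal.ofReal (n : ℝ)⁻¹), ← ENNReal.ofReal_natCast n,
          ← ENNReal.ofReal_mul (p := (n : ℝ)⁻¹) (by positivity), inv_mul_cancel₀ hn'.ne',
          ENNReal.ofReal_one, one_mul, ENNReal.ofReal_add (by positivity) (by positivity),
          ENNReal.ofReal_mul (p := 2) (q := b) (by norm_num)]

lemma condExp_comap_ae_eq_of_indepFun_sub {Ω β : Type*} {mΩ : MeasurableSpace Ω}
    {mβ : MeasurableSpace β} {P : Measure Ω} [IsProbabilityMeasure P] {X : Ω → ℝ} {V : Ω → β}
    {e : β → ℝ} (hX : Measurable X) (hV : Measurable V) (he : Measurable e)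
    (hXI : Integrable X P) (heI : Integrable (fun ω => e (V ω)) P)
    (indep : IndepFun (fun ω => X ω - e (V ω)) V P) (mean : ∫ ω, (X ω - e (V ω)) ∂P = 0) :
    P[X | mβ.comap V] =ᵐ[P] fun ω => e (V ω) := by
  have noise_measurable : Measurable fun ω => X ω - e (V ω) := by fun_prop
  have noise : P[fun ω => X ω - e (V ω) | mβ.comap V] =ᵐ[P] fun _ => 0 := by
    have h := condExp_indep_eq noise_measurable.comap_le hV.comap_le
      (comap_measurable _).stronglyMeasurable indep
    rwa [mean] at h
  have fit : P[fun ω => e (V ω) | mβ.comap V] = fun ω => e (V ω) :=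
    condExp_of_stronglyMeasurable hV.comap_le
      (he.comp (comap_measurable V)).stronglyMeasurable heI
  have sum := condExp_add (hXI.sub heI) heI (mβ.comap V)
  rw [sub_add_cancel] at sum
  filter_upwards [sum, noise] with ω hsum hnoise
  rw [hsum, Pi.add_apply, fit]
  exact add_eq_right.2 hnoise

/-- Under `P`, the pair `(X, V)` satisfies `f(X) = e(V) + ε`, where the noise `ε` is independent of
`V`, with law `N(0, vr)`, and `e(V)` has law `N(m, ve)`. -/
structure GaussianRegression {α β : Type*} {mα : MeasurableSpace α} {mβ : MeasurableSpace β}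
    (P : Measure (α × β)) (f : α → ℝ) (e : β → ℝ) (m : ℝ) (vr ve : ℝ≥0) : Prop where
  measurable_f : Measurable f
  measurable_e : Measurable e
  noise_law : HasLaw (fun p => f p.1 - e p.2) (gaussianReal 0 vr) P
  fit_law : HasLaw (fun p => e p.2) (gaussianReal m ve) P
  indep : IndepFun (fun p => f p.1 - e p.2) Prod.snd P

namespace GaussianRegression

variable {α β : Type*} {mα : MeasurableSpace α} {mβ : MeasurableSpace β} {P : Measure (α × β)}
  {f : α → ℝ} {e : β → ℝ} {m : ℝ} {vr ve : ℝ≥0}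

lemma hasLaw_fit_snd (h : GaussianRegression P f e m vr ve) : HasLaw e (gaussianReal m ve) P.snd :=
  ⟨h.measurable_e.aemeasurable, by
    rw [Measure.snd, Measure.map_map h.measurable_e measurable_snd]
    exact h.fit_law.map_eq⟩

lemma hasLaw_fst (h : GaussianRegression P f e m vr ve) :
    HasLaw (fun p => f p.1) (gaussianReal m (vr + ve)) P := by
  simpa only [sub_add_cancel, zero_add, Function.comp_def, id] using
    hasLaw_add_gaussianReal_of_indepFun (h.indep.comp measurable_id h.measurable_e)
      h.noise_law h.fit_law

variable [IsProbabilityMeasure P]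

lemma condExp_ae_eq (h : GaussianRegression P f e m vr ve) :
    P[fun p => f p.1 | mβ.comap Prod.snd] =ᵐ[P] fun p => e p.2 :=
  condExp_comap_ae_eq_of_indepFun_sub (h.measurable_f.comp measurable_fst) measurable_snd
    h.measurable_e h.hasLaw_fst.hasGaussianLaw.integrable h.fit_law.hasGaussianLaw.integrable
    h.indep (integral_of_hasLaw_gaussianReal h.noise_law)

end GaussianRegression

section Group

variable {d n m : ℕ} {P : Measure (Vec d × Vec d)} {f e : Vec d → ℝ} {mean : ℝ} {vr ve : ℝ≥0}

/-- The cross-fitted mean estimator when the conditional expectation `e` is known. -/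
noncomputable def oracleMean (f e : Vec d → ℝ) (L : Fin n → Vec d × Vec d) (U : Fin m → Vec d) :
    ℝ :=
  empMean (fun i => f (L i).1 - e (L i).2) + empMean (fun i => e (covariates L U i))

@[fun_prop]
lemma measurable_covariates (i : Fin (n + m)) :
    Measurable fun q : (Fin n → Vec d × Vec d) × (Fin m → Vec d) => covariates q.1 q.2 i := by
  refine Fin.addCases (fun i => ?_) (fun i => ?_) i
  · simp only [covariates, Fin.append_left]
    fun_prop
  · simp only [covariates, Fin.append_right]
    fun_prop

lemma measurable_crossFit {est : Regression d (n / 2)}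
    (hest : Measurable (Function.uncurry (est f))) (i : Fin (n + m)) :
    Measurable fun q : (Fin n → Vec d × Vec d) × (Fin m → Vec d) => crossFit est f q.1 q.2 i := by
  simp only [crossFit_eq]
  exact hest.comp (((measurable_trainingFold i).comp measurable_fst).prodMk
    (measurable_covariates i))

lemma measurable_crossMean {est : Regression d (n / 2)} (hf : Measurable f)
    (hest : Measurable (Function.uncurry (est f))) :
    Measurable fun q : (Fin n → Vec d × Vec d) × (Fin m → Vec d) => crossMean est f q.1 q.2 := by
  have fit := fun i => measurable_crossFit (m := m) hest i
  unfold crossMean residual empMean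
  fun_prop

lemma measurable_crossVar {est : Regression d (n / 2)} (hf : Measurable f)
    (hest : Measurable (Function.uncurry (est f))) :
    Measurable fun q : (Fin n → Vec d × Vec d) × (Fin m → Vec d) => crossVar est f q.1 q.2 := by
  have fit := fun i => measurable_crossFit (m := m) hest i
  unfold crossVar residual empVar empMean
  fun_prop

lemma measurable_oracleMean (hf : Measurable f) (he : Measurable e) :
    Measurable fun q : (Fin n → Vec d × Vec d) × (Fin m → Vec d) => oracleMean f e q.1 q.2 := by
  unfold oracleMean empMean
  fun_prop

lemma oracleMean_eq (hn : 0 < n) (L : Fin n → Vec d × Vec d) (U : Fin n → Vec d) :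
    oracleMean f e L U =
      (n : ℝ)⁻¹ * ∑ i, ((f (L i).1 - e (L i).2) + 2⁻¹ * e (L i).2) +
        (2 * n : ℝ)⁻¹ * ∑ i, e (U i) := by
  have hn' : (n : ℝ) ≠ 0 := by positivity
  simp only [oracleMean, empMean, covariates, Fin.sum_univ_add, Fin.append_left, Fin.append_right,
    Finset.sum_add_distrib, ← Finset.mul_sum]
  push_cast
  field_simp
  ring

lemma crossMean_sub_oracleMean (hn : Even n) (hn0 : 0 < n) (est : Regression d (n / 2))
    (L : Fin n → Vec d × Vec d) (U : Fin n → Vec d) :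
    crossMean est f L U - oracleMean f e L U =
      (2 * n : ℝ)⁻¹ * (∑ i : Fin n, (est f (trainingFold L i) (U i) - e (U i)) -
        ∑ i : Fin n, (est f (trainingFold L i) (L i).2 - e (L i).2)) := by
  have hn' : (n : ℝ) ≠ 0 := by positivity
  simp only [crossMean, oracleMean, residual, empMean, Fin.sum_univ_add, crossFit_eq, covariates,
    Fin.append_left, Fin.append_right, Fin.val_castAdd, Fin.val_natAdd, trainingFold_add hn,
    Finset.sum_sub_distrib]
  push_cast
  field_simp
  ring

section

variable [IsProbabilityMeasure P]

lemma measurePreserving_covariates :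
    MeasurePreserving (fun q : (Fin n → Vec d × Vec d) × (Fin m → Vec d) => covariates q.1 q.2)
      (sampleLaw P n m) (Measure.pi fun _ : Fin (n + m) => P.snd) := by
  have labeled : MeasurePreserving (fun (L : Fin n → Vec d × Vec d) i => (L i).2)
      (Measure.pi fun _ : Fin n => P) (Measure.pi fun _ : Fin n => P.snd) :=
    measurePreserving_pi _ _ fun _ => measurable_snd.measurePreserving P
  have pairing := labeled.prod (MeasurePreserving.id (Measure.pi fun _ : Fin m => P.snd))
  have gluing := (measurePreserving_piCongrLeft (fun _ : Fin (n + m) => P.snd) finSumFinEquiv).comp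
    (measurePreserving_sumPiEquivProdPi (fun _ : Fin n ⊕ Fin m => P.snd)).symm
  convert! gluing.comp pairing using 1
  ext q : 1
  refine (MeasurableEquiv.symm_apply_eq
    (MeasurableEquiv.piCongrLeft (fun _ : Fin (n + m) => Vec d) finSumFinEquiv)).1 ?_
  ext (i | i) : 1
  · change covariates q.1 q.2 (Fin.castAdd m i) = _
    simp only [covariates, Fin.append_left]
    rfl
  · change covariates q.1 q.2 (Fin.natAdd n i) = _
    simp only [covariates, Fin.append_right]
    rfl

lemma measurePreserving_trainingFold_covariates (hn : Even n) (i : Fin (n + m)) :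
    MeasurePreserving (fun q : (Fin n → Vec d × Vec d) × (Fin m → Vec d) =>
      (trainingFold q.1 i, covariates q.1 q.2 i)) (sampleLaw P n m)
      ((Measure.pi fun _ => P).prod P.snd) := by
  refine Fin.addCases (fun i => ?_) (fun i => ?_) i
  · simp only [covariates, Fin.append_left, Fin.val_castAdd]
    exact ((MeasurePreserving.id _).prod (measurable_snd.measurePreserving P)).comp
      ((measurePreserving_trainingFold_apply P hn i).comp measurePreserving_fst)
  · simp only [covariates, Fin.append_right, Fin.val_natAdd, trainingFold_add hn]
    exact (measurePreserving_trainingFold P hn i).prod (measurePreserving_eval (fun _ => P.snd) i)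

lemma lintegral_sq_crossMean_sub_oracleMean_le (hn : Even n) (hn0 : 0 < n)
    {est : Regression d (n / 2)} (he : Measurable e)
    (hest : Measurable (Function.uncurry (est f))) :
    ∫⁻ q, ENNReal.ofReal ((crossMean est f q.1 q.2 - oracleMean f e q.1 q.2) ^ 2)
        ∂(sampleLaw P n n) ≤
      ENNReal.ofReal (2 / n) * trainedSq P (fun t v => est f t v - e v) := by
  have : (0 : ℝ) < n := by positivity
  have constant : ENNReal.ofReal ((2 * n : ℝ)⁻¹ ^ 2) * (8 * n) = ENNReal.ofReal (2 / n) := by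
    rw [← ENNReal.ofReal_ofNat 8, ← ENNReal.ofReal_natCast n, ← ENNReal.ofReal_mul (by norm_num),
      ← ENNReal.ofReal_mul (by positivity)]
    congr 1
    field_simp
    norm_num
  simp only [crossMean_sub_oracleMean hn hn0, mul_pow, ENNReal.ofReal_mul (sq_nonneg (2 * n : ℝ)⁻¹)]
  rw [lintegral_const_mul' _ _ ENNReal.ofReal_ne_top, ← constant, mul_assoc]
  gcongr
  exact lintegral_sq_sum_trainingFold_sub_le (D := fun t v => est f t v - e v) hn
    (hest.sub (he.comp measurable_snd))

end

namespace GaussianRegression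

variable [IsProbabilityMeasure P]

lemma relMSE_eq (h : GaussianRegression P f e mean vr ve) {k : ℕ} {est : Regression d k}
    (hest : Measurable (Function.uncurry (est f))) :
    relMSE P est f = trainedSq P (fun t v => est f t v - e v) / (vr + ve : ℝ≥0) := by
  have error_measurable : Measurable (Function.uncurry fun t v => est f t v - e v) :=
    hest.sub (h.measurable_e.comp measurable_snd)
  rw [relMSE, trainedSq,
    lintegral_prod _ (error_measurable.pow_const 2).ennreal_ofReal.aemeasurable]
  congr 1
  · refine lintegral_congr fun t => ?_
    refine (lintegral_congr_ae ?_).trans ((measurable_snd.measurePreserving P).lintegral_comp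
      ((error_measurable.comp measurable_prodMk_left).pow_const 2).ennreal_ofReal)
    filter_upwards [h.condExp_ae_eq] with p hp
    rw [hp, ← neg_sub, neg_sq]
    rfl
  · rw [← h.hasLaw_fst.hasGaussianLaw.memLp_two.ofReal_variance_eq,
      variance_of_hasLaw_gaussianReal h.hasLaw_fst, ENNReal.ofReal_coe_nnreal]

lemma hasLaw_oracleMean (h : GaussianRegression P f e mean vr ve) (hn : 0 < n) :
    HasLaw (fun q : (Fin n → Vec d × Vec d) × (Fin n → Vec d) => oracleMean f e q.1 q.2)
      (gaussianReal mean ((vr + ve / 2) / n)) (sampleLaw P n n) := by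
  have labeled_law := gaussianReal_const_mul (hasLaw_sum_pi_gaussianReal fun _ : Fin n =>
    hasLaw_add_gaussianReal_of_indepFun (h.indep.comp measurable_id (h.measurable_e.const_mul 2⁻¹))
      h.noise_law (gaussianReal_const_mul h.fit_law 2⁻¹)) (n : ℝ)⁻¹
  have unlabeled_law := gaussianReal_const_mul
    (hasLaw_sum_pi_gaussianReal fun _ : Fin n => h.hasLaw_fit_snd) (2 * n : ℝ)⁻¹
  have law_eq : gaussianReal mean ((vr + ve / 2) / n) = gaussianReal
      ((n : ℝ)⁻¹ * ∑ _i : Fin n, (0 + 2⁻¹ * mean) + (2 * n : ℝ)⁻¹ * ∑ _i : Fin n, mean)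
      (.mk ((n : ℝ)⁻¹ ^ 2) (sq_nonneg _) *
          ∑ _i : Fin n, (vr + .mk ((2 : ℝ)⁻¹ ^ 2) (sq_nonneg _) * ve) +
        .mk ((2 * n : ℝ)⁻¹ ^ 2) (sq_nonneg _) * ∑ _i : Fin n, ve) := by
    have hn' : (n : ℝ) ≠ 0 := by positivity
    simp only [Finset.sum_const, Finset.card_univ, Fintype.card_fin, nsmul_eq_mul]
    congr 1
    · field_simp
      ring
    · ext
      push_cast
      field_simp
      ring
  simp only [oracleMean_eq hn, law_eq]
  exact hasLaw_prod_add_gaussianReal labeled_law unlabeled_law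

variable {est : Regression d (n / 2)} {θ : ℝ}

lemma lintegral_abs_empVar_residual_sub_le (h : GaussianRegression P f e mean vr ve)
    (hn : Even n) (hn0 : 0 < n) (hest : Measurable (Function.uncurry (est f))) (hθ : 0 < θ)
    (hθ1 : θ ≤ 1) (hV : 0 < vr + ve) :
    ∫⁻ q : (Fin n → Vec d × Vec d) × (Fin m → Vec d),
        ENNReal.ofReal |empVar (residual est f q.1 q.2) - vr| ∂(sampleLaw P n m) ≤
      ENNReal.ofReal (θ * vr + 2 * ((vr + ve) * (fourthMoment + 2) / √n)) +
        ENNReal.ofReal (2 * θ⁻¹) * trainedSq P (fun t v => est f t v - e v) := by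
  have hf := h.measurable_f
  have he := h.measurable_e
  have hK := fourthMoment_nonneg
  have error_measurable := hest.sub (he.comp measurable_snd)
  have oracle_noise : MeasurePreserving (fun (L : Fin n → Vec d × Vec d) i =>
      f (L i).1 - e (L i).2) (Measure.pi fun _ => P) (Measure.pi fun _ => gaussianReal 0 vr) :=
    measurePreserving_pi _ _ fun _ => h.noise_law.measurePreserving (by fun_prop)
  have residual_eq : ∀ q : (Fin n → Vec d × Vec d) × (Fin m → Vec d), residual est f q.1 q.2 =
      fun i => (f (q.1 i).1 - e (q.1 i).2) +
        -(est f (trainingFold q.1 i) (q.1 i).2 - e (q.1 i).2) := by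
    intro q
    ext i
    rw [residual, crossFit_eq, covariates, Fin.append_left, Fin.val_castAdd]
    ring
  have fold_law := fun i : Fin n => measurePreserving_trainingFold_covariates (P := P) (m := m) hn
    (Fin.castAdd m i)
  simp only [covariates, Fin.append_left, Fin.val_castAdd] at fold_law
  simp_rw [residual_eq]
  refine lintegral_abs_empVar_add_sub_le hn0
    (fun i => (error_measurable.comp (fold_law i).measurable).neg) vr.coe_nonneg (by positivity)
    hθ hθ1 ?_ fun i => ?_
  · refine ((oracle_noise.comp measurePreserving_fst).lintegral_comp
      (f := fun x => ENNReal.ofReal |empVar x - vr|)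
      (by unfold empVar empMean; fun_prop)).trans_le ?_
    exact_mod_cast lintegral_abs_empVar_sub_gaussianReal_le hn0 0 le_self_add hV
  · simp only [Pi.neg_apply, neg_sq]
    exact ((fold_law i).lintegral_comp (error_measurable.pow_const 2).ennreal_ofReal).le

lemma lintegral_abs_empVar_crossFit_sub_le (h : GaussianRegression P f e mean vr ve)
    (hn : Even n) (hn0 : 0 < n) (hest : Measurable (Function.uncurry (est f))) (hθ : 0 < θ)
    (hθ1 : θ ≤ 1) (hV : 0 < vr + ve) :
    ∫⁻ q : (Fin n → Vec d × Vec d) × (Fin m → Vec d),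
        ENNReal.ofReal |empVar (crossFit est f q.1 q.2) - ve| ∂(sampleLaw P n m) ≤
      ENNReal.ofReal (θ * ve + 2 * ((vr + ve) * (fourthMoment + 2) / √n)) +
        ENNReal.ofReal (2 * θ⁻¹) * trainedSq P (fun t v => est f t v - e v) := by
  have he := h.measurable_e
  have hK := fourthMoment_nonneg
  have : (0 : ℝ) < n := by positivity
  have error_measurable := hest.sub (he.comp measurable_snd)
  have oracle_fit : MeasurePreserving (fun (w : Fin (n + m) → Vec d) i => e (w i))
      (Measure.pi fun _ => P.snd) (Measure.pi fun _ => gaussianReal mean ve) :=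
    measurePreserving_pi _ _ fun _ => h.hasLaw_fit_snd.measurePreserving he
  have crossFit_add : ∀ q : (Fin n → Vec d × Vec d) × (Fin m → Vec d), crossFit est f q.1 q.2 =
      fun i => e (covariates q.1 q.2 i) +
        (est f (trainingFold q.1 i) (covariates q.1 q.2 i) - e (covariates q.1 q.2 i)) :=
    fun q => funext fun i => by rw [crossFit_eq, add_sub_cancel]
  have fold_law := fun i : Fin (n + m) => measurePreserving_trainingFold_covariates (P := P) hn i
  simp only [crossFit_add]
  refine lintegral_abs_empVar_add_sub_le (by omega)
    (fun i => error_measurable.comp (fold_law i).measurable) ve.coe_nonneg (by positivity)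
    hθ hθ1 ?_ fun i =>
      ((fold_law i).lintegral_comp (error_measurable.pow_const 2).ennreal_ofReal).le
  refine ((oracle_fit.comp measurePreserving_covariates).lintegral_comp
    (f := fun x => ENNReal.ofReal |empVar x - ve|) (by unfold empVar empMean; fun_prop)).trans_le ?_
  refine (lintegral_abs_empVar_sub_gaussianReal_le (n := n + m) (by omega) mean le_add_self
    hV).trans (ENNReal.ofReal_le_ofReal ?_)
  push_cast
  gcongr
  linarith [(Nat.cast_nonneg m : (0 : ℝ) ≤ m)]

lemma lintegral_abs_crossVar_sub_le (h : GaussianRegression P f e mean vr ve)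
    (hn : Even n) (hn0 : 0 < n) (hest : Measurable (Function.uncurry (est f))) (hθ : 0 < θ)
    (hθ1 : θ ≤ 1) (hV : 0 < vr + ve) :
    ∫⁻ q, ENNReal.ofReal |n * crossVar est f q.1 q.2 - (vr + ve / 2)| ∂(sampleLaw P n n) ≤
      2 * (ENNReal.ofReal ((vr + ve) * (θ + 2 * (fourthMoment + 2) / √n)) +
        ENNReal.ofReal (2 * θ⁻¹) * trainedSq P (fun t v => est f t v - e v)) := by
  have triangle : ∀ q : (Fin n → Vec d × Vec d) × (Fin n → Vec d),
      ENNReal.ofReal |n * crossVar est f q.1 q.2 - (vr + ve / 2)| ≤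
        ENNReal.ofReal |empVar (residual est f q.1 q.2) - vr| +
          ENNReal.ofReal |empVar (crossFit est f q.1 q.2) - ve| := by
    intro q
    have hn' : (n : ℝ) ≠ 0 := by positivity
    have decomposition : n * crossVar est f q.1 q.2 - (vr + ve / 2) =
        (empVar (residual est f q.1 q.2) - vr) + (empVar (crossFit est f q.1 q.2) - ve) / 2 := by
      rw [crossVar]
      push_cast
      field_simp
      ring
    rw [← ENNReal.ofReal_add (abs_nonneg _) (abs_nonneg _), decomposition]
    refine ENNReal.ofReal_le_ofReal ((abs_add_le _ _).trans ?_)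
    rw [abs_div, abs_two]
    linarith [abs_nonneg (empVar (crossFit est f q.1 q.2) - ve)]
  have fit_measurable := fun i => measurable_crossFit (m := n) hest i
  have variance_le : ∀ w : ℝ, w ≤ vr + ve →
      ENNReal.ofReal (θ * w + 2 * ((vr + ve) * (fourthMoment + 2) / √n)) ≤
        ENNReal.ofReal ((vr + ve) * (θ + 2 * (fourthMoment + 2) / √n)) := by
    refine fun w hw => ENNReal.ofReal_le_ofReal ?_
    have : θ * w ≤ θ * (vr + ve) := by gcongr
    linear_combination this
  refine (lintegral_mono triangle).trans ?_
  rw [lintegral_add_right _ (by unfold empVar empMean; fun_prop), two_mul]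
  refine add_le_add
    ((h.lintegral_abs_empVar_residual_sub_le hn hn0 hest hθ hθ1 hV).trans ?_)
    ((h.lintegral_abs_empVar_crossFit_sub_le hn hn0 hest hθ hθ1 hV).trans ?_)
  · exact add_le_add (variance_le vr (by simp)) le_rfl
  · exact add_le_add (variance_le ve (by simp)) le_rfl

end GaussianRegression

end Group

/-! ### The conditional power given the witness function -/

lemma measureReal_ge_le_of_lintegral_le {Ω : Type*} {mΩ : MeasurableSpace Ω} {ν : Measure Ω}
    {X : Ω → ℝ} (hX : AEMeasurable X ν) {b c : ℝ} (hb : 0 ≤ b) (hc : 0 < c)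
    (h : ∫⁻ ω, ENNReal.ofReal (X ω) ∂ν ≤ ENNReal.ofReal b) :
    ν.real {ω | c ≤ X ω} ≤ b / c := by
  have markov := meas_ge_le_lintegral_div hX.ennreal_ofReal (ENNReal.ofReal_pos.2 hc).ne'
    ENNReal.ofReal_ne_top
  refine ENNReal.toReal_le_of_le_ofReal (by positivity) ?_
  rw [ENNReal.ofReal_div_of_pos hc]
  calc ν {ω | c ≤ X ω} ≤ ν {ω | ENNReal.ofReal c ≤ ENNReal.ofReal (X ω)} :=
        measure_mono fun ω hω => ENNReal.ofReal_le_ofReal hω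
    _ ≤ _ := markov.trans (ENNReal.div_le_div_right h _)

section TwoSample

variable {Ω₁ Ω₂ : Type*} {mΩ₁ : MeasurableSpace Ω₁} {mΩ₂ : MeasurableSpace Ω₂}
  {μ₁ : Measure Ω₁} {μ₂ : Measure Ω₂} [IsProbabilityMeasure μ₁] [IsProbabilityMeasure μ₂]

lemma lintegral_prod_add_le {A : Ω₁ → ℝ} {B : Ω₂ → ℝ} (hA : Measurable A) (hB : Measurable B)
    (hA0 : ∀ x, 0 ≤ A x) (hB0 : ∀ x, 0 ≤ B x) {a b : ℝ} (ha : 0 ≤ a) (hb : 0 ≤ b)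
    (iA : ∫⁻ x, ENNReal.ofReal (A x) ∂μ₁ ≤ ENNReal.ofReal a)
    (iB : ∫⁻ x, ENNReal.ofReal (B x) ∂μ₂ ≤ ENNReal.ofReal b) :
    ∫⁻ ω, ENNReal.ofReal (A ω.1 + B ω.2) ∂(μ₁.prod μ₂) ≤ ENNReal.ofReal (a + b) := by
  simp only [ENNReal.ofReal_add (hA0 _) (hB0 _)]
  rw [lintegral_add_left (by fun_prop), ENNReal.ofReal_add ha hb]
  exact add_le_add ((measurePreserving_fst.lintegral_comp hA.ennreal_ofReal).trans_le iA)
    ((measurePreserving_snd.lintegral_comp hB.ennreal_ofReal).trans_le iB)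

lemma measureReal_abs_sub_sub_sub_ge_le {A O : Ω₁ → ℝ} {B O' : Ω₂ → ℝ} (hA : Measurable A)
    (hO : Measurable O) (hB : Measurable B) (hO' : Measurable O') {a b c : ℝ} (ha : 0 ≤ a)
    (hb : 0 ≤ b) (hc : 0 < c)
    (iA : ∫⁻ x, ENNReal.ofReal ((A x - O x) ^ 2) ∂μ₁ ≤ ENNReal.ofReal a)
    (iB : ∫⁻ x, ENNReal.ofReal ((B x - O' x) ^ 2) ∂μ₂ ≤ ENNReal.ofReal b) :
    (μ₁.prod μ₂).real {ω | c ≤ |A ω.1 - B ω.2 - (O ω.1 - O' ω.2)|} ≤ (a + b) / (c ^ 2 / 2) := by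
  refine (measureReal_mono fun ω hω => ?_).trans
    (measureReal_ge_le_of_lintegral_le (by fun_prop) (by positivity) (by positivity)
      (lintegral_prod_add_le (A := fun x => (A x - O x) ^ 2) (B := fun x => (B x - O' x) ^ 2)
        (by fun_prop) (by fun_prop) (fun _ => sq_nonneg _) (fun _ => sq_nonneg _) ha hb iA iB))
  have hsq := pow_le_pow_left₀ hc.le (Set.mem_ofPred_eq ▸ hω : c ≤ |_|) 2
  rw [sq_abs] at hsq
  change c ^ 2 / 2 ≤ (A ω.1 - O ω.1) ^ 2 + (B ω.2 - O' ω.2) ^ 2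
  linarith [sq_nonneg (A ω.1 - O ω.1 + (B ω.2 - O' ω.2))]

lemma measureReal_abs_add_div_sub_one_ge_le {A : Ω₁ → ℝ} {B : Ω₂ → ℝ} (hA : Measurable A)
    (hB : Measurable B) {v w a b c : ℝ} (hvw : 0 < v + w) (ha : 0 ≤ a) (hb : 0 ≤ b) (hc : 0 < c)
    (iA : ∫⁻ x, ENNReal.ofReal |A x - v| ∂μ₁ ≤ ENNReal.ofReal a)
    (iB : ∫⁻ x, ENNReal.ofReal |B x - w| ∂μ₂ ≤ ENNReal.ofReal b) :
    (μ₁.prod μ₂).real {ω | c ≤ |(A ω.1 + B ω.2) / (v + w) - 1|} ≤ (a + b) / (c * (v + w)) := by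
  refine (measureReal_mono fun ω hω => ?_).trans
    (measureReal_ge_le_of_lintegral_le (by fun_prop) (by positivity) (by positivity)
      (lintegral_prod_add_le (A := fun x => |A x - v|) (B := fun x => |B x - w|)
        (by fun_prop) (by fun_prop) (fun _ => abs_nonneg _) (fun _ => abs_nonneg _) ha hb iA iB))
  change c ≤ |(A ω.1 + B ω.2) / (v + w) - 1| at hω
  rw [div_sub_one hvw.ne', abs_div, abs_of_pos hvw, le_div_iff₀ hvw, add_sub_add_comm] at hω
  exact hω.trans (abs_add_le _ _)

lemma abs_two_sample_power_sub_le {C₁ O₁ S₁ : Ω₁ → ℝ} {C₂ O₂ S₂ : Ω₂ → ℝ}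
    (hC₁ : Measurable C₁) (hO₁ : Measurable O₁) (hS₁ : Measurable S₁)
    (hC₂ : Measurable C₂) (hO₂ : Measurable O₂) (hS₂ : Measurable S₂)
    {m₁ m₂ a₁ a₂ b₁ b₂ κ : ℝ} {v₁ v₂ : ℝ≥0} (hv : 0 < v₁ + v₂) (ha₁ : 0 ≤ a₁) (ha₂ : 0 ≤ a₂)
    (hb₁ : 0 ≤ b₁) (hb₂ : 0 ≤ b₂) (hκ : 0 < κ) (hκ1 : κ ≤ 1)
    (law₁ : HasLaw O₁ (gaussianReal m₁ v₁) μ₁) (law₂ : HasLaw O₂ (gaussianReal m₂ v₂) μ₂)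
    (hCO₁ : ∫⁻ x, ENNReal.ofReal ((C₁ x - O₁ x) ^ 2) ∂μ₁ ≤ ENNReal.ofReal a₁)
    (hCO₂ : ∫⁻ x, ENNReal.ofReal ((C₂ x - O₂ x) ^ 2) ∂μ₂ ≤ ENNReal.ofReal a₂)
    (hSv₁ : ∫⁻ x, ENNReal.ofReal |S₁ x - v₁| ∂μ₁ ≤ ENNReal.ofReal b₁)
    (hSv₂ : ∫⁻ x, ENNReal.ofReal |S₂ x - v₂| ∂μ₂ ≤ ENNReal.ofReal b₂) (t : ℝ) :
    |(μ₁.prod μ₂).real {ω | t < (C₁ ω.1 - C₂ ω.2) / √(S₁ ω.1 + S₂ ω.2)} -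
      Phi (-t + (m₁ - m₂) / √(v₁ + v₂ : ℝ))| ≤
      κ * (|t| + 1) + 2 * (a₁ + a₂) / (κ ^ 2 * (v₁ + v₂)) + (b₁ + b₂) / (κ * (v₁ + v₂)) := by
  have hv' : (0 : ℝ) < v₁ + v₂ := mod_cast hv
  have difference_law : HasLaw (fun ω : Ω₁ × Ω₂ => O₁ ω.1 - O₂ ω.2)
      (gaussianReal (m₁ - m₂) (v₁ + v₂)) (μ₁.prod μ₂) := by
    have h := hasLaw_prod_add_gaussianReal law₁ (gaussianReal_const_mul law₂ (-1))
    have variance_eq : .mk ((-1 : ℝ) ^ 2) (sq_nonneg _) * v₂ = v₂ := by ext; simp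
    simpa only [variance_eq, neg_one_mul, ← sub_eq_add_neg] using h
  have mean_error := measureReal_abs_sub_sub_sub_ge_le hC₁ hO₁ hC₂ hO₂ ha₁ ha₂
    (mul_pos hκ (Real.sqrt_pos.2 hv')) hCO₁ hCO₂
  have variance_error := measureReal_abs_add_div_sub_one_ge_le hS₁ hS₂ hv' hb₁ hb₂ hκ hSv₁ hSv₂
  rw [mul_pow, Real.sq_sqrt hv'.le, div_div_eq_mul_div, mul_comm _ 2] at mean_error
  have studentized := abs_measureReal_studentized_sub_le hv.ne' difference_law t hκ hκ1
    (N := fun ω => C₁ ω.1 - C₂ ω.2) (S := fun ω => S₁ ω.1 + S₂ ω.2)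
  push_cast at studentized
  exact studentized.trans (add_le_add (add_le_add le_rfl mean_error) variance_error)

end TwoSample

section ConditionalPower

variable {d n : ℕ} {P Q : Measure (Vec d × Vec d)} [IsProbabilityMeasure P]
  [IsProbabilityMeasure Q] {f eX eY : Vec d → ℝ} {mX mY ρ : ℝ} {vr ve : ℝ≥0}

lemma GaussianRegression.lintegral_abs_crossVar_sub_le_of_trainedSq_le
    (h : GaussianRegression P f eX mX vr ve) (hn : Even n) (hn0 : 0 < n)
    {est : Regression d (n / 2)} (hest : Measurable (Function.uncurry (est f)))
    (hV : 0 < vr + ve) (hρ : 0 < ρ) (hρ1 : ρ ≤ 1)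
    (hm : trainedSq P (fun t v => est f t v - eX v) ≤ ENNReal.ofReal (ρ * (vr + ve))) :
    ∫⁻ q, ENNReal.ofReal |crossVar est f q.1 q.2 - ((vr + ve / 2) / n : ℝ≥0)|
        ∂(sampleLaw P n n) ≤
      ENNReal.ofReal (2 * (vr + ve) * (3 * √ρ + 2 * (fourthMoment + 2) / √n) / n) := by
  have hK := fourthMoment_nonneg
  have hn' : (0 : ℝ) < n := by positivity
  have hsqrt : 0 < √ρ := Real.sqrt_pos.2 hρ
  have rescale : ∀ q : (Fin n → Vec d × Vec d) × (Fin n → Vec d),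
      ENNReal.ofReal |crossVar est f q.1 q.2 - ((vr + ve / 2) / n : ℝ≥0)| =
        ENNReal.ofReal (n : ℝ)⁻¹ *
          ENNReal.ofReal |n * crossVar est f q.1 q.2 - (vr + ve / 2)| := by
    intro q
    rw [← ENNReal.ofReal_mul (by positivity), ← abs_of_pos (inv_pos.2 hn'), ← abs_mul]
    congr 2
    push_cast
    field_simp
  have cancel : 2 * (√ρ)⁻¹ * (ρ * (vr + ve)) = 2 * √ρ * (vr + ve) := by
    field_simp
    rw [Real.sq_sqrt hρ.le]
  simp only [rescale]
  rw [lintegral_const_mul' _ _ ENNReal.ofReal_ne_top]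
  calc _ ≤ ENNReal.ofReal (n : ℝ)⁻¹ *
        (2 * (ENNReal.ofReal ((vr + ve) * (√ρ + 2 * (fourthMoment + 2) / √n)) +
          ENNReal.ofReal (2 * (√ρ)⁻¹) * ENNReal.ofReal (ρ * (vr + ve)))) := by
        gcongr
        refine (h.lintegral_abs_crossVar_sub_le hn hn0 hest hsqrt (Real.sqrt_le_one.2 hρ1) hV).trans
          ?_
        gcongr
    _ = _ := by
        rw [← ENNReal.ofReal_mul (by positivity), cancel, ← ENNReal.ofReal_add (by positivity)
          (by positivity), ← ENNReal.ofReal_ofNat 2, ← ENNReal.ofReal_mul (by norm_num),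
          ← ENNReal.ofReal_mul (by positivity)]
        congr 1
        ring

/-- The outcomes of the regression samples of the two groups for which the statistic exceeds `t`,
when `f` is used in place of the witness function. -/
def rejectionRegion {d n₁ n₂ m₁ m₂ : ℕ} (estX : Regression d (n₁ / 2))
    (estY : Regression d (n₂ / 2)) (f : Vec d → ℝ) (t : ℝ) :
    Set (((Fin n₁ → Vec d × Vec d) × (Fin m₁ → Vec d)) ×
      ((Fin n₂ → Vec d × Vec d) × (Fin m₂ → Vec d))) :=
  {ω | t < (crossMean estX f ω.1.1 ω.1.2 - crossMean estY f ω.2.1 ω.2.2) /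
    √(crossVar estX f ω.1.1 ω.1.2 + crossVar estY f ω.2.1 ω.2.2)}

lemma abs_conditional_power_sub_le (hX : GaussianRegression P f eX mX vr ve)
    (hY : GaussianRegression Q f eY mY vr ve) (hn : Even n) (hn0 : 0 < n)
    {estX estY : Regression d (n / 2)} (hestX : Measurable (Function.uncurry (estX f)))
    (hestY : Measurable (Function.uncurry (estY f))) (hV : 0 < vr + ve) (hρ : 0 < ρ)
    (hρ1 : ρ ≤ 1) {κ : ℝ} (hκ : 0 < κ) (hκ1 : κ ≤ 1)
    (hmX : trainedSq P (fun t v => estX f t v - eX v) ≤ ENNReal.ofReal (ρ * (vr + ve)))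
    (hmY : trainedSq Q (fun t v => estY f t v - eY v) ≤ ENNReal.ofReal (ρ * (vr + ve))) (t : ℝ) :
    |((sampleLaw P n n).prod (sampleLaw Q n n)).real (rejectionRegion estX estY f t) -
      Phi (-t + (mX - mY) / √(2 * (vr + ve / 2) / n))| ≤
      κ * (|t| + 1) + 8 * ρ / κ ^ 2 + 4 * (3 * √ρ + 2 * (fourthMoment + 2) / √n) / κ := by
  have hf := hX.measurable_f
  have hK := fourthMoment_nonneg
  have hV' : (0 : ℝ) < vr + ve := mod_cast hV
  have half_le : (vr + ve : ℝ) / 2 ≤ vr + ve / 2 := by linarith [vr.coe_nonneg]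
  have hq : (0 : ℝ) < vr + ve / 2 := by linarith
  have variance_pos : 0 < (vr + ve / 2) / n + (vr + ve / 2) / n := by
    rw [← NNReal.coe_pos]
    push_cast
    positivity
  have scale : ∀ {M : ℝ≥0∞}, M ≤ ENNReal.ofReal (ρ * (vr + ve)) →
      ENNReal.ofReal (2 / n) * M ≤ ENNReal.ofReal (2 / n * (ρ * (vr + ve))) := by
    intro M hM
    rw [ENNReal.ofReal_mul (by positivity)]
    gcongr
  have two_sample := abs_two_sample_power_sub_le (measurable_crossMean (m := n) hf hestX)
    (measurable_oracleMean hf hX.measurable_e) (measurable_crossVar hf hestX)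
    (measurable_crossMean (m := n) hf hestY) (measurable_oracleMean hf hY.measurable_e)
    (measurable_crossVar hf hestY) variance_pos (by positivity) (by positivity) (by positivity)
    (by positivity) hκ hκ1 (hX.hasLaw_oracleMean hn0) (hY.hasLaw_oracleMean hn0)
    ((lintegral_sq_crossMean_sub_oracleMean_le hn hn0 hX.measurable_e hestX).trans (scale hmX))
    ((lintegral_sq_crossMean_sub_oracleMean_le hn hn0 hY.measurable_e hestY).trans (scale hmY))
    (hX.lintegral_abs_crossVar_sub_le_of_trainedSq_le hn hn0 hestX hV hρ hρ1 hmX)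
    (hY.lintegral_abs_crossVar_sub_le_of_trainedSq_le hn hn0 hestY hV hρ hρ1 hmY) t
  push_cast at two_sample
  rw [← two_mul (_ / _ : ℝ), ← mul_div_assoc] at two_sample
  refine two_sample.trans (add_le_add (add_le_add le_rfl ?_) ?_)
  · calc _ ≤ 2 * (2 / n * (ρ * (vr + ve)) + 2 / n * (ρ * (vr + ve))) /
          (κ ^ 2 * (2 * ((vr + ve) / 2) / n)) := by gcongr
      _ = _ := by
        field_simp
        ring
  · rw [← two_mul]
    calc _ ≤ 2 * (2 * (vr + ve) * (3 * √ρ + 2 * (fourthMoment + 2) / √n) / n) /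
          (κ * (2 * ((vr + ve) / 2) / n)) := by gcongr
      _ = _ := by
        field_simp
        ring

end ConditionalPower

/-! ### Gaussian pairs -/

section GaussianPair

variable {d : ℕ} {μ₁ μ₂ : Vec d} {S₁₁ S₁₂ S₂₁ S₂₂ : Matrix (Fin d) (Fin d) ℝ}

/-- The two halves of a vector, as a continuous linear map. -/
noncomputable def splitCLM (d : ℕ) : EuclideanSpace ℝ (Fin d ⊕ Fin d) →L[ℝ] Vec d × Vec d :=
  LinearMap.toContinuousLinearMap
    { toFun := fun z => ((WithLp.toLp 2 (fun i => z (Sum.inl i)) : Vec d),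
        (WithLp.toLp 2 (fun i => z (Sum.inr i)) : Vec d))
      map_add' := fun _ _ => rfl
      map_smul' := fun _ _ => rfl }

lemma gaussianPair_eq_map_splitCLM : gaussianPair μ₁ μ₂ S₁₁ S₁₂ S₂₁ S₂₂ =
    (multivariateGaussian (WithLp.toLp 2 (Sum.elim (fun i => μ₁ i) (fun i => μ₂ i)))
      (Matrix.fromBlocks S₁₁ S₁₂ S₂₁ S₂₂)).map (splitCLM d) := rfl

instance isGaussian_gaussianPair : IsGaussian (gaussianPair μ₁ μ₂ S₁₁ S₁₂ S₂₁ S₂₂) := by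
  rw [gaussianPair_eq_map_splitCLM]
  infer_instance

lemma inner_splitCLM (a b : Vec d) (z : EuclideanSpace ℝ (Fin d ⊕ Fin d)) :
    ⟪a, (splitCLM d z).1⟫ + ⟪b, (splitCLM d z).2⟫ =
      ⟪(WithLp.toLp 2 (Sum.elim (fun i => a i) (fun i => b i)) :
        EuclideanSpace ℝ (Fin d ⊕ Fin d)), z⟫ := by
  simp only [PiLp.inner_apply, Fintype.sum_sum_type, Sum.elim_inl, Sum.elim_inr]
  rfl

lemma integral_inner_gaussianPair (a b : Vec d) :
    ∫ p, (⟪a, p.1⟫ + ⟪b, p.2⟫) ∂(gaussianPair μ₁ μ₂ S₁₁ S₁₂ S₂₁ S₂₂) = ⟪a, μ₁⟫ + ⟪b, μ₂⟫ := by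
  rw [gaussianPair_eq_map_splitCLM, integral_map (by fun_prop) (by fun_prop)]
  simp only [inner_splitCLM]
  rw [integral_inner IsGaussian.integrable_fun_id, integral_id_multivariateGaussian,
    ← inner_splitCLM]
  rfl

lemma covariance_inner_gaussianPair (hS : (Matrix.fromBlocks S₁₁ S₁₂ S₂₁ S₂₂).PosSemidef)
    (a b a' b' : Vec d) :
    cov[fun p => ⟪a, p.1⟫ + ⟪b, p.2⟫, fun p => ⟪a', p.1⟫ + ⟪b', p.2⟫;
        gaussianPair μ₁ μ₂ S₁₁ S₁₂ S₂₁ S₂₂] =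
      a.ofLp ⬝ᵥ (S₁₁ *ᵥ a'.ofLp + S₁₂ *ᵥ b'.ofLp) +
        b.ofLp ⬝ᵥ (S₂₁ *ᵥ a'.ofLp + S₂₂ *ᵥ b'.ofLp) := by
  rw [gaussianPair_eq_map_splitCLM, covariance_map (by fun_prop) (by fun_prop) (by fun_prop)]
  simp only [Function.comp_def, inner_splitCLM]
  rw [← covarianceBilin_apply_eq_cov IsGaussian.memLp_two_id,
    covarianceBilin_multivariateGaussian hS]
  simp only [Matrix.fromBlocks_mulVec]
  exact sumElim_dotProduct_sumElim _ _ _ _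

lemma hasLaw_inner_gaussianPair (hS : (Matrix.fromBlocks S₁₁ S₁₂ S₂₁ S₂₂).PosSemidef)
    (a b : Vec d) {v : ℝ≥0} (hv : a.ofLp ⬝ᵥ (S₁₁ *ᵥ a.ofLp + S₁₂ *ᵥ b.ofLp) +
      b.ofLp ⬝ᵥ (S₂₁ *ᵥ a.ofLp + S₂₂ *ᵥ b.ofLp) = v) :
    HasLaw (fun p => ⟪a, p.1⟫ + ⟪b, p.2⟫) (gaussianReal (⟪a, μ₁⟫ + ⟪b, μ₂⟫) v)
      (gaussianPair μ₁ μ₂ S₁₁ S₁₂ S₂₁ S₂₂) := by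
  have gaussian : HasGaussianLaw (fun p : Vec d × Vec d => ⟪a, p.1⟫ + ⟪b, p.2⟫)
      (gaussianPair μ₁ μ₂ S₁₁ S₁₂ S₂₁ S₂₂) :=
    IsGaussian.hasGaussianLaw_id.map_fun
      ((innerSL ℝ a).comp (ContinuousLinearMap.fst ℝ (Vec d) (Vec d)) +
        (innerSL ℝ b).comp (ContinuousLinearMap.snd ℝ (Vec d) (Vec d)))
  refine hasLaw_gaussianReal_of_hasGaussianLaw gaussian (integral_inner_gaussianPair a b) ?_
  rw [← hv, ← covariance_inner_gaussianPair (μ₁ := μ₁) (μ₂ := μ₂) hS,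
    covariance_self (by fun_prop)]

lemma quadratic_blocks_nonneg (hS : (Matrix.fromBlocks S₁₁ S₁₂ S₂₁ S₂₂).PosSemidef)
    (a b : Vec d) :
    0 ≤ a.ofLp ⬝ᵥ (S₁₁ *ᵥ a.ofLp + S₁₂ *ᵥ b.ofLp) +
      b.ofLp ⬝ᵥ (S₂₁ *ᵥ a.ofLp + S₂₂ *ᵥ b.ofLp) := by
  have h := hS.dotProduct_mulVec_nonneg (Sum.elim a.ofLp b.ofLp)
  rwa [star_trivial, Matrix.fromBlocks_mulVec, sumElim_dotProduct_sumElim] at h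

/-- The slope of the regression of `⟨a, X⟩` on `V`. -/
noncomputable def regressionSlope (S₂₁ S₂₂ : Matrix (Fin d) (Fin d) ℝ) (a : Vec d) : Vec d :=
  WithLp.toLp 2 (S₂₂⁻¹ *ᵥ (S₂₁ *ᵥ a.ofLp))

/-- The conditional expectation of `⟨a, X⟩` given `V = v`. -/
noncomputable def regressionFun (μ₁ μ₂ : Vec d) (S₂₁ S₂₂ : Matrix (Fin d) (Fin d) ℝ) (a v : Vec d) :
    ℝ :=
  ⟪regressionSlope S₂₁ S₂₂ a, v⟫ + (⟪a, μ₁⟫ - ⟪regressionSlope S₂₁ S₂₂ a, μ₂⟫)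

/-- The variance of `E[⟨a, X⟩ | V]`. -/
noncomputable def fitVar (S₁₂ S₂₁ S₂₂ : Matrix (Fin d) (Fin d) ℝ) (a : Vec d) : ℝ :=
  a.ofLp ⬝ᵥ ((S₁₂ * S₂₂⁻¹ * S₂₁) *ᵥ a.ofLp)

/-- The variance of `⟨a, X⟩ - E[⟨a, X⟩ | V]`. -/
noncomputable def noiseVar (S₁₁ S₁₂ S₂₁ S₂₂ : Matrix (Fin d) (Fin d) ℝ) (a : Vec d) : ℝ :=
  a.ofLp ⬝ᵥ (S₁₁ *ᵥ a.ofLp) - fitVar S₁₂ S₂₁ S₂₂ a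

lemma blocks_transpose (hS : (Matrix.fromBlocks S₁₁ S₁₂ S₂₁ S₂₂).PosSemidef) :
    S₁₁ᵀ = S₁₁ ∧ S₁₂ᵀ = S₂₁ ∧ S₂₁ᵀ = S₁₂ ∧ S₂₂ᵀ = S₂₂ := by
  have h := hS.isHermitian
  rw [Matrix.IsHermitian, Matrix.fromBlocks_conjTranspose, Matrix.fromBlocks_inj] at h
  simp only [Matrix.conjTranspose_eq_transpose_of_trivial] at h
  exact ⟨h.1, h.2.2.1, h.2.1, h.2.2.2⟩

lemma mulVec_regressionSlope (h₂₂ : IsUnit S₂₂) (a : Vec d) :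
    S₂₂ *ᵥ (regressionSlope S₂₁ S₂₂ a).ofLp = S₂₁ *ᵥ a.ofLp := by
  rw [regressionSlope, Matrix.mulVec_mulVec, Matrix.mul_nonsing_inv _
    ((Matrix.isUnit_iff_isUnit_det _).1 h₂₂), Matrix.one_mulVec]

lemma dotProduct_mulVec_regressionSlope (a : Vec d) :
    a.ofLp ⬝ᵥ (S₁₂ *ᵥ (regressionSlope S₂₁ S₂₂ a).ofLp) = fitVar S₁₂ S₂₁ S₂₂ a := by
  rw [fitVar, regressionSlope, Matrix.mulVec_mulVec, Matrix.mulVec_mulVec]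

lemma regressionSlope_dotProduct (hS : (Matrix.fromBlocks S₁₁ S₁₂ S₂₁ S₂₂).PosSemidef)
    (a : Vec d) :
    (regressionSlope S₂₁ S₂₂ a).ofLp ⬝ᵥ (S₂₁ *ᵥ a.ofLp) = fitVar S₁₂ S₂₁ S₂₂ a := by
  rw [← dotProduct_mulVec_regressionSlope, Matrix.dotProduct_mulVec, dotProduct_comm,
    ← Matrix.mulVec_transpose, (blocks_transpose hS).2.2.1, dotProduct_comm, dotProduct_comm]

lemma quadratic_blocks_fit (hS : (Matrix.fromBlocks S₁₁ S₁₂ S₂₁ S₂₂).PosSemidef)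
    (h₂₂ : IsUnit S₂₂) (a : Vec d) :
    (0 : Vec d).ofLp ⬝ᵥ (S₁₁ *ᵥ (0 : Vec d).ofLp + S₁₂ *ᵥ (regressionSlope S₂₁ S₂₂ a).ofLp) +
        (regressionSlope S₂₁ S₂₂ a).ofLp ⬝ᵥ
          (S₂₁ *ᵥ (0 : Vec d).ofLp + S₂₂ *ᵥ (regressionSlope S₂₁ S₂₂ a).ofLp) =
      fitVar S₁₂ S₂₁ S₂₂ a := by
  simp [mulVec_regressionSlope h₂₂, regressionSlope_dotProduct hS]

lemma quadratic_blocks_noise (h₂₂ : IsUnit S₂₂) (a : Vec d) :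
    a.ofLp ⬝ᵥ (S₁₁ *ᵥ a.ofLp + S₁₂ *ᵥ (-regressionSlope S₂₁ S₂₂ a).ofLp) +
        (-regressionSlope S₂₁ S₂₂ a).ofLp ⬝ᵥ
          (S₂₁ *ᵥ a.ofLp + S₂₂ *ᵥ (-regressionSlope S₂₁ S₂₂ a).ofLp) =
      noiseVar S₁₁ S₁₂ S₂₁ S₂₂ a := by
  rw [WithLp.ofLp_neg, Matrix.mulVec_neg, Matrix.mulVec_neg, mulVec_regressionSlope h₂₂, noiseVar,
    add_neg_cancel, dotProduct_zero, add_zero, dotProduct_add, dotProduct_neg,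
    dotProduct_mulVec_regressionSlope, sub_eq_add_neg]

lemma fitVar_nonneg (hS : (Matrix.fromBlocks S₁₁ S₁₂ S₂₁ S₂₂).PosSemidef) (h₂₂ : IsUnit S₂₂)
    (a : Vec d) : 0 ≤ fitVar S₁₂ S₂₁ S₂₂ a :=
  (quadratic_blocks_nonneg hS _ _).trans_eq (quadratic_blocks_fit hS h₂₂ a)

lemma noiseVar_nonneg (hS : (Matrix.fromBlocks S₁₁ S₁₂ S₂₁ S₂₂).PosSemidef) (h₂₂ : IsUnit S₂₂)
    (a : Vec d) : 0 ≤ noiseVar S₁₁ S₁₂ S₂₁ S₂₂ a :=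
  (quadratic_blocks_nonneg hS _ _).trans_eq (quadratic_blocks_noise h₂₂ a)

lemma measurable_regressionFun (a : Vec d) : Measurable (regressionFun μ₁ μ₂ S₂₁ S₂₂ a) := by
  unfold regressionFun
  fun_prop

lemma inner_sub_regressionFun (a : Vec d) (p : Vec d × Vec d) :
    ⟪a, p.1⟫ - regressionFun μ₁ μ₂ S₂₁ S₂₂ a p.2 =
      ⟪a, p.1⟫ + ⟪-regressionSlope S₂₁ S₂₂ a, p.2⟫ -
        (⟪a, μ₁⟫ + ⟪-regressionSlope S₂₁ S₂₂ a, μ₂⟫) := by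
  rw [regressionFun, inner_neg_left, inner_neg_left]
  ring

-- The pair `(⟨a, X⟩ - ⟨w, V⟩, V)` is jointly Gaussian and the slope `w` makes it uncorrelated.
lemma indepFun_noise_gaussianPair (hS : (Matrix.fromBlocks S₁₁ S₁₂ S₂₁ S₂₂).PosSemidef)
    (h₂₂ : IsUnit S₂₂) (a : Vec d) :
    IndepFun (fun p : Vec d × Vec d => ⟪a, p.1⟫ - regressionFun μ₁ μ₂ S₂₁ S₂₂ a p.2)
      Prod.snd (gaussianPair μ₁ μ₂ S₁₁ S₁₂ S₂₁ S₂₂) := by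
  set w := regressionSlope S₂₁ S₂₂ a with hw
  have jointly_gaussian : HasGaussianLaw (fun p : Vec d × Vec d => (⟪a, p.1⟫ + ⟪-w, p.2⟫, p.2))
      (gaussianPair μ₁ μ₂ S₁₁ S₁₂ S₂₁ S₂₂) :=
    IsGaussian.hasGaussianLaw_id.map_fun
      (((innerSL ℝ a).comp (ContinuousLinearMap.fst ℝ (Vec d) (Vec d)) +
        (innerSL ℝ (-w)).comp (ContinuousLinearMap.snd ℝ (Vec d) (Vec d))).prod
          (ContinuousLinearMap.snd ℝ (Vec d) (Vec d)))
  have normal_equation (y : Vec d) : a.ofLp ⬝ᵥ (S₁₂ *ᵥ y.ofLp) = w.ofLp ⬝ᵥ (S₂₂ *ᵥ y.ofLp) := by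
    rw [Matrix.dotProduct_mulVec, Matrix.dotProduct_mulVec, ← Matrix.mulVec_transpose,
      ← Matrix.mulVec_transpose, (blocks_transpose hS).2.1, (blocks_transpose hS).2.2.2, hw,
      mulVec_regressionSlope h₂₂]
  have uncentered := jointly_gaussian.indepFun_of_covariance_inner fun x y => ?_
  · simp only [inner_sub_regressionFun]
    exact uncentered.comp (measurable_sub_const _) measurable_id
  · have cov := covariance_inner_gaussianPair (μ₁ := μ₁) (μ₂ := μ₂) hS (x • a) (x • -w) 0 y
    simp only [inner_smul_left, ← mul_add, inner_zero_left, zero_add, conj_trivial] at cov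
    simp only [RCLike.inner_apply (𝕜 := ℝ), conj_trivial, mul_comm _ x]
    rw [cov]
    simp [normal_equation]

lemma gaussianRegression_gaussianPair (hS : (Matrix.fromBlocks S₁₁ S₁₂ S₂₁ S₂₂).PosSemidef)
    (h₂₂ : IsUnit S₂₂) (a : Vec d) :
    GaussianRegression (gaussianPair μ₁ μ₂ S₁₁ S₁₂ S₂₁ S₂₂) (fun x => ⟪a, x⟫)
      (regressionFun μ₁ μ₂ S₂₁ S₂₂ a) ⟪a, μ₁⟫ (noiseVar S₁₁ S₁₂ S₂₁ S₂₂ a).toNNReal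
      (fitVar S₁₂ S₂₁ S₂₂ a).toNNReal where
  measurable_f := by fun_prop
  measurable_e := measurable_regressionFun a
  noise_law := by
    have law := gaussianReal_sub_const (hasLaw_inner_gaussianPair (μ₁ := μ₁) (μ₂ := μ₂) hS a _
      ((quadratic_blocks_noise h₂₂ a).trans (Real.coe_toNNReal _ (noiseVar_nonneg hS h₂₂ a)).symm))
      (⟪a, μ₁⟫ + ⟪-regressionSlope S₂₁ S₂₂ a, μ₂⟫)
    simp only [inner_sub_regressionFun]
    rwa [sub_self] at law
  fit_law := by
    have law := gaussianReal_add_const (hasLaw_inner_gaussianPair (μ₁ := μ₁) (μ₂ := μ₂) hS 0 _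
      ((quadratic_blocks_fit hS h₂₂ a).trans (Real.coe_toNNReal _ (fitVar_nonneg hS h₂₂ a)).symm))
      (⟪a, μ₁⟫ - ⟪regressionSlope S₂₁ S₂₂ a, μ₂⟫)
    simpa only [regressionFun, inner_zero_left, zero_add, add_sub_cancel] using law
  indep := indepFun_noise_gaussianPair hS h₂₂ a

end GaussianPair

/-! ### Concentration of Gaussian quadratic forms -/

section QuadraticForm

variable {ι : Type*} [Fintype ι]

lemma inner_eq_dotProduct (x y : EuclideanSpace ℝ ι) : ⟪x, y⟫ = x.ofLp ⬝ᵥ y.ofLp := by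
  rw [EuclideanSpace.inner_eq_star_dotProduct, star_trivial, dotProduct_comm]

lemma norm_sq_eq_dotProduct (x : EuclideanSpace ℝ ι) : ‖x‖ ^ 2 = x.ofLp ⬝ᵥ x.ofLp := by
  rw [← inner_eq_dotProduct, real_inner_self_eq_norm_sq]

@[fun_prop]
lemma measurable_dotProduct_mulVec (A : Matrix ι ι ℝ) :
    Measurable fun x : ι → ℝ => x ⬝ᵥ (A *ᵥ x) := by
  unfold dotProduct Matrix.mulVec dotProduct
  fun_prop

lemma mulVec_dotProduct {R : Matrix ι ι ℝ} (hR : R.IsHermitian) (x y : ι → ℝ) :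
    (R *ᵥ x) ⬝ᵥ y = x ⬝ᵥ (R *ᵥ y) := by
  rw [Matrix.dotProduct_mulVec, ← Matrix.mulVec_transpose,
    ← Matrix.conjTranspose_eq_transpose_of_trivial, hR.eq]

lemma dotProduct_mulVec_nonneg {A : Matrix ι ι ℝ} (hA : A.PosSemidef) (x : ι → ℝ) :
    0 ≤ x ⬝ᵥ (A *ᵥ x) := by
  simpa using hA.dotProduct_mulVec_nonneg x

lemma dotProduct_conj_mulVec {A R : Matrix ι ι ℝ} (hR : R.IsHermitian) (x : ι → ℝ) :
    x ⬝ᵥ ((R * A * R) *ᵥ x) = (R *ᵥ x) ⬝ᵥ (A *ᵥ (R *ᵥ x)) := by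
  rw [← Matrix.mulVec_mulVec, ← Matrix.mulVec_mulVec, mulVec_dotProduct hR]

lemma dotProduct_mul_self_mulVec {R T : Matrix ι ι ℝ} (hR : R.IsHermitian) (hRT : R * R = T)
    (x : ι → ℝ) : x ⬝ᵥ (T *ᵥ x) = (R *ᵥ x) ⬝ᵥ (R *ᵥ x) := by
  rw [← hRT, ← Matrix.mulVec_mulVec, mulVec_dotProduct hR]

lemma dotProduct_conj_mulVec_le {A R T : Matrix ι ι ℝ} (hR : R.IsHermitian) (hRT : R * R = T)
    {CA CT : ℝ} (hCA : 0 ≤ CA) (hA : ∀ x, x ⬝ᵥ (A *ᵥ x) ≤ CA * (x ⬝ᵥ x))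
    (hT : ∀ x, x ⬝ᵥ (T *ᵥ x) ≤ CT * (x ⬝ᵥ x)) (x : ι → ℝ) :
    x ⬝ᵥ ((R * A * R) *ᵥ x) ≤ CA * CT * (x ⬝ᵥ x) :=
  calc x ⬝ᵥ ((R * A * R) *ᵥ x) ≤ CA * ((R *ᵥ x) ⬝ᵥ (R *ᵥ x)) :=
        (dotProduct_conj_mulVec hR x).trans_le (hA _)
    _ ≤ CA * (CT * (x ⬝ᵥ x)) :=
        mul_le_mul_of_nonneg_left (dotProduct_mul_self_mulVec hR hRT x ▸ hT x) hCA
    _ = CA * CT * (x ⬝ᵥ x) := (mul_assoc _ _ _).symm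

lemma le_dotProduct_conj_mulVec {A R T : Matrix ι ι ℝ} (hR : R.IsHermitian) (hRT : R * R = T)
    {cA cT : ℝ} (hcA : 0 ≤ cA) (hA : ∀ x, cA * (x ⬝ᵥ x) ≤ x ⬝ᵥ (A *ᵥ x))
    (hT : ∀ x, cT * (x ⬝ᵥ x) ≤ x ⬝ᵥ (T *ᵥ x)) (x : ι → ℝ) :
    cA * cT * (x ⬝ᵥ x) ≤ x ⬝ᵥ ((R * A * R) *ᵥ x) :=
  calc cA * cT * (x ⬝ᵥ x) = cA * (cT * (x ⬝ᵥ x)) := mul_assoc _ _ _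
    _ ≤ cA * ((R *ᵥ x) ⬝ᵥ (R *ᵥ x)) :=
        mul_le_mul_of_nonneg_left (dotProduct_mul_self_mulVec hR hRT x ▸ hT x) hcA
    _ ≤ x ⬝ᵥ ((R * A * R) *ᵥ x) := (hA _).trans_eq (dotProduct_conj_mulVec hR x).symm

lemma trace_conj {A R T : Matrix ι ι ℝ} (hRT : R * R = T) :
    (R * A * R).trace = (A * T).trace := by
  rw [Matrix.mul_assoc, Matrix.trace_mul_comm, Matrix.mul_assoc, hRT]

lemma quadratic_eq_centered_add {A : Matrix ι ι ℝ} (hA : A.IsHermitian) (a δ : EuclideanSpace ℝ ι) :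
    a.ofLp ⬝ᵥ (A *ᵥ a.ofLp) = (a - δ).ofLp ⬝ᵥ (A *ᵥ (a - δ).ofLp) +
      2 * (⟪WithLp.toLp 2 (A *ᵥ δ.ofLp), a⟫ - ⟪WithLp.toLp 2 (A *ᵥ δ.ofLp), δ⟫) +
        δ.ofLp ⬝ᵥ (A *ᵥ δ.ofLp) := by
  rw [inner_eq_dotProduct, inner_eq_dotProduct, WithLp.ofLp_sub, Matrix.mulVec_sub,
    sub_dotProduct, dotProduct_sub, dotProduct_sub, mulVec_dotProduct hA, mulVec_dotProduct hA,
    ← mulVec_dotProduct hA a.ofLp δ.ofLp, dotProduct_comm (A *ᵥ a.ofLp)]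
  ring

lemma lintegral_sq_sum_mul_sq_sub_le (lam : ι → ℝ) :
    ∫⁻ x, ENNReal.ofReal ((∑ i, (lam i * x i ^ 2 - lam i)) ^ 2)
        ∂(Measure.pi fun _ : ι => gaussianReal 0 1) ≤
      ENNReal.ofReal (∑ i, fourthMoment * lam i ^ 2) := by
  have hK := fourthMoment_nonneg
  have mean (c : ℝ) : ∫ x, c * x ^ 2 ∂(gaussianReal 0 1) = c := by
    have h := variance_eq_integral (X := id) (μ := gaussianReal 0 1) aemeasurable_id
    simp only [id, integral_id_gaussianReal, sub_zero] at h
    rw [integral_const_mul, ← h]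
    exact (congrArg (c * ·) variance_id_gaussianReal).trans (mul_one c)
  have fourth_moment (c : ℝ) : ∫⁻ x, ENNReal.ofReal ((c * x ^ 2) ^ 2) ∂(gaussianReal 0 1) =
      ENNReal.ofReal (fourthMoment * c ^ 2) := by
    have h := lintegral_sub_pow_four_gaussianReal 0 1
    simp only [sub_zero, NNReal.coe_one, one_pow, mul_one] at h
    simp only [mul_pow, ENNReal.ofReal_mul (sq_nonneg c), ← pow_mul, Nat.reduceMul]
    rw [lintegral_const_mul' _ _ ENNReal.ofReal_ne_top, h, mul_comm, ENNReal.ofReal_mul hK]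
  have h := lintegral_sq_sum_sub_integral_le (μ := fun _ : ι => gaussianReal 0 1)
    (g := fun i x => lam i * x ^ 2) fun i => by fun_prop
  simp only [mean, fourth_moment] at h
  rwa [← ENNReal.ofReal_sum_of_nonneg fun i _ => by positivity] at h

lemma quadratic_sub_sq_le {A : Matrix ι ι ℝ} {CA : ℝ} (hA : A.PosSemidef)
    (hAub : ∀ x, x ⬝ᵥ (A *ᵥ x) ≤ CA * (x ⬝ᵥ x)) (a δ : EuclideanSpace ℝ ι) (t : ℝ) :
    (a.ofLp ⬝ᵥ (A *ᵥ a.ofLp) - t) ^ 2 ≤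
      3 * ((a - δ).ofLp ⬝ᵥ (A *ᵥ (a - δ).ofLp) - t) ^ 2 +
        12 * (⟪WithLp.toLp 2 (A *ᵥ δ.ofLp), a⟫ - ⟪WithLp.toLp 2 (A *ᵥ δ.ofLp), δ⟫) ^ 2 +
          3 * (CA * ‖δ‖ ^ 2) ^ 2 := by
  have mean_term : (δ.ofLp ⬝ᵥ (A *ᵥ δ.ofLp)) ^ 2 ≤ (CA * ‖δ‖ ^ 2) ^ 2 := by
    rw [norm_sq_eq_dotProduct]
    exact pow_le_pow_left₀ (dotProduct_mulVec_nonneg hA _) (hAub _) 2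
  have sq_add_three (x y v : ℝ) : (x + 2 * y + v) ^ 2 ≤ 3 * x ^ 2 + 12 * y ^ 2 + 3 * v ^ 2 := by
    nlinarith [sq_nonneg (x - 2 * y), sq_nonneg (x - v), sq_nonneg (2 * y - v)]
  rw [quadratic_eq_centered_add hA.isHermitian a δ, add_sub_right_comm, add_sub_right_comm]
  exact (sq_add_three _ _ _).trans (by gcongr)

lemma card_mul_le_trace {B : Matrix ι ι ℝ} {c : ℝ}
    (hB : ∀ x, c * (x ⬝ᵥ x) ≤ x ⬝ᵥ (B *ᵥ x)) : Fintype.card ι * c ≤ B.trace := by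
  classical
  have diagonal : ∀ i, c ≤ B i i := fun i => by simpa using hB (Pi.single i 1)
  simpa [Matrix.trace] using
    Finset.card_nsmul_le_sum Finset.univ (fun i => B i i) c fun i _ => diagonal i

open scoped MatrixOrder Matrix.Norms.L2Operator in
lemma exists_sqrt_multivariateGaussian [DecidableEq ι] {T : Matrix ι ι ℝ} (hT : T.PosSemidef) :
    ∃ R : Matrix ι ι ℝ, R.PosSemidef ∧ R * R = T ∧
      ∀ δ, multivariateGaussian δ T =
        (stdGaussian (EuclideanSpace ℝ ι)).map (fun x => δ + WithLp.toLp 2 (R *ᵥ x.ofLp)) :=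
  ⟨CFC.sqrt T, Matrix.nonneg_iff_posSemidef.1 (CFC.sqrt_nonneg T),
    CFC.sqrt_mul_sqrt_self _ hT.nonneg, fun _ => rfl⟩

lemma le_trace_mul {A T : Matrix ι ι ℝ} (hT : T.PosSemidef) {cA cT : ℝ} (hcA : 0 ≤ cA)
    (hAlb : ∀ x, cA * (x ⬝ᵥ x) ≤ x ⬝ᵥ (A *ᵥ x)) (hTlb : ∀ x, cT * (x ⬝ᵥ x) ≤ x ⬝ᵥ (T *ᵥ x)) :
    Fintype.card ι * (cA * cT) ≤ (A * T).trace := by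
  classical
  obtain ⟨R, hR, hRT, -⟩ := exists_sqrt_multivariateGaussian hT
  rw [← trace_conj hRT]
  exact card_mul_le_trace (le_dotProduct_conj_mulVec hR.isHermitian hRT hcA hAlb hTlb)

lemma mulVec_dotProduct_mulVec_le {A : Matrix ι ι ℝ} (hA : A.PosSemidef) {CA : ℝ} (hCA : 0 ≤ CA)
    (hAub : ∀ x, x ⬝ᵥ (A *ᵥ x) ≤ CA * (x ⬝ᵥ x)) (x : ι → ℝ) :
    (A *ᵥ x) ⬝ᵥ (A *ᵥ x) ≤ CA ^ 2 * (x ⬝ᵥ x) := by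
  classical
  obtain ⟨R, hR, hRA, -⟩ := exists_sqrt_multivariateGaussian hA
  have factor : A * A = R * A * R := by simp only [← hRA, Matrix.mul_assoc]
  rw [← dotProduct_mul_self_mulVec hA.isHermitian factor, sq]
  exact dotProduct_conj_mulVec_le hR.isHermitian hRA hCA hAub hAub x

variable [DecidableEq ι]

lemma dotProduct_mulVec_sum_eigenvectorBasis {B : Matrix ι ι ℝ} (hB : B.IsHermitian)
    (x : ι → ℝ) :
    (∑ i, x i • hB.eigenvectorBasis i : EuclideanSpace ℝ ι).ofLp ⬝ᵥ
      (B *ᵥ (∑ i, x i • hB.eigenvectorBasis i : EuclideanSpace ℝ ι).ofLp) =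
      ∑ i, hB.eigenvalues i * x i ^ 2 := by
  set u := hB.eigenvectorBasis
  have mulVec_sum : B *ᵥ (∑ i, x i • u i : EuclideanSpace ℝ ι).ofLp =
      (∑ i, (hB.eigenvalues i * x i) • u i : EuclideanSpace ℝ ι).ofLp := by
    simp only [WithLp.ofLp_sum, WithLp.ofLp_smul, Matrix.mulVec_sum, Matrix.mulVec_smul]
    refine Finset.sum_congr rfl fun i _ => ?_
    rw [hB.mulVec_eigenvectorBasis, smul_smul, mul_comm]
  rw [mulVec_sum, ← inner_eq_dotProduct, u.orthonormal.inner_sum]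
  refine Finset.sum_congr rfl fun i _ => ?_
  rw [conj_trivial]
  ring

lemma eigenvalues_le_of_dotProduct_mulVec_le {B : Matrix ι ι ℝ} (hB : B.IsHermitian) {c : ℝ}
    (h : ∀ x, x ⬝ᵥ (B *ᵥ x) ≤ c * (x ⬝ᵥ x)) (i : ι) : hB.eigenvalues i ≤ c := by
  have unit : (hB.eigenvectorBasis i).ofLp ⬝ᵥ (hB.eigenvectorBasis i).ofLp = 1 := by
    rw [← norm_sq_eq_dotProduct, hB.eigenvectorBasis.norm_eq_one, one_pow]
  have rayleigh := h (hB.eigenvectorBasis i).ofLp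
  rwa [hB.mulVec_eigenvectorBasis, dotProduct_smul, unit, smul_eq_mul, mul_one, mul_one] at rayleigh

lemma lintegral_quadratic_sub_trace_sq_stdGaussian_le {B : Matrix ι ι ℝ} (hB : B.IsHermitian) :
    ∫⁻ x, ENNReal.ofReal ((x.ofLp ⬝ᵥ (B *ᵥ x.ofLp) - B.trace) ^ 2)
        ∂(stdGaussian (EuclideanSpace ℝ ι)) ≤
      ENNReal.ofReal (∑ i, fourthMoment * hB.eigenvalues i ^ 2) := by
  rw [stdGaussian_eq_map_pi_orthonormalBasis hB.eigenvectorBasis,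
    lintegral_map (by fun_prop) (by fun_prop)]
  simp only [dotProduct_mulVec_sum_eigenvectorBasis hB, hB.trace_eq_sum_eigenvalues,
    RCLike.ofReal_real_eq_id, id, ← Finset.sum_sub_distrib]
  exact lintegral_sq_sum_mul_sq_sub_le _

variable {A T : Matrix ι ι ℝ} {CA CT : ℝ}

lemma lintegral_centered_quadratic_sub_trace_sq_le (δ : EuclideanSpace ℝ ι) (hT : T.PosSemidef)
    (hA : A.PosSemidef) (hCA : 0 ≤ CA) (hAub : ∀ x, x ⬝ᵥ (A *ᵥ x) ≤ CA * (x ⬝ᵥ x))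
    (hTub : ∀ x, x ⬝ᵥ (T *ᵥ x) ≤ CT * (x ⬝ᵥ x)) :
    ∫⁻ a, ENNReal.ofReal (((a - δ).ofLp ⬝ᵥ (A *ᵥ (a - δ).ofLp) - (A * T).trace) ^ 2)
        ∂(multivariateGaussian δ T) ≤
      ENNReal.ofReal (Fintype.card ι * (fourthMoment * (CA * CT) ^ 2)) := by
  obtain ⟨R, hR, hRT, hmap⟩ := exists_sqrt_multivariateGaussian hT
  have hB : (R * A * R).PosSemidef := by
    simpa only [hR.isHermitian.eq] using hA.conjTranspose_mul_mul_same R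
  have hmeas : Measurable fun x : EuclideanSpace ℝ ι => δ + WithLp.toLp 2 (R *ᵥ x.ofLp) := by
    unfold Matrix.mulVec dotProduct
    fun_prop
  rw [hmap, lintegral_map (by fun_prop) hmeas]
  simp only [add_sub_cancel_left, ← dotProduct_conj_mulVec hR.isHermitian, ← trace_conj hRT]
  refine (lintegral_quadratic_sub_trace_sq_stdGaussian_le hB.isHermitian).trans
    (ENNReal.ofReal_le_ofReal ?_)
  calc ∑ i, fourthMoment * hB.isHermitian.eigenvalues i ^ 2 ≤
        ∑ _i : ι, fourthMoment * (CA * CT) ^ 2 := by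
        gcongr with i
        · exact fourthMoment_nonneg
        · exact hB.eigenvalues_nonneg i
        · exact eigenvalues_le_of_dotProduct_mulVec_le _
            (dotProduct_conj_mulVec_le hR.isHermitian hRT hCA hAub hTub) i
    _ = Fintype.card ι * (fourthMoment * (CA * CT) ^ 2) := by simp

lemma hasLaw_inner_multivariateGaussian (δ : EuclideanSpace ℝ ι) (hT : T.PosSemidef)
    (x : EuclideanSpace ℝ ι) :
    HasLaw (fun a => ⟪x, a⟫) (gaussianReal ⟪x, δ⟫ (x.ofLp ⬝ᵥ (T *ᵥ x.ofLp)).toNNReal)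
      (multivariateGaussian δ T) := by
  refine hasLaw_gaussianReal_of_hasGaussianLaw
    (IsGaussian.hasGaussianLaw_id.map_fun (innerSL ℝ x)) ?_ ?_
  · change ∫ a, ⟪x, a⟫ ∂(multivariateGaussian δ T) = _
    rw [integral_inner IsGaussian.integrable_fun_id, integral_id_multivariateGaussian]
  · rw [Real.coe_toNNReal _ (dotProduct_mulVec_nonneg hT _),
      ← covarianceBilin_self IsGaussian.memLp_two_id, covarianceBilin_multivariateGaussian hT]

lemma hasLaw_multivariateGaussian_of_forall_inner {Ω : Type*} {mΩ : MeasurableSpace Ω}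
    {ν : Measure Ω} [IsProbabilityMeasure ν] {X : Ω → EuclideanSpace ℝ ι}
    {δ : EuclideanSpace ℝ ι} (hX : AEMeasurable X ν) (hT : T.PosSemidef)
    (h : ∀ x, HasLaw (fun ω => ⟪x, X ω⟫)
      (gaussianReal ⟪x, δ⟫ (x.ofLp ⬝ᵥ (T *ᵥ x.ofLp)).toNNReal) ν) :
    HasLaw X (multivariateGaussian δ T) ν := by
  refine ⟨hX, ?_⟩
  have := Measure.isProbabilityMeasure_map hX
  refine Measure.ext_of_charFunDual (funext fun L => ?_)
  obtain ⟨x, rfl⟩ := (InnerProductSpace.toDual ℝ (EuclideanSpace ℝ ι)).surjective L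
  rw [charFunDual_eq_charFun_map_one, charFunDual_eq_charFun_map_one,
    AEMeasurable.map_map_of_aemeasurable (by fun_prop) hX]
  exact congrArg (charFun · 1)
    ((h x).map_eq.trans (hasLaw_inner_multivariateGaussian δ hT x).map_eq.symm)

lemma lintegral_inner_sub_sq_multivariateGaussian (δ : EuclideanSpace ℝ ι) (hT : T.PosSemidef)
    (x : EuclideanSpace ℝ ι) :
    ∫⁻ a, ENNReal.ofReal ((⟪x, a⟫ - ⟪x, δ⟫) ^ 2) ∂(multivariateGaussian δ T) =
      ENNReal.ofReal (x.ofLp ⬝ᵥ (T *ᵥ x.ofLp)) := by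
  rw [(hasLaw_inner_multivariateGaussian δ hT x).lintegral_comp
    (f := fun y => ENNReal.ofReal ((y - ⟪x, δ⟫) ^ 2)) (by fun_prop), lintegral_sub_sq_gaussianReal]
  rfl

lemma lintegral_quadratic_sub_trace_sq_le (δ : EuclideanSpace ℝ ι) (hT : T.PosSemidef)
    (hA : A.PosSemidef) (hCA : 0 ≤ CA) (hCT : 0 ≤ CT)
    (hAub : ∀ x, x ⬝ᵥ (A *ᵥ x) ≤ CA * (x ⬝ᵥ x)) (hTub : ∀ x, x ⬝ᵥ (T *ᵥ x) ≤ CT * (x ⬝ᵥ x)) :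
    ∫⁻ a, ENNReal.ofReal ((a.ofLp ⬝ᵥ (A *ᵥ a.ofLp) - (A * T).trace) ^ 2)
        ∂(multivariateGaussian δ T) ≤
      ENNReal.ofReal (3 * (Fintype.card ι * (fourthMoment * (CA * CT) ^ 2)) +
        12 * (CT * (CA ^ 2 * ‖δ‖ ^ 2)) + 3 * (CA * ‖δ‖ ^ 2) ^ 2) := by
  have hK := fourthMoment_nonneg
  set w : EuclideanSpace ℝ ι := WithLp.toLp 2 (A *ᵥ δ.ofLp)
  have ofReal_combination {x y v : ℝ} (hx : 0 ≤ x) (hy : 0 ≤ y) (hv : 0 ≤ v) :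
      ENNReal.ofReal (3 * x + 12 * y + v) =
        3 * ENNReal.ofReal x + 12 * ENNReal.ofReal y + ENNReal.ofReal v := by
    rw [ENNReal.ofReal_add (by positivity) hv, ENNReal.ofReal_add (by positivity) (by positivity),
      ENNReal.ofReal_mul (by norm_num), ENNReal.ofReal_mul (by norm_num), ENNReal.ofReal_ofNat,
      ENNReal.ofReal_ofNat]
  have linear_term : w.ofLp ⬝ᵥ (T *ᵥ w.ofLp) ≤ CT * (CA ^ 2 * ‖δ‖ ^ 2) := by
    refine (hTub _).trans (mul_le_mul_of_nonneg_left ?_ hCT)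
    rw [norm_sq_eq_dotProduct]
    exact mulVec_dotProduct_mulVec_le hA hCA hAub _
  calc _ ≤ ∫⁻ a, (3 * ENNReal.ofReal
          (((a - δ).ofLp ⬝ᵥ (A *ᵥ (a - δ).ofLp) - (A * T).trace) ^ 2) +
        12 * ENNReal.ofReal ((⟪w, a⟫ - ⟪w, δ⟫) ^ 2) + ENNReal.ofReal (3 * (CA * ‖δ‖ ^ 2) ^ 2))
          ∂(multivariateGaussian δ T) := by
        refine lintegral_mono fun a =>
          (ENNReal.ofReal_le_ofReal (quadratic_sub_sq_le hA hAub a δ _)).trans_eq ?_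
        exact ofReal_combination (by positivity) (by positivity) (by positivity)
    _ ≤ 3 * ENNReal.ofReal (Fintype.card ι * (fourthMoment * (CA * CT) ^ 2)) +
        12 * ENNReal.ofReal (CT * (CA ^ 2 * ‖δ‖ ^ 2)) +
        ENNReal.ofReal (3 * (CA * ‖δ‖ ^ 2) ^ 2) := by
        rw [lintegral_add_right _ (by fun_prop), lintegral_add_left (by fun_prop),
          lintegral_const_mul' _ _ (by norm_num), lintegral_const_mul' _ _ (by norm_num),
          lintegral_const, measure_univ, mul_one,
          lintegral_inner_sub_sq_multivariateGaussian δ hT w]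
        gcongr
        exact lintegral_centered_quadratic_sub_trace_sq_le δ hT hA hCA hAub hTub
    _ = _ := (ofReal_combination (by positivity) (by positivity) (by positivity)).symm

end QuadraticForm

/-! ### The law of the witness function -/

section Witness

variable {d n : ℕ}

/-- The law of the two samples `X̃ᵢ` and `Ỹᵢ` from which the witness function is computed. -/
noncomputable def witnessLaw (P Q : Measure (Vec d × Vec d)) (n₁ n₂ : ℕ) :
    Measure ((Fin n₁ → Vec d) × (Fin n₂ → Vec d)) :=
  (Measure.pi fun _ : Fin n₁ => P.fst).prod (Measure.pi fun _ : Fin n₂ => Q.fst)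

instance isProbabilityMeasure_witnessLaw (P Q : Measure (Vec d × Vec d)) (n₁ n₂ : ℕ)
    [IsProbabilityMeasure P] [IsProbabilityMeasure Q] :
    IsProbabilityMeasure (witnessLaw P Q n₁ n₂) := by
  unfold witnessLaw
  infer_instance

/-- The vector which represents the witness function of the linear kernel. -/
noncomputable def witnessVec (g : (Fin n → Vec d) × (Fin n → Vec d)) : Vec d :=
  (n : ℝ)⁻¹ • (∑ i, g.1 i - ∑ i, g.2 i)

lemma witness_linearKernel (g : (Fin n → Vec d) × (Fin n → Vec d)) :
    witness linearKernel g.1 g.2 = fun x => ⟪witnessVec g, x⟫ := by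
  ext x
  simp only [witness, linearKernel, witnessVec, real_inner_smul_left, inner_sub_left, sum_inner]
  ring

lemma inner_witnessVec (x : Vec d) (g : (Fin n → Vec d) × (Fin n → Vec d)) :
    ⟪x, witnessVec g⟫ = (n : ℝ)⁻¹ * ∑ i, ⟪x, g.1 i⟫ + -(n : ℝ)⁻¹ * ∑ i, ⟪x, g.2 i⟫ := by
  simp only [witnessVec, real_inner_smul_right, inner_sub_right, inner_sum]
  ring

@[fun_prop]
lemma measurable_witnessVec :
    Measurable (witnessVec : (Fin n → Vec d) × (Fin n → Vec d) → Vec d) := by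
  unfold witnessVec
  fun_prop

variable {μX μV μY μW : Vec d} {S₁₁ S₁₂ S₂₁ S₂₂ : Matrix (Fin d) (Fin d) ℝ}

lemma hasLaw_inner_fst_gaussianPair (hS : (Matrix.fromBlocks S₁₁ S₁₂ S₂₁ S₂₂).PosSemidef)
    (x : Vec d) {v : ℝ≥0} (hv : x.ofLp ⬝ᵥ (S₁₁ *ᵥ x.ofLp) = v) :
    HasLaw (fun y => ⟪x, y⟫) (gaussianReal ⟪x, μX⟫ v)
      (gaussianPair μX μV S₁₁ S₁₂ S₂₁ S₂₂).fst := by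
  have law := hasLaw_inner_gaussianPair (μ₁ := μX) (μ₂ := μV) (v := v) hS x 0 (by simpa using hv)
  simp only [inner_zero_left, add_zero] at law
  refine ⟨by fun_prop, ?_⟩
  rw [Measure.fst, Measure.map_map (by fun_prop) measurable_fst]
  exact law.map_eq

lemma hasLaw_inner_witnessVec (hS : (Matrix.fromBlocks S₁₁ S₁₂ S₂₁ S₂₂).PosSemidef) (hn : 0 < n)
    (x : Vec d) {v : ℝ≥0} (hv : x.ofLp ⬝ᵥ (S₁₁ *ᵥ x.ofLp) = v) :
    HasLaw (fun g => ⟪x, witnessVec g⟫) (gaussianReal ⟪x, μX - μY⟫ (2 / n * v))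
      (witnessLaw (gaussianPair μX μV S₁₁ S₁₂ S₂₁ S₂₂)
        (gaussianPair μY μW S₁₁ S₁₂ S₂₁ S₂₂) n n) := by
  have hn' : (n : ℝ) ≠ 0 := by positivity
  have law := hasLaw_prod_add_gaussianReal
    (gaussianReal_const_mul (hasLaw_sum_pi_gaussianReal fun _ : Fin n =>
      hasLaw_inner_fst_gaussianPair (μX := μX) (μV := μV) hS x hv) (n : ℝ)⁻¹)
    (gaussianReal_const_mul (hasLaw_sum_pi_gaussianReal fun _ : Fin n =>
      hasLaw_inner_fst_gaussianPair (μX := μY) (μV := μW) hS x hv) (-(n : ℝ)⁻¹))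
  simp only [inner_witnessVec, witnessLaw]
  convert law using 2
  · simp only [inner_sub_right, Finset.sum_const, Finset.card_univ, Fintype.card_fin, nsmul_eq_mul]
    field_simp
    ring
  · ext
    simp only [Finset.sum_const, Finset.card_univ, Fintype.card_fin, nsmul_eq_mul, NNReal.coe_add,
      NNReal.coe_mul, NNReal.coe_div, NNReal.coe_natCast, NNReal.coe_ofNat, NNReal.coe_mk]
    field_simp
    ring

lemma hasLaw_witnessVec (hS : (Matrix.fromBlocks S₁₁ S₁₂ S₂₁ S₂₂).PosSemidef)
    (hS₁₁ : S₁₁.PosSemidef) (hn : 0 < n) :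
    HasLaw witnessVec (multivariateGaussian (μX - μY) ((2 / n : ℝ) • S₁₁))
      (witnessLaw (gaussianPair μX μV S₁₁ S₁₂ S₂₁ S₂₂)
        (gaussianPair μY μW S₁₁ S₁₂ S₂₁ S₂₂) n n) := by
  refine hasLaw_multivariateGaussian_of_forall_inner (by fun_prop) (hS₁₁.smul (by positivity))
    fun x => ?_
  have variance_eq : (x.ofLp ⬝ᵥ (((2 / n : ℝ) • S₁₁) *ᵥ x.ofLp)).toNNReal =
      2 / (n : ℝ≥0) * (x.ofLp ⬝ᵥ (S₁₁ *ᵥ x.ofLp)).toNNReal := by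
    rw [Matrix.smul_mulVec, dotProduct_smul, smul_eq_mul, Real.toNNReal_mul (by positivity),
      Real.toNNReal_div (by positivity), Real.toNNReal_ofNat, Real.toNNReal_natCast]
  rw [variance_eq]
  exact hasLaw_inner_witnessVec hS hn x
    (Real.coe_toNNReal _ (dotProduct_mulVec_nonneg hS₁₁ _)).symm

end Witness

/-! ### The asymptotic variance -/

section Spectrum

variable {ι : Type*} [Fintype ι] [DecidableEq ι] {S : Matrix ι ι ℝ} {c C : ℝ}

lemma le_dotProduct_mulVec_of_le_spectrum (hS : S.IsHermitian) (h : ∀ y ∈ spectrum ℝ S, c ≤ y)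
    (x : ι → ℝ) : c * (x ⬝ᵥ x) ≤ x ⬝ᵥ (S *ᵥ x) := by
  have shifted : (S - algebraMap ℝ _ c).PosSemidef := by
    refine Matrix.posSemidef_iff_isHermitian_and_spectrum_nonneg.2 ⟨hS.sub ?_, ?_⟩
    · exact IsSelfAdjoint.algebraMap _ (IsSelfAdjoint.all c)
    · rw [← spectrum.sub_singleton_eq]
      rintro _ ⟨y, hy, z, rfl, rfl⟩
      exact sub_nonneg.2 (h y hy)
  have shifted_nonneg := dotProduct_mulVec_nonneg shifted x
  rwa [Algebra.algebraMap_eq_smul_one, Matrix.sub_mulVec, Matrix.smul_mulVec, Matrix.one_mulVec,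
    dotProduct_sub, dotProduct_smul, smul_eq_mul, sub_nonneg] at shifted_nonneg

lemma dotProduct_mulVec_le_of_spectrum_le (hS : S.IsHermitian) (h : ∀ y ∈ spectrum ℝ S, y ≤ C)
    (x : ι → ℝ) : x ⬝ᵥ (S *ᵥ x) ≤ C * (x ⬝ᵥ x) := by
  have neg_bound := le_dotProduct_mulVec_of_le_spectrum (c := -C) hS.neg (fun y hy => by
    rw [← spectrum.neg_eq] at hy
    exact neg_le.1 (h _ (Set.mem_neg.1 hy))) x
  rwa [Matrix.neg_mulVec, dotProduct_neg, neg_mul, neg_le_neg_iff] at neg_bound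

lemma isUnit_of_spectrum_pos (h : ∀ y ∈ spectrum ℝ S, 0 < y) : IsUnit S :=
  spectrum.isUnit_of_zero_notMem ℝ fun h0 => (h 0 h0).false

end Spectrum

section OracleCov

variable {d : ℕ} {S₁₁ S₁₂ S₂₁ S₂₂ : Matrix (Fin d) (Fin d) ℝ}

lemma posSemidef_fst_block (hS : (Matrix.fromBlocks S₁₁ S₁₂ S₂₁ S₂₂).PosSemidef) :
    S₁₁.PosSemidef :=
  hS.submatrix Sum.inl

/-- The matrix `A` such that, for the function `⟪a, ·⟫` and exactly known regression functions,
`⟪a, A a⟫ / n` is the variance of the semi-supervised mean estimator of each group. -/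
noncomputable def oracleCov (S₁₁ S₁₂ S₂₁ S₂₂ : Matrix (Fin d) (Fin d) ℝ) :
    Matrix (Fin d) (Fin d) ℝ :=
  S₁₁ - (2⁻¹ : ℝ) • (S₁₂ * S₂₂⁻¹ * S₂₁)

lemma dotProduct_oracleCov_mulVec (a : Vec d) :
    a.ofLp ⬝ᵥ (oracleCov S₁₁ S₁₂ S₂₁ S₂₂ *ᵥ a.ofLp) =
      noiseVar S₁₁ S₁₂ S₂₁ S₂₂ a + fitVar S₁₂ S₂₁ S₂₂ a / 2 := by
  rw [noiseVar, oracleCov, Matrix.sub_mulVec, dotProduct_sub, Matrix.smul_mulVec, dotProduct_smul,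
    fitVar, smul_eq_mul]
  ring

lemma four_mul_trace_oracleCov_mul :
    4 * (oracleCov S₁₁ S₁₂ S₂₁ S₂₂ * S₁₁).trace =
      4 * (S₁₁ ^ 2).trace - 2 * (S₁₂ * S₂₂⁻¹ * S₂₁ * S₁₁).trace := by
  rw [oracleCov, Matrix.sub_mul, Matrix.smul_mul, Matrix.trace_sub, Matrix.trace_smul, sq,
    smul_eq_mul]
  ring

lemma posSemidef_oracleCov (hS : (Matrix.fromBlocks S₁₁ S₁₂ S₂₁ S₂₂).PosSemidef)
    (h₂₂ : IsUnit S₂₂) : (oracleCov S₁₁ S₁₂ S₂₁ S₂₂).PosSemidef := by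
  refine .of_dotProduct_mulVec_nonneg ?_ fun x => ?_
  · obtain ⟨h₁₁, h₁₂, h₂₁, h₂₂'⟩ := blocks_transpose hS
    rw [Matrix.IsHermitian, Matrix.conjTranspose_eq_transpose_of_trivial, oracleCov,
      Matrix.transpose_sub, Matrix.transpose_smul, Matrix.transpose_mul, Matrix.transpose_mul,
      Matrix.transpose_nonsing_inv, h₁₁, h₁₂, h₂₁, h₂₂', Matrix.mul_assoc]
  · rw [star_trivial]
    exact (add_nonneg (noiseVar_nonneg hS h₂₂ (WithLp.toLp 2 x)) (div_nonneg
      (fitVar_nonneg hS h₂₂ _) zero_le_two)).trans_eq (dotProduct_oracleCov_mulVec _).symm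

lemma half_dotProduct_le_dotProduct_oracleCov
    (hS : (Matrix.fromBlocks S₁₁ S₁₂ S₂₁ S₂₂).PosSemidef) (h₂₂ : IsUnit S₂₂) (x : Fin d → ℝ) :
    x ⬝ᵥ (S₁₁ *ᵥ x) / 2 ≤ x ⬝ᵥ (oracleCov S₁₁ S₁₂ S₂₁ S₂₂ *ᵥ x) := by
  have noise := noiseVar_nonneg hS h₂₂ (WithLp.toLp 2 x)
  have split := dotProduct_oracleCov_mulVec (S₁₁ := S₁₁) (S₁₂ := S₁₂) (S₂₁ := S₂₁) (S₂₂ := S₂₂)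
    (WithLp.toLp 2 x)
  simp only [noiseVar] at noise split
  linarith

lemma dotProduct_oracleCov_le_dotProduct
    (hS : (Matrix.fromBlocks S₁₁ S₁₂ S₂₁ S₂₂).PosSemidef) (h₂₂ : IsUnit S₂₂) (x : Fin d → ℝ) :
    x ⬝ᵥ (oracleCov S₁₁ S₁₂ S₂₁ S₂₂ *ᵥ x) ≤ x ⬝ᵥ (S₁₁ *ᵥ x) := by
  have fit := fitVar_nonneg hS h₂₂ (WithLp.toLp 2 x)
  have split := dotProduct_oracleCov_mulVec (S₁₁ := S₁₁) (S₁₂ := S₁₂) (S₂₁ := S₂₁) (S₂₂ := S₂₂)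
    (WithLp.toLp 2 x)
  simp only [noiseVar] at split
  linarith

end OracleCov

/-! ### Conditioning on the witness function -/

section Conditioning

variable {α β α' β' : Type*} {mα : MeasurableSpace α} {mβ : MeasurableSpace β}
  {mα' : MeasurableSpace α'} {mβ' : MeasurableSpace β'}

/-- The equivalence `Equiv.prodProdProdComm` as an equivalence of measurable spaces. -/
def measurableProdProdProdComm (α β α' β' : Type*) [MeasurableSpace α] [MeasurableSpace β]
    [MeasurableSpace α'] [MeasurableSpace β'] : (α × β) × (α' × β') ≃ᵐ (α × α') × (β × β') where
  toEquiv := Equiv.prodProdProdComm α β α' β'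
  measurable_toFun := by
    change Measurable fun D : (α × β) × (α' × β') => ((D.1.1, D.2.1), (D.1.2, D.2.2))
    fun_prop
  measurable_invFun := by
    change Measurable fun D : (α × α') × (β × β') => ((D.1.1, D.2.1), (D.1.2, D.2.2))
    fun_prop

lemma measurePreserving_prodProdProdComm (μ : Measure α) (ν : Measure β) (μ' : Measure α')
    (ν' : Measure β') [SFinite μ] [SFinite ν] [SFinite μ'] [SFinite ν'] :
    MeasurePreserving (measurableProdProdProdComm α β α' β') ((μ.prod ν).prod (μ'.prod ν'))
      ((μ.prod μ').prod (ν.prod ν')) := by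
  have swap_middle := (measurePreserving_prodAssoc ν μ' ν').symm
  have swap := ((Measure.measurePreserving_swap (μ := ν) (ν := μ')).prod
    (MeasurePreserving.id ν')).comp swap_middle
  have inner := (MeasurePreserving.id μ).prod ((measurePreserving_prodAssoc μ' ν ν').comp swap)
  exact (measurePreserving_prodAssoc μ μ' (ν.prod ν')).symm.comp
    (inner.comp (measurePreserving_prodAssoc μ ν (μ'.prod ν')))

lemma abs_integral_sub_le_add_measureReal {μ : Measure α} [IsProbabilityMeasure μ] {f : α → ℝ}
    (hf : Measurable f) (hf01 : ∀ a, f a ∈ Set.Icc (0 : ℝ) 1) {p b : ℝ}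
    (hp : p ∈ Set.Icc (0 : ℝ) 1) (hb : 0 ≤ b) {B : Set α} (h : ∀ a ∉ B, |f a - p| ≤ b) :
    |∫ a, f a ∂μ - p| ≤ b + μ.real B := by
  have f_integrable : Integrable f μ := .of_mem_Icc 0 1 hf.aemeasurable (ae_of_all _ hf01)
  have measurable_hull := measurableSet_toMeasurable μ B
  have indicator_integrable : Integrable ((toMeasurable μ B).indicator fun _ => (1 : ℝ)) μ :=
    (integrable_const _).indicator measurable_hull
  have pointwise (a : α) : |f a - p| ≤ b + (toMeasurable μ B).indicator (fun _ => (1 : ℝ)) a := by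
    by_cases ha : a ∈ toMeasurable μ B
    · rw [Set.indicator_of_mem ha, abs_le]
      constructor <;> linarith [hp.1, hp.2, (hf01 a).1, (hf01 a).2]
    · rw [Set.indicator_of_notMem ha, add_zero]
      exact h a fun hB => ha (subset_toMeasurable _ _ hB)
  calc |∫ a, f a ∂μ - p|
    _ = |∫ a, (f a - p) ∂μ| := by
      rw [integral_sub f_integrable (integrable_const _), integral_const, probReal_univ, one_smul]
    _ ≤ ∫ a, |f a - p| ∂μ := abs_integral_le_integral_abs
    _ ≤ ∫ a, (b + (toMeasurable μ B).indicator (fun _ => (1 : ℝ)) a) ∂μ :=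
      integral_mono (f_integrable.sub (integrable_const _)).abs
        ((integrable_const _).add indicator_integrable) pointwise
    _ = b + μ.real B := by
      rw [integral_add (integrable_const _) indicator_integrable,
        integral_indicator_const _ measurable_hull, integral_const, probReal_univ, one_smul,
        smul_eq_mul, mul_one, measureReal_def, measure_toMeasurable, measureReal_def]

lemma abs_measureReal_prod_sub_le (μ : Measure α) (ν : Measure β) [IsProbabilityMeasure μ]
    [IsProbabilityMeasure ν] {S : Set (α × β)} (hS : MeasurableSet S) {p b : ℝ}
    (hp : p ∈ Set.Icc (0 : ℝ) 1) (hb : 0 ≤ b) {B : Set α}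
    (h : ∀ a ∉ B, |ν.real (Prod.mk a ⁻¹' S) - p| ≤ b) :
    |(μ.prod ν).real S - p| ≤ b + μ.real B := by
  have section_measurable := measurable_measure_prodMk_left (ν := ν) hS
  have measureReal_eq : (μ.prod ν).real S = ∫ a, ν.real (Prod.mk a ⁻¹' S) ∂μ := by
    rw [measureReal_def, Measure.prod_apply hS]
    exact (integral_toReal section_measurable.aemeasurable
      (ae_of_all _ fun _ => measure_lt_top _ _)).symm
  rw [measureReal_eq]
  exact abs_integral_sub_le_add_measureReal section_measurable.ennreal_toReal
    (fun _ => ⟨measureReal_nonneg, measureReal_le_one⟩) hp hb h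

end Conditioning

section Measurability

variable {d n₁ n₂ n m : ℕ} {k : Vec d → Vec d → ℝ}

lemma measurable_linearKernel : Measurable (Function.uncurry (linearKernel (d := d))) := by
  unfold linearKernel Function.uncurry
  fun_prop

lemma measurable_witness (hk : Measurable (Function.uncurry k)) :
    Measurable fun q : ((Fin n₁ → Vec d) × (Fin n₂ → Vec d)) × Vec d =>
      witness k q.1.1 q.1.2 q.2 := by
  have eval_sum {n : ℕ} : Measurable fun q : (Fin n → Vec d) × Vec d => ∑ i, k (q.1 i) q.2 :=
    Finset.measurable_fun_sum _ fun i _ =>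
      Measurable.comp (f := fun q : (Fin n → Vec d) × Vec d => (q.1 i, q.2)) hk (by fun_prop)
  exact ((eval_sum.comp (measurable_fst.fst.prodMk measurable_snd)).div_const _).sub
    ((eval_sum.comp (measurable_fst.snd.prodMk measurable_snd)).div_const _)

variable {est : Regression d (n / 2)}

lemma measurable_crossFit_witness (hest : MeasurableRegression k n₁ n₂ est) (i : Fin (n + m)) :
    Measurable fun q : ((Fin n₁ → Vec d) × (Fin n₂ → Vec d)) ×
      ((Fin n → Vec d × Vec d) × (Fin m → Vec d)) =>
        crossFit est (witness k q.1.1 q.1.2) q.2.1 q.2.2 i := by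
  simp only [crossFit_eq]
  exact Measurable.comp hest (measurable_fst.prodMk
    (((measurable_trainingFold i).comp measurable_snd.fst).prodMk
      ((measurable_covariates i).comp measurable_snd)))

lemma measurable_residual_witness (hk : Measurable (Function.uncurry k))
    (hest : MeasurableRegression k n₁ n₂ est) (i : Fin n) :
    Measurable fun q : ((Fin n₁ → Vec d) × (Fin n₂ → Vec d)) ×
      ((Fin n → Vec d × Vec d) × (Fin m → Vec d)) =>
        residual est (witness k q.1.1 q.1.2) q.2.1 q.2.2 i := by
  have response : Measurable fun q : ((Fin n₁ → Vec d) × (Fin n₂ → Vec d)) ×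
      ((Fin n → Vec d × Vec d) × (Fin m → Vec d)) => (q.1, (q.2.1 i).1) := by fun_prop
  exact ((measurable_witness hk).comp response).sub
    (measurable_crossFit_witness hest (Fin.castAdd m i))

lemma measurable_crossMean_witness (hk : Measurable (Function.uncurry k))
    (hest : MeasurableRegression k n₁ n₂ est) :
    Measurable fun q : ((Fin n₁ → Vec d) × (Fin n₂ → Vec d)) ×
      ((Fin n → Vec d × Vec d) × (Fin m → Vec d)) =>
        crossMean est (witness k q.1.1 q.1.2) q.2.1 q.2.2 := by
  have fit := fun i => measurable_crossFit_witness (m := m) hest i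
  have residual := fun i => measurable_residual_witness (m := m) hk hest i
  unfold crossMean empMean
  fun_prop

lemma measurable_crossVar_witness (hk : Measurable (Function.uncurry k))
    (hest : MeasurableRegression k n₁ n₂ est) :
    Measurable fun q : ((Fin n₁ → Vec d) × (Fin n₂ → Vec d)) ×
      ((Fin n → Vec d × Vec d) × (Fin m → Vec d)) =>
        crossVar est (witness k q.1.1 q.1.2) q.2.1 q.2.2 := by
  have fit := fun i => measurable_crossFit_witness (m := m) hest i
  have residual := fun i => measurable_residual_witness (m := m) hk hest i
  unfold crossVar empVar empMean
  fun_prop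

lemma measurableSet_rejectionRegion_witness {n' m' : ℕ} {estX : Regression d (n / 2)}
    {estY : Regression d (n' / 2)} (hk : Measurable (Function.uncurry k))
    (hestX : MeasurableRegression k n₁ n₂ estX) (hestY : MeasurableRegression k n₁ n₂ estY)
    (t : ℝ) :
    MeasurableSet {q : ((Fin n₁ → Vec d) × (Fin n₂ → Vec d)) ×
      (((Fin n → Vec d × Vec d) × (Fin m → Vec d)) ×
        ((Fin n' → Vec d × Vec d) × (Fin m' → Vec d))) |
      q.2 ∈ rejectionRegion estX estY (witness k q.1.1 q.1.2) t} := by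
  have fst_group {α β γ : Type} [MeasurableSpace α] [MeasurableSpace β] [MeasurableSpace γ] :
      Measurable fun q : α × β × γ => (q.1, q.2.1) := by fun_prop
  have snd_group {α β γ : Type} [MeasurableSpace α] [MeasurableSpace β] [MeasurableSpace γ] :
      Measurable fun q : α × β × γ => (q.1, q.2.2) := by fun_prop
  exact measurableSet_lt measurable_const
    ((((measurable_crossMean_witness hk hestX).comp fst_group).sub
      ((measurable_crossMean_witness hk hestY).comp snd_group)).div
    (((measurable_crossVar_witness hk hestX).comp fst_group).add
      ((measurable_crossVar_witness hk hestY).comp snd_group)).sqrt)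

lemma MeasurableRegression.measurable_uncurry {h : ℕ} {est : Regression d h}
    (hest : MeasurableRegression k n₁ n₂ est) (g : (Fin n₁ → Vec d) × (Fin n₂ → Vec d)) :
    Measurable (Function.uncurry (est (witness k g.1 g.2))) :=
  Measurable.comp (f := fun p : (Fin h → Vec d × Vec d) × Vec d => (g, p)) hest (by fun_prop)

end Measurability

section Experiment

variable {d n₁ n₂ m₁ m₂ : ℕ} {P Q : Measure (Vec d × Vec d)} [IsProbabilityMeasure P]
  [IsProbabilityMeasure Q]

lemma measurePreserving_dataLaw :
    MeasurePreserving (measurableProdProdProdComm (Fin n₁ → Vec d) _ (Fin n₂ → Vec d) _)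
      (dataLaw P Q n₁ n₂ m₁ m₂)
      ((witnessLaw P Q n₁ n₂).prod ((sampleLaw P n₁ m₁).prod (sampleLaw Q n₂ m₂))) :=
  measurePreserving_prodProdProdComm (Measure.pi fun _ : Fin n₁ => P.fst)
    (sampleLaw P n₁ m₁) (Measure.pi fun _ : Fin n₂ => Q.fst) (sampleLaw Q n₂ m₂)

lemma power_eq_measureReal_rejectionRegion (k : Vec d → Vec d → ℝ) (estX : Regression d (n₁ / 2))
    (estY : Regression d (n₂ / 2)) (α : ℝ) :
    power k P Q n₁ n₂ m₁ m₂ estX estY α =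
      ((witnessLaw P Q n₁ n₂).prod ((sampleLaw P n₁ m₁).prod (sampleLaw Q n₂ m₂))).real
        {q | q.2 ∈ rejectionRegion estX estY (witness k q.1.1 q.1.2) (z (1 - α))} := by
  rw [measureReal_def, ← measurePreserving_dataLaw.measure_preimage_equiv]
  rfl

lemma witnessLaw_real_eq_dataLaw (B : Set ((Fin n₁ → Vec d) × (Fin n₂ → Vec d))) :
    (witnessLaw P Q n₁ n₂).real B = (dataLaw P Q n₁ n₂ m₁ m₂).real {D | (D.1.1, D.2.1) ∈ B} := by
  have cylinder := (measurePreserving_dataLaw (P := P) (Q := Q) (m₁ := m₁)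
    (m₂ := m₂)).measure_preimage_equiv (B ×ˢ Set.univ)
  rw [Measure.prod_prod, measure_univ, mul_one, Set.prod_univ] at cylinder
  rw [measureReal_def, ← cylinder]
  rfl

end Experiment

/-! ### The power along a fixed experiment -/

lemma abs_inv_sqrt_sub_inv_sqrt_le {r x y : ℝ} (hr : 0 < r) (hx : r ≤ x) (hy : r ≤ y) :
    |(√x)⁻¹ - (√y)⁻¹| ≤ |x - y| / (2 * (r * √r)) := by
  have root_pos : 0 < √r := Real.sqrt_pos.2 hr
  have root_le_x := Real.sqrt_le_sqrt hx
  have root_le_y := Real.sqrt_le_sqrt hy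
  have x_pos := root_pos.trans_le root_le_x
  have y_pos := root_pos.trans_le root_le_y
  have rationalized : (√x)⁻¹ - (√y)⁻¹ = (y - x) / (√x * √y * (√x + √y)) := by
    field_simp
    linear_combination Real.sq_sqrt (hr.le.trans hy) - Real.sq_sqrt (hr.le.trans hx)
  rw [rationalized, abs_div, abs_sub_comm y x, abs_of_pos (by positivity : 0 < _ * _ * (√x + √y))]
  refine div_le_div_of_nonneg_left (abs_nonneg _) (by positivity) ?_
  calc 2 * (r * √r) = √r * √r * (√r + √r) := by rw [Real.mul_self_sqrt hr.le]; ring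
    _ ≤ √x * √y * (√x + √y) := by gcongr

lemma abs_div_sqrt_sub_div_sqrt_le {r x y u v : ℝ} (hr : 0 < r) (hx : r ≤ x) (hy : r ≤ y) :
    |u / √x - v / √y| ≤ |u - v| / √r + |v| * (|x - y| / (2 * (r * √r))) := by
  calc |u / √x - v / √y|
    _ = |(u - v) / √x + v * ((√x)⁻¹ - (√y)⁻¹)| := by ring_nf
    _ ≤ |u - v| / √x + |v| * |(√x)⁻¹ - (√y)⁻¹| := by
      grw [abs_add_le, abs_div, abs_mul, abs_of_nonneg (Real.sqrt_nonneg x)]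
    _ ≤ |u - v| / √r + |v| * (|x - y| / (2 * (r * √r))) := by
      have : 0 < √r := Real.sqrt_pos.2 hr
      gcongr
      exact abs_inv_sqrt_sub_inv_sqrt_le hr hx hy

lemma abs_signal_sub_le {q q' q₀ κ s b N : ℝ} (hN : 0 < N) (hb : 0 ≤ b) (hq₀ : 0 < q₀)
    (hq' : q₀ ≤ q') (hκ : κ ≤ q₀ / 2) (hq : |q - q'| ≤ κ) (hs : |√N * (s - b)| ≤ κ) :
    |s / √(2 * q / N) - √N * b / √(2 * q')| ≤ κ * (1 / √q₀ + √N * b / (q₀ * √q₀)) := by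
  have q_lower : q₀ ≤ 2 * q := by linarith [(abs_le.1 hq).1]
  have : 0 < √q₀ := Real.sqrt_pos.2 hq₀
  have scaled : s / √(2 * q / N) = √N * s / √(2 * q) := by
    rw [Real.sqrt_div (by linarith), div_div_eq_mul_div, mul_comm]
  rw [scaled]
  refine (abs_div_sqrt_sub_div_sqrt_le hq₀ q_lower (by linarith)).trans ?_
  rw [← mul_sub, ← mul_sub, abs_mul 2, abs_two, abs_of_nonneg (by positivity : 0 ≤ √N * b)]
  calc |√N * (s - b)| / √q₀ + √N * b * (2 * |q - q'| / (2 * (q₀ * √q₀)))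
    _ ≤ κ / √q₀ + √N * b * (2 * κ / (2 * (q₀ * √q₀))) := by gcongr
    _ = κ * (1 / √q₀ + √N * b / (q₀ * √q₀)) := by
      field_simp

lemma trainedSq_le_of_relMSE_lt {P : Measure (Vec d × Vec d)} [IsProbabilityMeasure P]
    {f : Vec d → ℝ} {e : Vec d → ℝ} {m : ℝ} {vr ve : ℝ≥0} (h : GaussianRegression P f e m vr ve)
    (hV : 0 < vr + ve) {k : ℕ} {est : Regression d k}
    (hest : Measurable (Function.uncurry (est f))) {ρ : ℝ} (hρ : 0 ≤ ρ)
    (hlt : relMSE P est f < ENNReal.ofReal ρ) :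
    trainedSq P (fun t v => est f t v - e v) ≤ ENNReal.ofReal (ρ * (vr + ve)) := by
  rw [h.relMSE_eq hest] at hlt
  have bound := (ENNReal.div_le_iff (by simpa using hV.ne') ENNReal.coe_ne_top).1 hlt.le
  rwa [← ENNReal.ofReal_coe_nnreal, ← ENNReal.ofReal_mul hρ, NNReal.coe_add] at bound

section GaussianExperiment

variable {d n : ℕ} {μX μV μY μW : Vec d} {S₁₁ S₁₂ S₂₁ S₂₂ : Matrix (Fin d) (Fin d) ℝ}

lemma abs_conditional_power_sub_Phi_inner_le
    (hS : (Matrix.fromBlocks S₁₁ S₁₂ S₂₁ S₂₂).PosSemidef) (h₂₂ : IsUnit S₂₂) (hn : Even n)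
    (hn0 : 0 < n) {a : Vec d} {estX estY : Regression d (n / 2)}
    (hestX : Measurable (Function.uncurry (estX fun x => ⟪a, x⟫)))
    (hestY : Measurable (Function.uncurry (estY fun x => ⟪a, x⟫))) {α κ : ℝ}
    (hα : α ∈ Set.Ioo 0 1) (hκ : 0 < κ) (hκ1 : κ ≤ 1)
    (hX : relMSE (gaussianPair μX μV S₁₁ S₁₂ S₂₁ S₂₂) estX (fun x => ⟪a, x⟫) <
      ENNReal.ofReal (κ ^ 4))
    (hY : relMSE (gaussianPair μY μW S₁₁ S₁₂ S₂₁ S₂₂) estY (fun x => ⟪a, x⟫) <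
      ENNReal.ofReal (κ ^ 4))
    (hpos : 0 < a.ofLp ⬝ᵥ (oracleCov S₁₁ S₁₂ S₂₁ S₂₂ *ᵥ a.ofLp)) :
    |((sampleLaw (gaussianPair μX μV S₁₁ S₁₂ S₂₁ S₂₂) n n).prod
        (sampleLaw (gaussianPair μY μW S₁₁ S₁₂ S₂₁ S₂₂) n n)).real
          (rejectionRegion estX estY (fun x => ⟪a, x⟫) (z (1 - α))) -
      Phi (z α + ⟪μX - μY, a⟫ /
        √(2 * (a.ofLp ⬝ᵥ (oracleCov S₁₁ S₁₂ S₂₁ S₂₂ *ᵥ a.ofLp)) / n))| ≤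
    κ * (|z (1 - α)| + 21) + 8 * (fourthMoment + 2) / (√n * κ) := by
  have noise_coe := Real.coe_toNNReal _ (noiseVar_nonneg hS h₂₂ a)
  have fit_coe := Real.coe_toNNReal _ (fitVar_nonneg hS h₂₂ a)
  have variance_pos : 0 < (noiseVar S₁₁ S₁₂ S₂₁ S₂₂ a).toNNReal +
      (fitVar S₁₂ S₂₁ S₂₂ a).toNNReal := by
    rw [dotProduct_oracleCov_mulVec] at hpos
    rw [← NNReal.coe_pos, NNReal.coe_add, noise_coe, fit_coe]
    linarith [fitVar_nonneg hS h₂₂ a]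
  have regX := gaussianRegression_gaussianPair (μ₁ := μX) (μ₂ := μV) hS h₂₂ a
  have regY := gaussianRegression_gaussianPair (μ₁ := μY) (μ₂ := μW) hS h₂₂ a
  have hκ4 : 0 < κ ^ 4 := by positivity
  have power_bound := abs_conditional_power_sub_le regX regY hn hn0 hestX hestY variance_pos hκ4
    (pow_le_one₀ hκ.le hκ1) hκ hκ1
    (trainedSq_le_of_relMSE_lt regX variance_pos hestX hκ4.le hX)
    (trainedSq_le_of_relMSE_lt regY variance_pos hestY hκ4.le hY) (z (1 - α))
  have neg_quantile : -z (1 - α) = z α := by rw [z_one_sub hα, neg_neg]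
  rw [noise_coe, fit_coe, neg_quantile, ← inner_sub_right, real_inner_comm,
    ← dotProduct_oracleCov_mulVec] at power_bound
  have sqrt_pow_four : √(κ ^ 4) = κ ^ 2 := by
    rw [show κ ^ 4 = (κ ^ 2) ^ 2 by ring, Real.sqrt_sq (by positivity)]
  rw [sqrt_pow_four] at power_bound
  refine power_bound.trans ?_
  have sq_le : κ ^ 2 ≤ κ := pow_le_of_le_one hκ.le hκ1 two_ne_zero
  calc _ = κ * (|z (1 - α)| + 1) + 8 * κ ^ 2 + 12 * κ + 8 * (fourthMoment + 2) / (√n * κ) := by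
        field_simp
        ring
    _ ≤ κ * (|z (1 - α)| + 21) + 8 * (fourthMoment + 2) / (√n * κ) := by linarith

lemma abs_conditional_power_sub_signal_le
    (hS : (Matrix.fromBlocks S₁₁ S₁₂ S₂₁ S₂₂).PosSemidef) (h₂₂ : IsUnit S₂₂) (hn : Even n)
    (hn0 : 0 < n) {a : Vec d} {estX estY : Regression d (n / 2)}
    (hestX : Measurable (Function.uncurry (estX fun x => ⟪a, x⟫)))
    (hestY : Measurable (Function.uncurry (estY fun x => ⟪a, x⟫))) {α κ q₀ q : ℝ}
    (hα : α ∈ Set.Ioo 0 1) (hκ : 0 < κ) (hκ1 : κ ≤ 1) (hκq : κ ≤ q₀ / 2) (hq : q₀ ≤ q)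
    (hX : relMSE (gaussianPair μX μV S₁₁ S₁₂ S₂₁ S₂₂) estX (fun x => ⟪a, x⟫) <
      ENNReal.ofReal (κ ^ 4))
    (hY : relMSE (gaussianPair μY μW S₁₁ S₁₂ S₂₁ S₂₂) estY (fun x => ⟪a, x⟫) <
      ENNReal.ofReal (κ ^ 4))
    (hvar : |a.ofLp ⬝ᵥ (oracleCov S₁₁ S₁₂ S₂₁ S₂₂ *ᵥ a.ofLp) - q| ≤ κ)
    (hmean : |√n * (⟪μX - μY, a⟫ - ‖μX - μY‖ ^ 2)| ≤ κ) :
    |((sampleLaw (gaussianPair μX μV S₁₁ S₁₂ S₂₁ S₂₂) n n).prod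
        (sampleLaw (gaussianPair μY μW S₁₁ S₁₂ S₂₁ S₂₂) n n)).real
          (rejectionRegion estX estY (fun x => ⟪a, x⟫) (z (1 - α))) -
      Phi (z α + √n * ‖μX - μY‖ ^ 2 / √(2 * q))| ≤
    κ * (|z (1 - α)| + 21 + 1 / √q₀ + √n * ‖μX - μY‖ ^ 2 / (q₀ * √q₀)) +
      8 * (fourthMoment + 2) / (√n * κ) := by
  have form_pos : 0 < a.ofLp ⬝ᵥ (oracleCov S₁₁ S₁₂ S₂₁ S₂₂ *ᵥ a.ofLp) := by
    linarith [(abs_le.1 hvar).1]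
  have power_bound := abs_conditional_power_sub_Phi_inner_le (μX := μX) (μV := μV) (μY := μY)
    (μW := μW) hS h₂₂ hn hn0 hestX hestY hα hκ hκ1 hX hY form_pos
  have signal_bound := abs_signal_sub_le (by positivity) (sq_nonneg _) (by linarith) hq hκq hvar
    hmean
  rw [← add_sub_add_left_eq_sub _ _ (z α)] at signal_bound
  replace signal_bound := (abs_Phi_sub_le _ _).trans signal_bound
  refine (abs_sub_le _ _ _).trans ((add_le_add power_bound signal_bound).trans_eq ?_)
  ring

end GaussianExperiment

section ExceptionalSet

variable {d n : ℕ} {μX μV μY μW : Vec d} {S₁₁ S₁₂ S₂₁ S₂₂ : Matrix (Fin d) (Fin d) ℝ} {C κ : ℝ}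

/-- The samples `(X̃, Ỹ)` for which the conditional power of the test given `f̂ = ⟪a, ·⟫` need not
be within `O(κ)` of its limit: those with a large regression error in one of the groups, or for
which `⟪a, A a⟫` or `√n ⟪δ, a⟫` is not within `κ` of `q` respectively `√n ‖δ‖ ^ 2`. -/
def exceptionalSet (P Q : Measure (Vec d × Vec d)) (A : Matrix (Fin d) (Fin d) ℝ) (δ : Vec d)
    (estX estY : Regression d (n / 2)) (q κ : ℝ) : Set ((Fin n → Vec d) × (Fin n → Vec d)) :=
  {g | ENNReal.ofReal (κ ^ 4) ≤ relMSE P estX (witness linearKernel g.1 g.2)} ∪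
    {g | ENNReal.ofReal (κ ^ 4) ≤ relMSE Q estY (witness linearKernel g.1 g.2)} ∪
    {g | κ ≤ |(witnessVec g).ofLp ⬝ᵥ (A *ᵥ (witnessVec g).ofLp) - q|} ∪
    {g | κ ≤ |√n * (⟪δ, witnessVec g⟫ - ‖δ‖ ^ 2)|}

lemma abs_power_sub_Phi_le (hS : (Matrix.fromBlocks S₁₁ S₁₂ S₂₁ S₂₂).PosSemidef)
    (h₂₂ : IsUnit S₂₂) (hn : Even n) (hn0 : 0 < n) {estX estY : Regression d (n / 2)}
    (hestX : MeasurableRegression linearKernel n n estX)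
    (hestY : MeasurableRegression linearKernel n n estY) {α q₀ q : ℝ} (hα : α ∈ Set.Ioo 0 1)
    (hκ : 0 < κ) (hκ1 : κ ≤ 1) (hκq : κ ≤ q₀ / 2) (hq : q₀ ≤ q)
    {P Q : Measure (Vec d × Vec d)} (hP : P = gaussianPair μX μV S₁₁ S₁₂ S₂₁ S₂₂)
    (hQ : Q = gaussianPair μY μW S₁₁ S₁₂ S₂₁ S₂₂) :
    |power linearKernel P Q n n n n estX estY α -
        Phi (z α + √n * ‖μX - μY‖ ^ 2 / √(2 * q))| ≤
      κ * (|z (1 - α)| + 21 + 1 / √q₀ + √n * ‖μX - μY‖ ^ 2 / (q₀ * √q₀)) +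
        8 * (fourthMoment + 2) / (√n * κ) +
        (witnessLaw P Q n n).real (exceptionalSet P Q (oracleCov S₁₁ S₁₂ S₂₁ S₂₂) (μX - μY)
          estX estY q κ) := by
  subst hP hQ
  have hK := fourthMoment_nonneg
  have q₀_pos : 0 < q₀ := by linarith
  rw [power_eq_measureReal_rejectionRegion]
  refine abs_measureReal_prod_sub_le _ _
    (measurableSet_rejectionRegion_witness measurable_linearKernel hestX hestY _)
    ⟨cdf_nonneg _ _, cdf_le_one _ _⟩ (by positivity) fun g hg => ?_
  have hestX_g := hestX.measurable_uncurry g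
  have hestY_g := hestY.measurable_uncurry g
  simp only [exceptionalSet, Set.mem_union, Set.mem_ofPred_eq, not_or, not_le] at hg
  obtain ⟨⟨⟨errorX, errorY⟩, variance_close⟩, mean_close⟩ := hg
  rw [witness_linearKernel] at errorX errorY hestX_g hestY_g
  have bound := abs_conditional_power_sub_signal_le hS h₂₂ hn hn0 hestX_g hestY_g hα hκ hκ1 hκq hq
    errorX errorY variance_close.le mean_close.le
  rwa [← witness_linearKernel] at bound

lemma witnessLaw_real_abs_quadratic_sub_trace_ge_le
    (hS : (Matrix.fromBlocks S₁₁ S₁₂ S₂₁ S₂₂).PosSemidef) (h₂₂ : IsUnit S₂₂) (hn : 0 < n)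
    (hC : 0 ≤ C) (hS₁₁ : ∀ y ∈ spectrum ℝ S₁₁, y ≤ C) (hκ : 0 < κ) :
    (witnessLaw (gaussianPair μX μV S₁₁ S₁₂ S₂₁ S₂₂) (gaussianPair μY μW S₁₁ S₁₂ S₂₁ S₂₂) n n).real
        {g | κ ≤ |(witnessVec g).ofLp ⬝ᵥ (oracleCov S₁₁ S₁₂ S₂₁ S₂₂ *ᵥ (witnessVec g).ofLp) -
          (oracleCov S₁₁ S₁₂ S₂₁ S₂₂ * ((2 / n : ℝ) • S₁₁)).trace|} ≤
      (3 * (d * (fourthMoment * (C * (2 / n * C)) ^ 2)) +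
        12 * (2 / n * C * (C ^ 2 * ‖μX - μY‖ ^ 2)) + 3 * (C * ‖μX - μY‖ ^ 2) ^ 2) / κ ^ 2 := by
  have hK := fourthMoment_nonneg
  have posSemidef₁₁ := posSemidef_fst_block hS
  have upper := dotProduct_mulVec_le_of_spectrum_le posSemidef₁₁.isHermitian hS₁₁
  have second_moment := lintegral_quadratic_sub_trace_sq_le (μX - μY)
    (posSemidef₁₁.smul (by positivity : (0 : ℝ) ≤ 2 / n)) (posSemidef_oracleCov hS h₂₂) hC
    (by positivity : 0 ≤ 2 / n * C)
    (fun x => (dotProduct_oracleCov_le_dotProduct hS h₂₂ x).trans (upper x))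
    (fun x => by
      rw [Matrix.smul_mulVec, dotProduct_smul, smul_eq_mul, mul_assoc]
      gcongr
      exact upper x)
  rw [← (hasLaw_witnessVec (μV := μV) (μW := μW) hS posSemidef₁₁ hn).lintegral_comp
    (by fun_prop), Fintype.card_fin] at second_moment
  simp only [← pow_le_pow_iff_left₀ hκ.le (abs_nonneg _) two_ne_zero, sq_abs]
  exact measureReal_ge_le_of_lintegral_le (by fun_prop) (by positivity) (by positivity)
    second_moment

lemma witnessLaw_real_abs_inner_sub_ge_le
    (hS : (Matrix.fromBlocks S₁₁ S₁₂ S₂₁ S₂₂).PosSemidef) (hn : 0 < n) (hC : 0 ≤ C)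
    (hS₁₁ : ∀ y ∈ spectrum ℝ S₁₁, y ≤ C) (hκ : 0 < κ) :
    (witnessLaw (gaussianPair μX μV S₁₁ S₁₂ S₂₁ S₂₂) (gaussianPair μY μW S₁₁ S₁₂ S₂₁ S₂₂) n n).real
        {g | κ ≤ |√n * (⟪μX - μY, witnessVec g⟫ - ‖μX - μY‖ ^ 2)|} ≤
      2 * C * ‖μX - μY‖ ^ 2 / κ ^ 2 := by
  have n_pos : (0 : ℝ) < n := by positivity
  have posSemidef₁₁ := posSemidef_fst_block hS
  have variance_le : (μX - μY).ofLp ⬝ᵥ (((2 / n : ℝ) • S₁₁) *ᵥ (μX - μY).ofLp) ≤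
      2 / n * (C * ‖μX - μY‖ ^ 2) := by
    rw [Matrix.smul_mulVec, dotProduct_smul, smul_eq_mul, norm_sq_eq_dotProduct]
    gcongr
    exact dotProduct_mulVec_le_of_spectrum_le posSemidef₁₁.isHermitian hS₁₁ _
  have second_moment := lintegral_inner_sub_sq_multivariateGaussian (μX - μY)
    (posSemidef₁₁.smul (by positivity : (0 : ℝ) ≤ 2 / n)) (μX - μY)
  rw [← (hasLaw_witnessVec (μV := μV) (μW := μW) hS posSemidef₁₁ hn).lintegral_comp
    (f := fun a => ENNReal.ofReal ((⟪μX - μY, a⟫ - ⟪μX - μY, μX - μY⟫) ^ 2)) (by fun_prop),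
    real_inner_self_eq_norm_sq] at second_moment
  simp only [← pow_le_pow_iff_left₀ hκ.le (abs_nonneg _) two_ne_zero, sq_abs, mul_pow,
    Real.sq_sqrt n_pos.le, ← div_le_iff₀' n_pos]
  refine (measureReal_ge_le_of_lintegral_le (by fun_prop) (by positivity) (by positivity)
    (second_moment.trans_le (ENNReal.ofReal_le_ofReal variance_le))).trans_eq ?_
  field_simp

lemma witnessLaw_real_exceptionalSet_le (P Q : Measure (Vec d × Vec d)) [IsProbabilityMeasure P]
    [IsProbabilityMeasure Q] (A : Matrix (Fin d) (Fin d) ℝ) (δ : Vec d)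
    (estX estY : Regression d (n / 2)) (q κ : ℝ) :
    (witnessLaw P Q n n).real (exceptionalSet P Q A δ estX estY q κ) ≤
      (dataLaw P Q n n n n).real
        {D | ENNReal.ofReal (κ ^ 4) ≤ relMSE P estX (dataWitness linearKernel D)} +
      (dataLaw P Q n n n n).real
        {D | ENNReal.ofReal (κ ^ 4) ≤ relMSE Q estY (dataWitness linearKernel D)} +
      (witnessLaw P Q n n).real
        {g | κ ≤ |(witnessVec g).ofLp ⬝ᵥ (A *ᵥ (witnessVec g).ofLp) - q|} +
      (witnessLaw P Q n n).real {g | κ ≤ |√n * (⟪δ, witnessVec g⟫ - ‖δ‖ ^ 2)|} := by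
  refine (measureReal_union_le _ _).trans (add_le_add_left ((measureReal_union_le _ _).trans
    (add_le_add_left ((measureReal_union_le _ _).trans_eq ?_) _)) _)
  rw [witnessLaw_real_eq_dataLaw (m₁ := n) (m₂ := n), witnessLaw_real_eq_dataLaw (m₁ := n)
    (m₂ := n)]
  rfl

end ExceptionalSet

/-! ### Asymptotics -/

section TraceOracleCov

variable {d n : ℕ} {S₁₁ S₁₂ S₂₁ S₂₂ : Matrix (Fin d) (Fin d) ℝ}

lemma sqrt_mul_div_sqrt_two_mul_trace (hn : 0 < n) (D : ℝ) :
    √n * D / √(2 * (oracleCov S₁₁ S₁₂ S₂₁ S₂₂ * ((2 / n : ℝ) • S₁₁)).trace) =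
      n * D / √(4 * (S₁₁ ^ 2).trace - 2 * (S₁₂ * S₂₂⁻¹ * S₂₁ * S₁₁).trace) := by
  have n_pos : (0 : ℝ) < n := by positivity
  rw [← four_mul_trace_oracleCov_mul, Matrix.mul_smul, Matrix.trace_smul, smul_eq_mul]
  set q := (oracleCov S₁₁ S₁₂ S₂₁ S₂₂ * S₁₁).trace
  rw [show 2 * (2 / n * q) = 4 * q / n by ring, Real.sqrt_div' _ n_pos.le, div_div_eq_mul_div]
  congr 1
  linear_combination D * Real.mul_self_sqrt n_pos.le

lemma le_trace_oracleCov_mul (hS : (Matrix.fromBlocks S₁₁ S₁₂ S₂₁ S₂₂).PosSemidef)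
    (h₂₂ : IsUnit S₂₂) {c : ℝ} (hc : 0 ≤ c) (hS₁₁ : ∀ y ∈ spectrum ℝ S₁₁, c ≤ y) :
    c ^ 2 * (d / n) ≤ (oracleCov S₁₁ S₁₂ S₂₁ S₂₂ * ((2 / n : ℝ) • S₁₁)).trace := by
  have posSemidef₁₁ := posSemidef_fst_block hS
  have lower := le_dotProduct_mulVec_of_le_spectrum posSemidef₁₁.isHermitian hS₁₁
  have trace_lower := le_trace_mul (cA := c / 2) (cT := 2 / n * c)
    (posSemidef₁₁.smul (by positivity : (0 : ℝ) ≤ 2 / n)) (by positivity)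
    (fun x => (by linarith [lower x] : c / 2 * (x ⬝ᵥ x) ≤ x ⬝ᵥ (S₁₁ *ᵥ x) / 2).trans
      (half_dotProduct_le_dotProduct_oracleCov hS h₂₂ x))
    (fun x => by
      rw [Matrix.smul_mulVec, dotProduct_smul, smul_eq_mul, mul_assoc]
      gcongr
      exact lower x)
  refine le_of_eq_of_le ?_ trace_lower
  rw [Fintype.card_fin]
  ring

end TraceOracleCov

section Limits

variable {ι : Type*} {l : Filter ι} {n d : ι → ℕ} {τ : ℝ} {D : ι → ℝ}

lemma norm_sub_sq_isBigO {E : ι → Type*} [∀ j, SeminormedAddCommGroup (E j)] {x y : ∀ j, E j}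
    {g : ι → ℝ} (hx : (fun j => ‖x j‖ ^ 2) =O[l] g) (hy : (fun j => ‖y j‖ ^ 2) =O[l] g) :
    (fun j => ‖x j - y j‖ ^ 2) =O[l] g := by
  refine (Asymptotics.IsBigO.of_bound 2 (Eventually.of_forall fun j => ?_)).trans (hx.add hy)
  rw [Real.norm_of_nonneg (by positivity), Real.norm_of_nonneg (by positivity)]
  calc ‖x j - y j‖ ^ 2 ≤ (‖x j‖ + ‖y j‖) ^ 2 := by gcongr; exact norm_sub_le _ _
    _ ≤ 2 * (‖x j‖ ^ 2 + ‖y j‖ ^ 2) := add_sq_le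

lemma exists_sqrt_mul_le_of_isBigO (hd : Tendsto (fun j => (d j / n j : ℝ)) l (𝓝 τ))
    (hD : D =O[l] fun j => √(d j : ℝ) / (n j : ℝ)) :
    ∃ M : ℝ, 0 ≤ M ∧ ∀ᶠ j in l, √(n j) * D j ≤ M := by
  have scaled : (fun j => √(n j : ℝ) * D j) =O[l] fun j => √((d j : ℝ) / n j) := by
    refine ((Asymptotics.isBigO_refl (fun j => √(n j : ℝ)) l).mul hD).congr_right fun j => ?_
    rw [Real.sqrt_div (by positivity), ← mul_div_assoc, mul_div_right_comm, Real.sqrt_div_self']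
    ring
  obtain ⟨M, hM, bound⟩ := (scaled.trans (hd.sqrt.isBigO_one ℝ)).exists_nonneg
  refine ⟨M, hM, bound.bound.mono fun j hj => ?_⟩
  simpa using (le_abs_self _).trans hj

lemma tendsto_sqrt_natCast_atTop (hn : Tendsto n l atTop) :
    Tendsto (fun j => √(n j : ℝ)) l atTop :=
  Real.tendsto_sqrt_atTop.comp (tendsto_natCast_atTop_atTop.comp hn)

lemma tendsto_zero_of_sqrt_mul_le (hn : Tendsto n l atTop) (hD : ∀ j, 0 ≤ D j) {M : ℝ}
    (h : ∀ᶠ j in l, √(n j) * D j ≤ M) : Tendsto D l (𝓝 0) := by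
  have root := tendsto_sqrt_natCast_atTop hn
  refine tendsto_of_tendsto_of_tendsto_of_le_of_le' tendsto_const_nhds
    (root.const_div_atTop M) (Eventually.of_forall hD) ?_
  filter_upwards [h, root.eventually_gt_atTop 0] with j hj root_pos
  rwa [le_div_iff₀ root_pos, mul_comm]

lemma tendsto_quadratic_variance (hn : Tendsto n l atTop)
    (hd : Tendsto (fun j => (d j / n j : ℝ)) l (𝓝 τ)) (hD : Tendsto D l (𝓝 0)) (K C : ℝ) :
    Tendsto (fun j => 3 * (d j * (K * (C * (2 / n j * C)) ^ 2)) +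
      12 * (2 / n j * C * (C ^ 2 * D j)) + 3 * (C * D j) ^ 2) l (𝓝 0) := by
  have inv_n : Tendsto (fun j => 2 / (n j : ℝ)) l (𝓝 0) :=
    (tendsto_natCast_atTop_atTop.comp hn).const_div_atTop 2
  have centred := (hd.const_mul (6 * K * C ^ 4)).mul inv_n
  have cross := ((inv_n.mul_const C).mul (hD.const_mul (C ^ 2))).const_mul 12
  have shift := ((hD.const_mul C).pow 2).const_mul 3
  convert (centred.add cross).add shift using 2
  · ring
  · ring

lemma tendsto_zero_of_forall_abs_le {x : ι → ℝ} {r : ℝ → ι → ℝ} {L κ₀ : ℝ} (hκ₀ : 0 < κ₀)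
    (hr : ∀ κ > 0, Tendsto (r κ) l (𝓝 0))
    (h : ∀ κ ∈ Set.Ioc 0 κ₀, ∀ᶠ j in l, |x j| ≤ κ * L + r κ j) : Tendsto x l (𝓝 0) := by
  rw [Metric.tendsto_nhds]
  intro ε hε
  have mul_tendsto : Tendsto (fun κ => κ * L) (𝓝[>] 0) (𝓝 0) := by
    simpa using (tendsto_id.mul_const L).mono_left (nhdsWithin_le_nhds (a := (0 : ℝ)))
  obtain ⟨κ, hκε, hκ⟩ := ((mul_tendsto.eventually_lt_const (half_pos hε)).and
    (Ioc_mem_nhdsGT hκ₀)).exists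
  filter_upwards [h κ hκ, (hr κ hκ.1).eventually_lt_const (half_pos hε)] with j bound small
  rw [Real.dist_eq, sub_zero]
  linarith

end Limits

section Sequence

variable {ι : Type*} {l : Filter ι} {n d : ι → ℕ} {τ C κ : ℝ} {μX μV μY μW : ∀ j, Vec (d j)}
  {S₁₁ S₁₂ S₂₁ S₂₂ : ∀ j, Matrix (Fin (d j)) (Fin (d j)) ℝ}
  {P Q : ∀ j, Measure (Vec (d j) × Vec (d j))}

lemma tendsto_witnessLaw_exceptionalSet (hn : Tendsto n l atTop)
    (hd : Tendsto (fun j => (d j / n j : ℝ)) l (𝓝 τ))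
    (hS : ∀ j, (Matrix.fromBlocks (S₁₁ j) (S₁₂ j) (S₂₁ j) (S₂₂ j)).PosSemidef)
    (h₁₁ : ∀ j, ∀ y ∈ spectrum ℝ (S₁₁ j), y ≤ C) (h₂₂ : ∀ j, IsUnit (S₂₂ j))
    (hδ : Tendsto (fun j => ‖μX j - μY j‖ ^ 2) l (𝓝 0))
    (hP : ∀ j, P j = gaussianPair (μX j) (μV j) (S₁₁ j) (S₁₂ j) (S₂₁ j) (S₂₂ j))
    (hQ : ∀ j, Q j = gaussianPair (μY j) (μW j) (S₁₁ j) (S₁₂ j) (S₂₁ j) (S₂₂ j))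
    {estX estY : ∀ j, Regression (d j) (n j / 2)}
    (hconsX : ∀ ε : ℝ≥0∞, 0 < ε → Tendsto (fun j => dataLaw (P j) (Q j) (n j) (n j) (n j) (n j)
      {D | ε ≤ relMSE (P j) (estX j) (dataWitness linearKernel D)}) l (𝓝 0))
    (hconsY : ∀ ε : ℝ≥0∞, 0 < ε → Tendsto (fun j => dataLaw (P j) (Q j) (n j) (n j) (n j) (n j)
      {D | ε ≤ relMSE (Q j) (estY j) (dataWitness linearKernel D)}) l (𝓝 0)) (hκ : 0 < κ) :
    Tendsto (fun j => (witnessLaw (P j) (Q j) (n j) (n j)).real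
      (exceptionalSet (P j) (Q j) (oracleCov (S₁₁ j) (S₁₂ j) (S₂₁ j) (S₂₂ j)) (μX j - μY j)
        (estX j) (estY j)
        (oracleCov (S₁₁ j) (S₁₂ j) (S₂₁ j) (S₂₂ j) * ((2 / n j : ℝ) • S₁₁ j)).trace κ))
      l (𝓝 0) := by
  obtain rfl : P = _ := funext hP
  obtain rfl : Q = _ := funext hQ
  have threshold_pos : 0 < ENNReal.ofReal (κ ^ 4) := ENNReal.ofReal_pos.2 (by positivity)
  have errorX := (ENNReal.tendsto_toReal ENNReal.zero_ne_top).comp (hconsX _ threshold_pos)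
  have errorY := (ENNReal.tendsto_toReal ENNReal.zero_ne_top).comp (hconsY _ threshold_pos)
  have quadratic := (tendsto_quadratic_variance hn hd hδ fourthMoment (max C 0)).div_const (κ ^ 2)
  have linear := (hδ.const_mul (2 * max C 0)).div_const (κ ^ 2)
  rw [zero_div] at quadratic
  rw [mul_zero, zero_div] at linear
  have total := ((errorX.add errorY).add quadratic).add linear
  simp only [ENNReal.toReal_zero, add_zero] at total
  refine squeeze_zero' (Eventually.of_forall fun _ => measureReal_nonneg) ?_ total
  filter_upwards [hn.eventually_gt_atTop 0] with j hnj
  have upper : ∀ y ∈ spectrum ℝ (S₁₁ j), y ≤ max C 0 := fun y hy => le_max_of_le_left (h₁₁ j y hy)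
  refine (witnessLaw_real_exceptionalSet_le _ _ _ _ _ _ _ _).trans (add_le_add (add_le_add le_rfl
    (witnessLaw_real_abs_quadratic_sub_trace_ge_le (hS j) (h₂₂ j) hnj (le_max_right _ _) upper hκ))
    (witnessLaw_real_abs_inner_sub_ge_le (hS j) hnj (le_max_right _ _) upper hκ))

end Sequence

end XssMMD

open XssMMD in
theorem mainTheorem9_general {ι : Type*} {l : Filter ι} {α : ℝ} (hα : α ∈ Set.Ioo (0 : ℝ) 1)
    {n d : ι → ℕ} (hn : Tendsto n l atTop) (hn_even : ∀ j, Even (n j)) {τ : ℝ} (hτ : 0 < τ)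
    (hd : Tendsto (fun j => (d j : ℝ) / (n j : ℝ)) l (𝓝 τ)) {μX μV μY μW : ∀ j, Vec (d j)}
    {S₁₁ S₁₂ S₂₁ S₂₂ : ∀ j, Matrix (Fin (d j)) (Fin (d j)) ℝ}
    (hS : ∀ j, (Matrix.fromBlocks (S₁₁ j) (S₁₂ j) (S₂₁ j) (S₂₂ j)).PosSemidef) {c C : ℝ}
    (hc : 0 < c) (h₁₁ : ∀ j, spectrum ℝ (S₁₁ j) ⊆ Set.Icc c C) (h₂₂ : ∀ j, IsUnit (S₂₂ j))
    (hδ : (fun j => ‖μX j - μY j‖ ^ 2) =O[l] fun j => √(d j : ℝ) / (n j : ℝ))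
    {P Q : ∀ j, Measure (Vec (d j) × Vec (d j))}
    (hP : ∀ j, P j = gaussianPair (μX j) (μV j) (S₁₁ j) (S₁₂ j) (S₂₁ j) (S₂₂ j))
    (hQ : ∀ j, Q j = gaussianPair (μY j) (μW j) (S₁₁ j) (S₁₂ j) (S₂₁ j) (S₂₂ j))
    {estX estY : ∀ j, Regression (d j) (n j / 2)}
    (hestX : ∀ j, MeasurableRegression linearKernel (n j) (n j) (estX j))
    (hestY : ∀ j, MeasurableRegression linearKernel (n j) (n j) (estY j))
    (hconsX : ∀ ε : ℝ≥0∞, 0 < ε → Tendsto (fun j => dataLaw (P j) (Q j) (n j) (n j) (n j) (n j)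
      {D | ε ≤ relMSE (P j) (estX j) (dataWitness linearKernel D)}) l (𝓝 0))
    (hconsY : ∀ ε : ℝ≥0∞, 0 < ε → Tendsto (fun j => dataLaw (P j) (Q j) (n j) (n j) (n j) (n j)
      {D | ε ≤ relMSE (Q j) (estY j) (dataWitness linearKernel D)}) l (𝓝 0)) :
    Tendsto (fun j => power linearKernel (P j) (Q j) (n j) (n j) (n j) (n j) (estX j) (estY j) α -
      Phi (z α + (n j : ℝ) * ‖μX j - μY j‖ ^ 2 / √(4 * (S₁₁ j ^ 2).trace -
        2 * (S₁₂ j * (S₂₂ j)⁻¹ * S₂₁ j * S₁₁ j).trace))) l (𝓝 0) := by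
  obtain ⟨M, -, signal_le⟩ := exists_sqrt_mul_le_of_isBigO hd hδ
  have δ_tendsto := tendsto_zero_of_sqrt_mul_le hn (fun j => sq_nonneg ‖μX j - μY j‖) signal_le
  have remainder_tendsto (κ : ℝ) (hκ : 0 < κ) :=
    (((tendsto_sqrt_natCast_atTop hn).atTop_mul_const hκ).const_div_atTop
      (8 * (fourthMoment + 2))).add
    (tendsto_witnessLaw_exceptionalSet hn hd hS (fun j y hy => (h₁₁ j hy).2) h₂₂ δ_tendsto hP hQ
      hconsX hconsY hκ)
  simp only [add_zero] at remainder_tendsto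
  set q₀ := c ^ 2 * (τ / 2)
  have : 0 < q₀ := by positivity
  refine tendsto_zero_of_forall_abs_le (κ₀ := min 1 (q₀ / 2))
    (L := |z (1 - α)| + 21 + 1 / √q₀ + M / (q₀ * √q₀)) (by positivity) remainder_tendsto
    fun κ ⟨κ_pos, κ_le⟩ => ?_
  filter_upwards [signal_le, hn.eventually_gt_atTop 0,
    hd.eventually_const_lt (half_lt_self hτ)] with j signal_le_j n_pos ratio_gt
  have q₀_le := (mul_le_mul_of_nonneg_left ratio_gt.le (sq_nonneg c)).trans
    (le_trace_oracleCov_mul (n := n j) (hS j) (h₂₂ j) hc.le fun y hy => (h₁₁ j hy).1)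
  obtain ⟨κ_le_one, κ_le_q₀⟩ := le_min_iff.1 κ_le
  rw [← sqrt_mul_div_sqrt_two_mul_trace n_pos, ← add_assoc]
  grw [abs_power_sub_Phi_le (hS j) (h₂₂ j) (hn_even j) n_pos (hestX j) (hestY j) hα κ_pos
    κ_le_one κ_le_q₀ q₀_le (hP j) (hQ j), signal_le_j]

theorem mainTheorem9
    (α : ℝ) (hα : α ∈ Set.Ioo (0 : ℝ) 1)
    -- sample size and dimension along the sequence of experiments
    (n d : ℕ → ℕ) (hn : Tendsto n atTop atTop) (hn_even : ∀ j, Even (n j))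
    (τ : ℝ) (hτ : 0 < τ)
    (hd : Tendsto (fun j => (d j : ℝ) / (n j : ℝ)) atTop (𝓝 τ))
    -- means and the common covariance matrix of `(X, V)` and `(Y, W)`
    (μX μV μY μW : ∀ j, XssMMD.Vec (d j))
    (S11 S12 S21 S22 : ∀ j, Matrix (Fin (d j)) (Fin (d j)) ℝ)
    (hS : ∀ j, (Matrix.fromBlocks (S11 j) (S12 j) (S21 j) (S22 j)).PosSemidef)
    -- bounded eigenvalues
    (c C : ℝ) (hc : 0 < c)
    (h11 : ∀ j, spectrum ℝ (S11 j) ⊆ Set.Icc c C)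
    (h22 : ∀ j, spectrum ℝ (S22 j) ⊆ Set.Icc c C)
    -- local alternative
    (hμX : (fun j => ‖μX j‖ ^ 2) =O[atTop] fun j => √(d j : ℝ) / (n j : ℝ))
    (hμY : (fun j => ‖μY j‖ ^ 2) =O[atTop] fun j => √(d j : ℝ) / (n j : ℝ))
    -- the laws of `(X, V)` and of `(Y, W)`
    (P Q : ∀ j, Measure (XssMMD.Vec (d j) × XssMMD.Vec (d j)))
    (hP : ∀ j, P j = XssMMD.gaussianPair (μX j) (μV j) (S11 j) (S12 j) (S21 j) (S22 j))
    (hQ : ∀ j, Q j = XssMMD.gaussianPair (μY j) (μW j) (S11 j) (S12 j) (S21 j) (S22 j))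
    -- the regression procedures and their consistency
    (estX estY : ∀ j, XssMMD.Regression (d j) (n j / 2))
    (hestX : ∀ j, XssMMD.MeasurableRegression XssMMD.linearKernel (n j) (n j) (estX j))
    (hestY : ∀ j, XssMMD.MeasurableRegression XssMMD.linearKernel (n j) (n j) (estY j))
    (hconsX : ∀ ε : ℝ≥0∞, 0 < ε → Tendsto
      (fun j => XssMMD.dataLaw (P j) (Q j) (n j) (n j) (n j) (n j)
        {D | ε ≤ XssMMD.relMSE (P j) (estX j) (XssMMD.dataWitness XssMMD.linearKernel D)})
      atTop (𝓝 0))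
    (hconsY : ∀ ε : ℝ≥0∞, 0 < ε → Tendsto
      (fun j => XssMMD.dataLaw (P j) (Q j) (n j) (n j) (n j) (n j)
        {D | ε ≤ XssMMD.relMSE (Q j) (estY j) (XssMMD.dataWitness XssMMD.linearKernel D)})
      atTop (𝓝 0)) :
    Tendsto
      (fun j =>
        XssMMD.power XssMMD.linearKernel (P j) (Q j) (n j) (n j) (n j) (n j)
            (estX j) (estY j) α
          - XssMMD.Phi (XssMMD.z α + (n j : ℝ) * ‖μX j - μY j‖ ^ 2 /
              √(4 * (S11 j ^ 2).trace
                - 2 * (S12 j * (S22 j)⁻¹ * S21 j * S11 j).trace)))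
      atTop (𝓝 0) :=
  mainTheorem9_general hα hn hn_even hτ hd hS hc h11
    (fun j => XssMMD.isUnit_of_spectrum_pos fun _ hy => hc.trans_le (h22 j hy).1)
    (XssMMD.norm_sub_sq_isBigO hμX hμY) hP hQ hestX hestY hconsX hconsY
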